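/- **Conventions.** A *generalized permutation* $\pi$ is a pair of nonempty words (the top and the bottom line) such that every symbol that is present appears exactly twice in the two lines together. It is *cylindrical* if the first symbol of one line is the last symbol of the other and the set of symbols of neither line is a proper subset of the set of symbols of the other. *Suspensions* over a cylindrical $\pi$ are constructed as follows. Let $\alpha_0$ be the symbol that is first in one line and last in the other. Choose a vector $v_{\alpha_0}\in\mathbb C$ with $\operatorname{Im} v_{\alpha_0}>0$ if $\alpha_0$ is first in the top line (and $<0$ if it is first in the bottom line), and positive real numbers $v_\alpha$ for all other symbols, such that $\sum v_\alpha$ over the top line equals $\sum v_\alpha$ over the bottom line. The two broken lines that start at $0$ and have the sides $v_\alpha$, read along the two lines, bound a parallelogram. Identify the two sides carrying the same symbol by a translation if they lie on different broken lines, and by a central symmetry if they lie on the same one; $dz^2$ induces a complex structure and a quadratic differential $q$ on the glued surface. Let $X$ be the diagonal of the parallelogram from $0$ to the common endpoint of the broken lines. The stratum $\mathcal Q(d_1,\dots,d_n,-1^p)$, with $d_i\ge 1$, consists of the meromorphic quadratic differentials on compact connected Riemann surfaces that are not global squares of Abelian differentials and whose singularities are exactly $n$ zeroes of degrees $d_1,\dots,d_n$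 and $p$ simple poles. A quadratic differential is *Jenkins–Strebel with a single cylinder* if the surface is the closure of one maximal open flat cylinder filled with closed horizontal leaves. We say that $\pi$ *represents* $\mathcal Q(d_1,\dots,d_n,-1^p)$ if $\pi$ is a cylindrical generalized permutation, vectors $v$ as above exist, and for all such vectors the suspension belongs to $\mathcal Q(d_1,\dots,d_n,-1^p)$ and has a singularity of degree $d_1$ at the left endpoint $0$ of $X$. **Proposition.** Let $g\ge 3$ and $p\ge 0$ be integers. For $0\le k\le g-3$ and $0\le l\le p-1$ let $$V(k)=(4+4k,\;4g-1+p+2k,\;7+4k,\;4g+p+2k,\;6+4k,\;4g-1+p+2k,\;5+4k,\;4g+p+2k),$$ $$W(l)=(4g-4+l,\;6g+p-5+l,\;6g+p-5+l),$$ and let $$\pi^{top}=(0,1,2,3,V(0),\dots,V(g-3),W(0),\dots,W(p-1),4g+p-4),$$ $$\pi^{bot}=(4g-3+p,\,3,\,4g-2+p,\,2,\,4g-3+p,\,1,\,4g-2+p,\;4,5,\dots,4g-4+p,\;0),$$ where the words $W$ are omitted if $p=0$. 1. The pair $(\pi^{top},\pi^{bot})$ is a cylindrical generalized permutation, vectors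 $v$ as above exist for it, and for all such vectors its suspension is a Jenkins–Strebel differential with a single cylinder in $\mathcal Q(1^{4g+p-4},-1^p)$. 2. Let $d_1,\dots,d_n$ be positive integers with $d_1+\dots+d_n-p=4g-4$. The generalized permutation obtained from $(\pi^{top},\pi^{bot})$ by erasing, in both lines, for every $j=1,\dots,n$ the block of the $d_j-1$ symbols $$d_1+\dots+d_{j-1}+1,\;\dots,\;d_1+\dots+d_j-1$$ represents the stratum $\mathcal Q(d_1,\dots,d_n,-1^p)$. -/

import Mathlib

open scoped Manifold ContDiff Topology

noncomputable section

/-! ### Quadratic differentials on Riemann surfaces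

A Riemann surface is a `ChartedSpace ℂ S` with `IsManifold 𝓘(ℂ) ω S`. -/

/-- A meromorphic quadratic differential `q` on a Riemann surface, given by its coefficient in every
chart `e` of the atlas: `q = coeff e (z) dz²` with `z` the coordinate of `e`. The coefficients are
meromorphic and transform as `dz²` does. As usual for meromorphic functions, coefficients are only
compared off discrete sets. -/
structure QuadraticDifferential (S : Type*) [TopologicalSpace S] [ChartedSpace ℂ S] where
  coeff : OpenPartialHomeomorph S ℂ → ℂ → ℂ
  meromorphic : ∀ e ∈ atlas ℂ S, MeromorphicOn (coeff e) e.target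
  transition : ∀ e ∈ atlas ℂ S, ∀ e' ∈ atlas ℂ S, ∀ z ∈ (e.symm.trans e').source,
    ∀ᶠ w in 𝓝[≠] z, coeff e w = coeff e' (e' (e.symm w)) * deriv (e' ∘ e.symm) w ^ 2

/-- A holomorphic 1-form (Abelian differential), given by its coefficient in every chart. -/
structure AbelianDifferential (S : Type*) [TopologicalSpace S] [ChartedSpace ℂ S] where
  coeff : OpenPartialHomeomorph S ℂ → ℂ → ℂ
  analytic : ∀ e ∈ atlas ℂ S, AnalyticOnNhd ℂ (coeff e) e.target
  transition : ∀ e ∈ atlas ℂ S, ∀ e' ∈ atlas ℂ S, ∀ z ∈ (e.symm.trans e').source,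
    coeff e z = coeff e' (e' (e.symm z)) * deriv (e' ∘ e.symm) z

namespace QuadraticDifferential

variable {S : Type*} [TopologicalSpace S] [ChartedSpace ℂ S]

/-- The order of `q` at a point: `d > 0` at a zero of degree `d`, `-1` at a simple pole, `0` at a
regular point. -/
def order (q : QuadraticDifferential S) (x : S) : WithTop ℤ :=
  meromorphicOrderAt (q.coeff (chartAt ℂ x)) (chartAt ℂ x x)

/-- `q` is the global square of an Abelian differential. -/
def IsGlobalSquare (q : QuadraticDifferential S) : Prop :=
  ∃ η : AbelianDifferential S, ∀ e ∈ atlas ℂ S, ∀ z ∈ e.target,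
    ∀ᶠ w in 𝓝[≠] z, q.coeff e w = η.coeff e w ^ 2

/-- `(S, q)` belongs to the stratum `𝒬(κ)`: `S` is a compact connected (Hausdorff) surface, `q` is
not a global square, and the orders of `q` at its singularities, with repetition, form `κ`. -/
def InStratum (q : QuadraticDifferential S) (κ : Multiset ℤ) : Prop :=
  CompactSpace S ∧ ConnectedSpace S ∧ T2Space S ∧ ¬ q.IsGlobalSquare ∧
    ∃ sing : Finset S, (∀ x, x ∉ sing → q.order x = 0) ∧
      sing.val.map q.order = κ.map (fun n : ℤ => (n : WithTop ℤ))

/-- On the open set `U ⊆ ℂ` the map `F` is holomorphic and `F^* q = dz²`. -/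
def IsFlatOn (q : QuadraticDifferential S) (F : ℂ → S) (U : Set ℂ) : Prop :=
  ∀ z ∈ U, ∀ e ∈ atlas ℂ S, F z ∈ e.source →
    AnalyticAt ℂ (e ∘ F) z ∧
      ∀ᶠ w in 𝓝[≠] z, q.coeff e (e (F w)) * deriv (e ∘ F) w ^ 2 = 1

/-- `q` is a Jenkins–Strebel differential with a single cylinder: the surface is the closure of one
open flat cylinder `{0 < Im z < h} / wℤ` filled with closed horizontal leaves, which is maximal, that
is, each of its two boundary components contains a singularity. The map `F` is the flat
parametrization of the cylinder, extended by continuity to its boundary. -/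
def IsOneCylinderJenkinsStrebel (q : QuadraticDifferential S) : Prop :=
  ∃ (w h : ℝ) (F : ℂ → S), 0 < w ∧ 0 < h ∧
    ContinuousOn F {z | 0 ≤ z.im ∧ z.im ≤ h} ∧
    (∀ z, F (z + w) = F z) ∧
    q.IsFlatOn F {z | 0 < z.im ∧ z.im < h} ∧
    (∀ z z' : ℂ, 0 < z.im → z.im < h → 0 < z'.im → z'.im < h → F z = F z' →
      ∃ n : ℤ, z' = z + n * w) ∧
    F '' {z | 0 ≤ z.im ∧ z.im ≤ h} = Set.univ ∧
    Disjoint (F '' {z | 0 < z.im ∧ z.im < h}) (F '' {z | z.im = 0 ∨ z.im = h}) ∧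
    (∃ z : ℂ, z.im = 0 ∧ q.order (F z) ≠ 0) ∧
    (∃ z : ℂ, z.im = h ∧ q.order (F z) ≠ 0)

end QuadraticDifferential

/-! ### Generalized permutations -/

/-- A pair of words ("lines") in the alphabet `ℕ`. -/
structure TwoLines where
  top : List ℕ
  bot : List ℕ

namespace TwoLines

/-- Generalized permutation: both lines are nonempty and every symbol that is present appears exactly
twice in the two lines together. -/
def IsGeneralizedPermutation (π : TwoLines) : Prop :=
  π.top ≠ [] ∧ π.bot ≠ [] ∧ ∀ a ∈ π.top ++ π.bot, (π.top ++ π.bot).count a = 2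

/-- Cylindrical generalized permutation: the first symbol of one line is the last symbol of the
other, and the symbols of neither line form a proper subset of those of the other. -/
def IsCylindrical (π : TwoLines) : Prop :=
  π.IsGeneralizedPermutation ∧
    (π.top.head? = π.bot.getLast? ∨ π.bot.head? = π.top.getLast?) ∧
    ¬ π.top.toFinset ⊂ π.bot.toFinset ∧ ¬ π.bot.toFinset ⊂ π.top.toFinset

/-- Erasing a set of symbols in both lines. -/
def erase (π : TwoLines) (s : Finset ℕ) : TwoLines where
  top := π.top.filter (fun a => a ∉ s)
  bot := π.bot.filter (fun a => a ∉ s)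

/-! ### The one-cylinder suspension

Both broken lines start at `0`; their sides are the vectors `v a`, for the symbols `a` of the top,
respectively bottom, line read from left to right. -/

/-- Vectors of a one-cylinder suspension over `π`. The symbol `a` is the one that is first in one line
and last in the other; its vector is transverse to the horizontal direction, so that the top broken
line lies above the bottom one. All other vectors are horizontal and positive, and the two broken
lines have the same endpoint. (The latter is the linear relation on the lengths of the horizontal
sides.) Thus the two lines bound a parallelogram, whose diagonal `X` goes from `0` to the common
endpoint. -/
def IsSuspensionData (π : TwoLines) (v : ℕ → ℂ) : Prop :=
  ∃ a : ℕ,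
    ((π.top.head? = some a ∧ π.bot.getLast? = some a ∧ 0 < (v a).im) ∨
      (π.bot.head? = some a ∧ π.top.getLast? = some a ∧ (v a).im < 0)) ∧
    (∀ b ∈ π.top ++ π.bot, b ≠ a → 0 < (v b).re ∧ (v b).im = 0) ∧
    (π.top.map v).sum = (π.bot.map v).sum

/-- The `k`-th vertex of the top broken line. -/
def topVertex (π : TwoLines) (v : ℕ → ℂ) (k : ℕ) : ℂ := ((π.top.take k).map v).sum

/-- The `k`-th vertex of the bottom broken line. -/
def botVertex (π : TwoLines) (v : ℕ → ℂ) (k : ℕ) : ℂ := ((π.bot.take k).map v).sum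

/-- The closed parallelogram bounded by the two broken lines. -/
def parallelogram (π : TwoLines) (v : ℕ → ℂ) : Set ℂ :=
  convexHull ℝ (Set.range (π.topVertex v) ∪ Set.range (π.botVertex v))

/-- Identification of the sides of the parallelogram. Two sides with the same symbol are identified by
a parallel translation if they lie on different broken lines, and by a central symmetry if they lie on
the same one. -/
inductive Glue (π : TwoLines) (v : ℕ → ℂ) : ℂ → ℂ → Prop
  | translation (i j a : ℕ) (hi : π.top[i]? = some a) (hj : π.bot[j]? = some a)
      (t : ℝ) (ht : t ∈ Set.Icc (0 : ℝ) 1) :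
      Glue π v (π.topVertex v i + t * v a) (π.botVertex v j + t * v a)
  | symmetryTop (i j a : ℕ) (hij : i ≠ j) (hi : π.top[i]? = some a) (hj : π.top[j]? = some a)
      (t : ℝ) (ht : t ∈ Set.Icc (0 : ℝ) 1) :
      Glue π v (π.topVertex v i + t * v a) (π.topVertex v j + (1 - t) * v a)
  | symmetryBot (i j a : ℕ) (hij : i ≠ j) (hi : π.bot[i]? = some a) (hj : π.bot[j]? = some a)
      (t : ℝ) (ht : t ∈ Set.Icc (0 : ℝ) 1) :
      Glue π v (π.botVertex v i + t * v a) (π.botVertex v j + (1 - t) * v a)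

/-- The equivalence relation on the parallelogram generated by the identification of the sides. -/
def glueSetoid (π : TwoLines) (v : ℕ → ℂ) : Setoid (π.parallelogram v) :=
  Relation.EqvGen.setoid (fun x y => Glue π v x y)

/-- The surface glued from the parallelogram, with the quotient topology. -/
def Surface (π : TwoLines) (v : ℕ → ℂ) : Type := Quotient (π.glueSetoid v)

instance (π : TwoLines) (v : ℕ → ℂ) : TopologicalSpace (π.Surface v) :=
  inferInstanceAs (TopologicalSpace (Quotient (π.glueSetoid v)))

theorem zero_mem_parallelogram (π : TwoLines) (v : ℕ → ℂ) : (0 : ℂ) ∈ π.parallelogram v :=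
  subset_convexHull ℝ _ (Or.inl ⟨0, by simp [topVertex]⟩)

open Classical in
/-- The projection of the parallelogram to the surface, with the junk value `[0]` at the points
outside the parallelogram. -/
def proj (π : TwoLines) (v : ℕ → ℂ) (z : ℂ) : π.Surface v :=
  if h : z ∈ π.parallelogram v then Quotient.mk (π.glueSetoid v) ⟨z, h⟩
  else Quotient.mk (π.glueSetoid v) ⟨0, π.zero_mem_parallelogram v⟩

/-- `q`, together with the complex structure on the glued surface, is the one induced by `dz²` on the
parallelogram. Since the projection is continuous and the sides are straight segments, this condition
on the open parallelogram determines the complex structure and `q` everywhere. -/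
def IsSuspension (π : TwoLines) (v : ℕ → ℂ) [ChartedSpace ℂ (π.Surface v)]
    (q : QuadraticDifferential (π.Surface v)) : Prop :=
  q.IsFlatOn (π.proj v) (interior (π.parallelogram v))

/-- `π` encodes a Jenkins–Strebel differential with a single cylinder in the stratum `𝒬(κ)`: `π` is
cylindrical, vectors of one-cylinder suspensions over `π` exist, and for all such vectors the
suspension is a Jenkins–Strebel differential with a single cylinder in `𝒬(κ)`. -/
def EncodesOneCylinder (π : TwoLines) (κ : Multiset ℤ) : Prop :=
  π.IsCylindrical ∧ (∃ v, π.IsSuspensionData v) ∧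
    ∀ v, π.IsSuspensionData v →
      ∃ (_ : ChartedSpace ℂ (π.Surface v)) (_ : IsManifold 𝓘(ℂ) ω (π.Surface v))
        (q : QuadraticDifferential (π.Surface v)),
        π.IsSuspension v q ∧ q.IsOneCylinderJenkinsStrebel ∧ q.InStratum κ

/-- The orders `(d₁, …, dₙ, -1, …, -1)` with `p` entries `-1`. -/
def orders (d : List ℕ) (p : ℕ) : Multiset ℤ :=
  (d : Multiset ℕ).map (fun n : ℕ => (n : ℤ)) + Multiset.replicate p (-1)

/-- The cylindrical generalized permutation `π` represents the stratum `𝒬(d₁, …, dₙ, -1^p)`: its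
suspensions exist, belong to that stratum, and have a singularity of degree `d₁` at the left endpoint
`0` of the diagonal `X`. -/
def Represents (π : TwoLines) (d : List ℕ) (p : ℕ) : Prop :=
  π.IsCylindrical ∧ (∃ v, π.IsSuspensionData v) ∧
    ∀ v, π.IsSuspensionData v →
      ∃ (_ : ChartedSpace ℂ (π.Surface v)) (_ : IsManifold 𝓘(ℂ) ω (π.Surface v))
        (q : QuadraticDifferential (π.Surface v)),
        π.IsSuspension v q ∧ q.InStratum (orders d p) ∧
          ∀ d₁ ∈ d.head?, q.order (π.proj v 0) = ((d₁ : ℤ) : WithTop ℤ)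

end TwoLines

/-! ### The explicit generalized permutation (for `g ≥ 3`) -/

/-- The word `V(k)`. -/
def wordV (g p k : ℕ) : List ℕ :=
  [4 + 4 * k, 4 * g - 1 + p + 2 * k, 7 + 4 * k, 4 * g + p + 2 * k,
    6 + 4 * k, 4 * g - 1 + p + 2 * k, 5 + 4 * k, 4 * g + p + 2 * k]

/-- The word `W(l)`. -/
def wordW (g p l : ℕ) : List ℕ :=
  [4 * g - 4 + l, 6 * g + p - 5 + l, 6 * g + p - 5 + l]

/-- The generalized permutation with lines `π^top` and `π^bot`. -/
def explicitPerm (g p : ℕ) : TwoLines where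
  top := [0, 1, 2, 3] ++ (List.range (g - 2)).flatMap (wordV g p) ++
    (List.range p).flatMap (wordW g p) ++ [4 * g + p - 4]
  bot := [4 * g - 3 + p, 3, 4 * g - 2 + p, 2, 4 * g - 3 + p, 1, 4 * g - 2 + p] ++
    List.Ico 4 (4 * g - 4 + p + 1) ++ [0]

/-- The symbols to be erased: for every `j`, the block of the `d_j - 1` symbols strictly between
`d₁ + ⋯ + d_{j-1}` and `d₁ + ⋯ + d_j`. -/
def erasedSymbols (d : List ℕ) : Finset ℕ :=
  (Finset.range d.length).biUnion fun j =>
    Finset.Ioo (d.take j).sum (d.take (j + 1)).sum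

end

set_option linter.unusedSectionVars false

noncomputable section

open Filter Complex

/-! ### Local inverses and sector coordinates -/

/-! Gluing the two slanted sides of the parallelogram gives a flat cylinder whose two boundary
circles are cut into horizontal edges, glued in pairs. Direct the edges so that the cylinder lies on
the left, and let `rot e` be the mate of the edge preceding `e`. The edges that start at one point
of the surface form a cycle of `rot`. A cycle of length m means that m half discs meet there, so the
cone angle is mπ. If u is the flat coordinate, then ζ = u^(2/m) is a chart, in which du² = (m/2)²
ζ^(m-2) dζ², and the degree is m - 2 (`CylinderGluing.order_org`). Flat coordinates are unique up to
sign (`IsFlatGerm.unique`), so these charts are holomorphically compatible and the squares of the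
derivatives match (`Star.transition`). Two mates on one boundary component prevent q from being a
square: a square root of q is a constant multiple of dz inside the cylinder, and a gluing by central
symmetry changes its sign (`not_isGlobalSquare`).

It remains to find the cycles of `rot`. Put N = 4g - 4 + p. Before any erasure the surface has N
simple zeros, numbered 0, …, N - 1, and p poles. The symbol i in 1, …, N labels a saddle connection
from zero i - 1 to zero i, with indices modulo N. The symbols used twice on one line join the zeros
i and i + 2 within groups of four, or join the zero 4g - 4 + l to the pole l. So three sides start
at zero i: one `t`, one `b` and `c i`. Erasing the symbol i contracts the connection between the
zeros i - 1 and i. Hence erasing the j-th block merges d_j simple zeros into one point at which d_j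
+ 2 sides start, that is, a zero of degree d_j.

No surface is actually contracted. The cyclic order of the kept sides around each merged point is
written down as a label (singularity, position), `Blocks.lab`. It is checked along the two boundary
words that the mate of a side has the label just before that of the next kept side
(`Blocks.isChain_lowerSides`, `Blocks.isChain_topSides`). This local condition determines `rot` and
its cycle lengths (`exists_perm_of_labels`, `minimalPeriod_eq_of_label`). The corner 0 of the
parallelogram is the origin of `c 0`, which belongs to the first block, whence the degree d₁ there.
The first statement is the case in which all d_j are 1 and nothing is erased. -/

theorem AnalyticAt.exists_analyticAt_rightInverse {U : ℂ → ℂ} {a : ℂ} (hU : AnalyticAt ℂ U a)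
    (h : deriv U a ≠ 0) :
    ∃ V : ℂ → ℂ, AnalyticAt ℂ V (U a) ∧ V (U a) = a ∧ (∀ᶠ u in 𝓝 (U a), U (V u) = u) ∧
      ∀ᶠ z in 𝓝 a, V (U z) = z :=
  ⟨hU.hasStrictDerivAt.localInverse _ _ _ h, hU.analyticAt_localInverse h,
    HasStrictFDerivAt.localInverse_apply_image .., HasStrictDerivAt.eventually_right_inverse ..,
    HasStrictDerivAt.eventually_left_inverse ..⟩

/-- The coordinate on the `j`-th half disc around a cone point of angle `m * π`: it maps the upper
half plane onto the sector of angles between `2 * π * j / m` and `2 * π * (j + 1) / m`. -/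
def sectorCoord (m j : ℕ) (u : ℂ) : ℂ :=
  if u = 0 then 0 else exp ((2 / m) * (log u + Real.pi * j * I))

@[simp] theorem sectorCoord_zero (m j : ℕ) : sectorCoord m j 0 = 0 := by simp [sectorCoord]

theorem sectorCoord_of_ne {u : ℂ} (m j : ℕ) (hu : u ≠ 0) :
    sectorCoord m j u = exp ((2 / m) * (log u + Real.pi * j * I)) := by simp [sectorCoord, hu]

theorem sectorCoord_ne_zero {u : ℂ} (m j : ℕ) (hu : u ≠ 0) : sectorCoord m j u ≠ 0 := by
  rw [sectorCoord_of_ne m j hu]; exact exp_ne_zero _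

theorem norm_sectorCoord {m : ℕ} (hm : 0 < m) (j : ℕ) (u : ℂ) :
    ‖sectorCoord m j u‖ = ‖u‖ ^ (2 / m : ℝ) := by
  have hm' : (m : ℝ) ≠ 0 := by positivity
  by_cases hu : u = 0
  · subst hu
    have : (2 / m : ℝ) ≠ 0 := by positivity
    simp [Real.zero_rpow this]
  · rw [sectorCoord_of_ne m j hu, norm_exp, Real.rpow_def_of_pos (norm_pos_iff.2 hu)]
    congr 1
    have : (2 / m : ℂ) = ((2 / m : ℝ) : ℂ) := by push_cast; rfl
    rw [this, re_ofReal_mul]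
    simp [log_re, mul_comm]

theorem sectorCoord_add_period {m : ℕ} (hm : 0 < m) (j : ℕ) (u : ℂ) :
    sectorCoord m (j + m) u = sectorCoord m j u := by
  have hm' : (m : ℂ) ≠ 0 := by exact_mod_cast hm.ne'
  by_cases hu : u = 0
  · simp [hu]
  rw [sectorCoord_of_ne _ _ hu, sectorCoord_of_ne _ _ hu, exp_eq_exp_iff_exists_int]
  refine ⟨1, ?_⟩
  push_cast
  field_simp
  ring

theorem sectorCoord_congr {m : ℕ} (hm : 0 < m) {j k : ℕ} (h : j ≡ k [MOD m]) (u : ℂ) :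
    sectorCoord m j u = sectorCoord m k u := by
  have key : ∀ n j, sectorCoord m (j + m * n) u = sectorCoord m j u := by
    intro n
    induction n with
    | zero => simp
    | succ n ih => intro j; rw [mul_add, mul_one, ← add_assoc, sectorCoord_add_period hm, ih]
  rw [← Nat.mod_add_div j m, ← Nat.mod_add_div k m, key, key, h]

/-- Since log(-t) = log t + πi, the negative ray of one half disc and the positive ray of the next
have the same image; this is what allows consecutive half discs to be glued into a disc. -/
theorem sectorCoord_neg {m : ℕ} (j : ℕ) {t : ℝ} (ht : 0 < t) :
    sectorCoord m j (-t) = sectorCoord m (j + 1) t := by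
  have h0 : (t : ℂ) ≠ 0 := by exact_mod_cast ht.ne'
  rw [sectorCoord_of_ne _ _ (neg_ne_zero.2 h0), sectorCoord_of_ne _ _ h0]
  have : log (-(t : ℂ)) = log t + Real.pi * I := by
    rw [Complex.log, Complex.log, norm_neg, arg_ofReal_of_nonneg ht.le]
    have := arg_ofReal_of_neg (x := -t) (by linarith)
    push_cast at this
    rw [this]; simp
  rw [this]
  congr 1
  push_cast
  ring

theorem continuousWithinAt_log_upperHalf {u : ℂ} (h0 : u ≠ 0) :
    ContinuousWithinAt log {u | 0 ≤ u.im} u := by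
  by_cases h : u ∈ slitPlane
  · exact (continuousAt_clog h).continuousWithinAt
  · rw [mem_slitPlane_iff, not_or, not_lt, not_not] at h
    have : u.re ≠ 0 := fun h' => h0 (Complex.ext h' h.2)
    exact continuousWithinAt_log_of_re_neg_of_im_zero (lt_of_le_of_ne h.1 this) h.2

theorem continuousOn_sectorCoord {m : ℕ} (hm : 0 < m) (j : ℕ) :
    ContinuousOn (sectorCoord m j) {u | 0 ≤ u.im} := by
  intro u hu
  by_cases h0 : u = 0
  · subst h0
    refine ContinuousAt.continuousWithinAt ?_
    rw [ContinuousAt, sectorCoord_zero, tendsto_zero_iff_norm_tendsto_zero]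
    simp_rw [norm_sectorCoord hm]
    have h2 : (0 : ℝ) < 2 / m := by positivity
    have := (Real.continuousAt_rpow_const (‖(0 : ℂ)‖) (2 / m) (Or.inr h2.le)).tendsto.comp
      (continuous_norm (E := ℂ)).continuousAt.tendsto
    simpa [Real.zero_rpow h2.ne', Function.comp_def] using this
  · have h1 : ContinuousWithinAt (fun u => exp ((2 / m) * (log u + Real.pi * j * I)))
        {u : ℂ | 0 ≤ u.im} u :=
      continuous_exp.continuousAt.comp_continuousWithinAt (continuousWithinAt_const.mul
        ((continuousWithinAt_log_upperHalf h0).add continuousWithinAt_const))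
    refine h1.congr_of_eventuallyEq ?_ (sectorCoord_of_ne m j h0)
    filter_upwards [mem_nhdsWithin_of_mem_nhds (isOpen_ne.mem_nhds h0)] with v hv
    exact sectorCoord_of_ne m j hv

theorem exists_sectorCoord_eq {m : ℕ} (hm : 0 < m) (ζ : ℂ) :
    ∃ j < m, ∃ u : ℂ, 0 ≤ u.im ∧ sectorCoord m j u = ζ := by
  by_cases h0 : ζ = 0
  · exact ⟨0, hm, 0, by simp, by simp [h0]⟩
  have hm' : (m : ℝ) ≠ 0 := by positivity
  have hmc : (m : ℂ) ≠ 0 := by exact_mod_cast hm.ne'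
  have hπ := Real.pi_pos
  obtain ⟨θ, hθ0, hθ1, hθ⟩ : ∃ θ : ℝ, 0 ≤ θ ∧ θ < 2 * Real.pi ∧
      exp (Real.log ‖ζ‖ + θ * I) = ζ := by
    have hb := exp_log h0
    by_cases ha : 0 ≤ arg ζ
    · exact ⟨arg ζ, ha, by linarith [arg_le_pi ζ], hb⟩
    · refine ⟨arg ζ + 2 * Real.pi, by linarith [neg_pi_lt_arg ζ], by linarith, ?_⟩
      conv_rhs => rw [← hb]
      rw [exp_eq_exp_iff_exists_int]
      exact ⟨1, by rw [Complex.log]; push_cast; ring⟩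
  -- In units of one sector the angle of `ζ` is `x`, which lies in [0, m) because the argument was
  -- first moved to [0, 2π). The integer part is the index of the sector, and the fractional part
  -- times π is the argument of `u`.
  set x : ℝ := m * θ / (2 * Real.pi) with hx
  have hx0 : 0 ≤ x := by positivity
  have hxm : x < m := by
    rw [hx, div_lt_iff₀ (by positivity)]
    exact mul_lt_mul_of_pos_left hθ1 (by positivity)
  have hfl := Nat.floor_le hx0
  have hfl' := Nat.lt_floor_add_one x
  have hθx : θ = 2 * Real.pi * x / m := by rw [hx]; field_simp
  refine ⟨⌊x⌋₊, by rw [Nat.floor_lt hx0]; exact hxm,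
    exp ((m / 2 : ℝ) * Real.log ‖ζ‖ + (Real.pi * (x - ⌊x⌋₊) : ℝ) * I), ?_, ?_⟩
  · rw [exp_im]
    refine mul_nonneg (Real.exp_pos _).le (Real.sin_nonneg_of_nonneg_of_le_pi ?_ ?_)
    · simp; nlinarith
    · simp; nlinarith
  · rw [sectorCoord_of_ne _ _ (exp_ne_zero _), log_exp]
    · conv_rhs => rw [← hθ]
      congr 1
      rw [hθx]
      push_cast
      field_simp
      ring
    · simp; nlinarith
    · simp; nlinarith

/-- Arguments in the closed upper half plane lie in [0, π], so two of them differ by -π, 0 or π when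
they differ by an integer multiple of π. Thus closed sectors overlap only along their boundary rays
and at the centre. -/
theorem sectorCoord_eq_iff {m : ℕ} (hm : 0 < m) {j k : ℕ} {u u' : ℂ} (hu : 0 ≤ u.im)
    (hu' : 0 ≤ u'.im) (h : sectorCoord m j u = sectorCoord m k u') :
    (u = 0 ∧ u' = 0) ∨ (j ≡ k [MOD m] ∧ u = u') ∨
      (k ≡ j + 1 [MOD m] ∧ ∃ t : ℝ, 0 < t ∧ u = -t ∧ u' = t) ∨
      (j ≡ k + 1 [MOD m] ∧ ∃ t : ℝ, 0 < t ∧ u = t ∧ u' = -t) := by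
  have hmc : (m : ℂ) ≠ 0 := by exact_mod_cast hm.ne'
  have hπ := Real.pi_pos
  by_cases h0 : u = 0
  · left
    refine ⟨h0, ?_⟩
    by_contra h1
    rw [h0, sectorCoord_zero] at h
    exact sectorCoord_ne_zero m k h1 h.symm
  right
  have h0' : u' ≠ 0 := by
    rintro rfl
    rw [sectorCoord_zero] at h
    exact sectorCoord_ne_zero m j h0 h
  rw [sectorCoord_of_ne _ _ h0, sectorCoord_of_ne _ _ h0', exp_eq_exp_iff_exists_int] at h
  obtain ⟨n, hn⟩ := h
  have hn' : log u + Real.pi * j * I = log u' + Real.pi * k * I + m * n * Real.pi * I := by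
    field_simp at hn
    linear_combination hn
  have hre := congrArg re hn'
  have him := congrArg im hn'
  simp [log_re, log_im] at hre him
  have hnorm : ‖u‖ = ‖u'‖ :=
    Real.log_injOn_pos (norm_pos_iff.2 h0) (norm_pos_iff.2 h0') hre
  have ha := arg_nonneg_iff.2 hu
  have ha' := arg_nonneg_iff.2 hu'
  have hb := arg_le_pi u
  have hb' := arg_le_pi u'
  have hq : arg u - arg u' = Real.pi * ((k + m * n - j : ℤ) : ℝ) := by
    push_cast; linarith
  have q1 : (k + m * n - j : ℤ) ≤ 1 := by
    by_contra hc
    have : (2 : ℝ) ≤ ((k + m * n - j : ℤ) : ℝ) := by exact_mod_cast not_le.1 hc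
    nlinarith
  have q2 : -1 ≤ (k + m * n - j : ℤ) := by
    by_contra hc
    have h3 : (k + m * n - j : ℤ) ≤ -2 := by omega
    have : ((k + m * n - j : ℤ) : ℝ) ≤ (-2 : ℝ) := by exact_mod_cast h3
    nlinarith
  have real_of : ∀ {v : ℂ}, arg v = 0 → v = (‖v‖ : ℝ) := by
    intro v h
    have := norm_mul_exp_arg_mul_I v
    rw [h] at this
    simpa using this.symm
  have real_of' : ∀ {v : ℂ}, arg v = Real.pi → v = -(‖v‖ : ℝ) := by
    intro v h
    have := norm_mul_exp_arg_mul_I v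
    rw [h] at this
    simpa using this.symm
  have hcases : (k + m * n - j : ℤ) = 0 ∨ (k + m * n - j : ℤ) = 1 ∨ (k + m * n - j : ℤ) = -1 := by
    omega
  rcases hcases with hc | hc | hc <;> rw [hc] at hq
  · left
    constructor
    · rw [← Int.natCast_modEq_iff]
      exact (Int.modEq_iff_dvd).2 ⟨-n, by linarith⟩
    · exact ext_norm_arg hnorm (by simp at hq; linarith)
  · right; left
    constructor
    · rw [← Int.natCast_modEq_iff]
      exact (Int.modEq_iff_dvd).2 ⟨n, by push_cast; linarith⟩
    · have h1 : arg u = Real.pi := by simp at hq; linarith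
      have h2 : arg u' = 0 := by simp at hq; linarith
      exact ⟨‖u‖, norm_pos_iff.2 h0, real_of' h1, by rw [hnorm]; exact real_of h2⟩
  · right; right
    constructor
    · rw [← Int.natCast_modEq_iff]
      exact (Int.modEq_iff_dvd).2 ⟨-n, by push_cast; linarith⟩
    · have h1 : arg u' = Real.pi := by simp at hq; linarith
      have h2 : arg u = 0 := by simp at hq; linarith
      exact ⟨‖u‖, norm_pos_iff.2 h0, real_of h2, by rw [hnorm]; exact real_of' h1⟩

/-- A local inverse of the sector coordinate. -/
theorem exists_sector_branch {m : ℕ} (hm : 0 < m) (j : ℕ) {u₀ a : ℂ}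
    (hu : 0 < u₀.im ∨ (0 < u₀.re ∧ u₀.im = 0)) (ha : a = sectorCoord m (j + 1) u₀) :
    ∃ U : ℂ → ℂ, AnalyticAt ℂ U a ∧ U a = u₀ ∧
      (∀ᶠ ζ in 𝓝 a, deriv U ζ ^ 2 = (m / 2 : ℂ) ^ 2 * ζ ^ ((m : ℤ) - 2)) ∧
      (∀ᶠ ζ in 𝓝 a, sectorCoord m (j + 1) (U ζ) = ζ) ∧
      (u₀.im = 0 → ∀ᶠ ζ in 𝓝 a, (U ζ).im ≤ 0 → sectorCoord m j (-U ζ) = ζ) := by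
  have hmc : (m : ℂ) ≠ 0 := by exact_mod_cast hm.ne'
  have hπ := Real.pi_pos
  have h0 : u₀ ≠ 0 := by
    rintro rfl
    simp at hu
  have hslit : u₀ ∈ slitPlane := by
    rw [mem_slitPlane_iff]
    rcases hu with h | h
    · exact Or.inr h.ne'
    · exact Or.inl h.1
  have harg : 0 ≤ arg u₀ ∧ arg u₀ < Real.pi := by
    refine ⟨arg_nonneg_iff.2 ?_, lt_of_le_of_ne (arg_le_pi _) (mem_slitPlane_iff_arg.1 hslit).1⟩
    rcases hu with h | h
    · exact h.le
    · exact h.2.ge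
  have ha0 : a ≠ 0 := by rw [ha]; exact sectorCoord_ne_zero _ _ h0
  rw [sectorCoord_of_ne _ _ h0] at ha
  -- A logarithm of the branch U = u₀ (ζ / a)^(m/2). Dividing by `a` keeps the logarithm away from
  -- its cut near ζ = `a`.
  set w : ℂ → ℂ := fun ζ => log u₀ + (m / 2) * log (ζ / a) with hw
  have hlog : AnalyticAt ℂ (fun ζ => log (ζ / a)) a :=
    (analyticAt_id.div analyticAt_const ha0).clog (by simp [ha0])
  have hwan : AnalyticAt ℂ w a := analyticAt_const.add (analyticAt_const.mul hlog)
  have hwa : w a = log u₀ := by simp [hw, ha0]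
  have hwt : Tendsto (fun ζ => (w ζ).im) (𝓝 a) (𝓝 (arg u₀)) := by
    have := (continuous_im.continuousAt.comp hwan.continuousAt).tendsto
    simpa [hwa, log_im, Function.comp_def] using this
  have hne : ∀ᶠ ζ in 𝓝 a, ζ ≠ 0 := isOpen_ne.mem_nhds ha0
  have hsl : ∀ᶠ ζ in 𝓝 a, ζ / a ∈ slitPlane :=
    (continuous_id.div_const a).continuousAt.eventually_mem
      (isOpen_slitPlane.mem_nhds (by simp [ha0]))
  have hexp : ∀ ζ, ζ ≠ 0 → exp ((2 / m) * (w ζ + Real.pi * (j + 1 : ℕ) * I)) = ζ := by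
    intro ζ hζ
    have : (2 / m) * (w ζ + Real.pi * (j + 1 : ℕ) * I) =
        (2 / m) * (log u₀ + Real.pi * (j + 1 : ℕ) * I) + log (ζ / a) := by
      simp only [hw]; field_simp; ring
    rw [this, exp_add, ← ha, exp_log (div_ne_zero hζ ha0)]
    field_simp
  refine ⟨fun ζ => exp (w ζ), hwan.cexp, ?_, ?_, ?_, ?_⟩
  · simp [hwa, exp_log h0]
  · filter_upwards [hne, hsl] with ζ hζ hζs
    have hd : HasDerivAt (fun ζ => exp (w ζ)) (exp (w ζ) * ((m / 2) * ((1 / a) / (ζ / a)))) ζ := by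
      refine HasDerivAt.cexp ?_
      refine HasDerivAt.const_add _ (HasDerivAt.const_mul _ ?_)
      exact ((hasDerivAt_id ζ).div_const a).clog hζs
    rw [hd.deriv]
    -- Squaring removes the sector index, which only shifts the exponent by a multiple of 2πi.
    -- Therefore U'² is given by the same formula in all sectors.
    have e2 : exp (w ζ) ^ 2 = ζ ^ m := by
      conv_rhs => rw [← hexp ζ hζ]
      rw [← exp_nat_mul, ← exp_nat_mul, exp_eq_exp_iff_exists_int]
      refine ⟨-(j + 1 : ℕ), ?_⟩
      push_cast
      field_simp
      ring
    rw [mul_pow, e2, zpow_sub₀ hζ, zpow_natCast]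
    field_simp
  · filter_upwards [hne, hwt.eventually (gt_mem_nhds harg.2),
      hwt.eventually (lt_mem_nhds (show -Real.pi < arg u₀ by linarith))] with ζ hζ h1 h2
    rw [sectorCoord_of_ne _ _ (exp_ne_zero _), log_exp h2 h1.le]
    exact hexp ζ hζ
  · intro him
    have harg0 : arg u₀ = 0 := by
      rw [arg_eq_zero_iff]
      rcases hu with h | h
      · exact absurd him h.ne'
      · exact ⟨h.1.le, him⟩
    rw [harg0] at hwt
    filter_upwards [hne, hwt.eventually (gt_mem_nhds (show (0 : ℝ) < Real.pi by linarith)),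
      hwt.eventually (lt_mem_nhds (show -Real.pi < (0 : ℝ) by linarith))] with ζ hζ h1 h2 h3
    have h4 : (w ζ).im ≤ 0 := by
      by_contra hc
      rw [exp_im] at h3
      have := mul_pos (Real.exp_pos (w ζ).re) (Real.sin_pos_of_pos_of_lt_pi (not_le.1 hc) h1)
      linarith
    -- Below the ray the imaginary part of `w ζ` lies in (-π, 0], so that adding π brings it into
    -- (0, π], where `log` inverts `exp`.
    have h5 : -exp (w ζ) = exp (w ζ + Real.pi * I) := by
      rw [exp_add (w ζ), exp_pi_mul_I]; ring
    rw [h5, sectorCoord_of_ne _ _ (exp_ne_zero _), log_exp]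
    · conv_rhs => rw [← hexp ζ hζ]
      congr 1
      push_cast
      ring
    · simp; linarith
    · simp; linarith

end

noncomputable section

open Filter Complex

/-! ### Gluing the boundary of a flat cylinder -/

/-- The boundary of the strip `{0 ≤ Im z ≤ height}` modulo the translation by `width`, divided into
edges which are to be glued in pairs. The edge `e` starts at `org e` and is directed by
`sgn e = ± 1` so that the strip lies on its left; it is glued to `mate e` reversing the direction.
The edge before `e` on its boundary component is `mate (rot e)`. -/
structure CylinderBoundary (E : Type*) where
  width : ℝ
  height : ℝ
  width_pos : 0 < width
  height_pos : 0 < height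
  org : E → ℂ
  sgn : E → ℂ
  len : E → ℝ
  mate : E → E
  rot : Equiv.Perm E
  sgn_cases : ∀ e, sgn e = 1 ∧ (org e).im = 0 ∨ sgn e = -1 ∧ (org e).im = height
  len_pos : ∀ e, 0 < len e
  mate_mate : ∀ e, mate (mate e) = e
  mate_ne : ∀ e, mate e ≠ e
  len_mate : ∀ e, len (mate e) = len e
  sgn_mate_rot : ∀ e, sgn (mate (rot e)) = sgn e
  org_eq : ∀ e, ∃ n : ℤ, org e = org (mate (rot e)) + sgn e * len (rot e) + n * width
  exists_pt : ∀ z : ℂ, z.im = 0 ∨ z.im = height →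
    ∃ (e : E) (s : ℝ) (n : ℤ), 0 ≤ s ∧ s < len e ∧ z = org e + sgn e * s + n * width
  pt_inj : ∀ (e e' : E) (s s' : ℝ) (n : ℤ), 0 ≤ s → s < len e → 0 ≤ s' → s' < len e' →
    org e + sgn e * s = org e' + sgn e' * s' + n * width → e = e' ∧ s = s'

/-- A surface glued from a strip along its boundary, with the projection `param`. -/
structure CylinderGluing (E S : Type*) [TopologicalSpace S] extends CylinderBoundary E where
  param : ℂ → S
  continuous_param : Continuous param
  isOpen_of : ∀ U : Set S, ∀ V : Set ℂ, IsOpen V →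
    (∀ z : ℂ, 0 ≤ z.im → z.im ≤ height → (z ∈ V ↔ param z ∈ U)) → IsOpen U
  surj : ∀ x, ∃ z : ℂ, 0 ≤ z.im ∧ z.im ≤ height ∧ param z = x
  periodic : ∀ z, param (z + width) = param z
  glue : ∀ e (s : ℝ), 0 ≤ s → s ≤ len e →
    param (org e + sgn e * s) = param (org (mate e) + sgn (mate e) * (len e - s : ℝ))
  fiber_interior : ∀ z z' : ℂ, 0 < z.im → z.im < height → 0 ≤ z'.im → z'.im ≤ height →
    param z' = param z → ∃ n : ℤ, z' = z + n * width
  fiber_edge : ∀ e (s : ℝ) (z : ℂ), 0 < s → s < len e → 0 ≤ z.im → z.im ≤ height →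
    param z = param (org e + sgn e * s) → ∃ n : ℤ, z = org e + sgn e * s + n * width ∨
      z = org (mate e) + sgn (mate e) * (len e - s : ℝ) + n * width
  fiber_vertex : ∀ e (z : ℂ), 0 ≤ z.im → z.im ≤ height → param z = param (org e) →
    ∃ (k : ℕ) (n : ℤ), z = org ((rot ^ k) e) + n * width

namespace CylinderGluing

variable {E S : Type*} [TopologicalSpace S] (G : CylinderGluing E S)

/-- The closed strip. -/
def strip : Set ℂ := {z | 0 ≤ z.im ∧ z.im ≤ G.height}

/-- The point at distance `s` from the origin of the edge `e`. -/
def pt (e : E) (s : ℝ) : ℂ := G.org e + G.sgn e * s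

/-- The points of the surface coming from the end points of the edges. -/
def vertices : Set S := Set.range (fun e => G.param (G.org e))

theorem sgn_sign (e : E) : G.sgn e = 1 ∨ G.sgn e = -1 :=
  (G.sgn_cases e).imp And.left And.left

@[simp] theorem pt_zero (e : E) : G.pt e 0 = G.org e := by simp [pt]

theorem pt_add (e : E) (s t : ℝ) : G.pt e (s + t) = G.pt e s + G.sgn e * t := by
  simp [pt]; ring

theorem pt_im (e : E) (s : ℝ) : (G.pt e s).im = (G.org e).im := by
  rcases G.sgn_sign e with h | h <;> simp [pt, h]

theorem param_add_int (z : ℂ) (n : ℤ) : G.param (z + n * G.width) = G.param z := by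
  have key : ∀ (n : ℕ) (z : ℂ), G.param (z + n * G.width) = G.param z := by
    intro n
    induction n with
    | zero => simp
    | succ n ih =>
      intro z
      rw [← ih z, ← G.periodic (z + n * G.width)]
      congr 1; push_cast; ring
  rcases Int.eq_nat_or_neg n with ⟨k, rfl | rfl⟩
  · exact_mod_cast key k z
  · rw [← key k (z + _)]
    congr 1; push_cast; ring

theorem org_im_cases (e : E) : (G.org e).im = 0 ∨ (G.org e).im = G.height :=
  (G.sgn_cases e).imp And.right And.right

theorem glue_pt (e : E) {s : ℝ} (h0 : 0 ≤ s) (h1 : s ≤ G.len e) :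
    G.param (G.pt e s) = G.param (G.pt (G.mate e) (G.len e - s)) := G.glue e s h0 h1

theorem org_mem_strip (e : E) : G.org e ∈ G.strip := by
  rcases G.org_im_cases e with h | h
  · exact ⟨h.ge, h.trans_le G.height_pos.le⟩
  · exact ⟨h ▸ G.height_pos.le, h.le⟩

theorem pt_mem_strip (e : E) (s : ℝ) : G.pt e s ∈ G.strip := by
  have := G.org_mem_strip e
  rwa [strip, Set.mem_ofPred_eq, ← G.pt_im e s] at this

theorem pt_ne_interior {e : E} {s : ℝ} {z : ℂ} (h0 : 0 < z.im) (h1 : z.im < G.height) :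
    G.param (G.pt e s) ≠ G.param z := by
  intro h
  obtain ⟨n, hn⟩ := G.fiber_interior z _ h0 h1 (G.pt_mem_strip e s).1 (G.pt_mem_strip e s).2 h
  have := congrArg im hn
  rw [G.pt_im] at this
  simp at this
  rcases G.org_im_cases e with h | h <;> linarith

theorem fiber_pt {e e' : E} {s s' : ℝ} (h0 : 0 < s) (h1 : s < G.len e) (h0' : 0 ≤ s')
    (h1' : s' < G.len e') (h : G.param (G.pt e' s') = G.param (G.pt e s)) :
    (e' = e ∧ s' = s) ∨ (e' = G.mate e ∧ s' = G.len e - s) := by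
  obtain ⟨n, hn | hn⟩ :=
    G.fiber_edge e s _ h0 h1 (G.pt_mem_strip e' s').1 (G.pt_mem_strip e' s').2 h
  · exact Or.inl (G.pt_inj _ _ _ _ n h0' h1' h0.le h1 hn)
  · refine Or.inr (G.pt_inj _ _ _ _ n h0' h1' (by linarith) ?_ hn)
    rw [G.len_mate]; linarith

theorem pt_notMem_vertices {e : E} {s : ℝ} (h0 : 0 < s) (h1 : s < G.len e) :
    G.param (G.pt e s) ∉ G.vertices := by
  rintro ⟨e', h⟩
  simp only [← G.pt_zero e'] at h
  rcases G.fiber_pt h0 h1 le_rfl (G.len_pos e') h with ⟨_, h⟩ | ⟨_, h⟩ <;> linarith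

theorem interior_notMem_vertices {z : ℂ} (h0 : 0 < z.im) (h1 : z.im < G.height) :
    G.param z ∉ G.vertices := by
  rintro ⟨e', h⟩
  exact G.pt_ne_interior (e := e') (s := 0) h0 h1 (by simpa using h)

theorem eq_rot_pow_of_vertex {e e' : E} (h : G.param (G.org e') = G.param (G.org e)) :
    ∃ k : ℕ, e' = (G.rot ^ k) e := by
  obtain ⟨k, n, hk⟩ := G.fiber_vertex e _ (G.org_mem_strip e').1 (G.org_mem_strip e').2 h
  exact ⟨k, (G.pt_inj e' _ 0 0 n le_rfl (G.len_pos _) le_rfl (G.len_pos _) (by simpa using hk)).1⟩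

/-- Up to a period, the origin of `e` is the end of the preceding edge, and the gluing takes this
end to the origin of the mate of that edge, which is `rot e`. -/
theorem param_org_rot (e : E) : G.param (G.org (G.rot e)) = G.param (G.org e) := by
  obtain ⟨n, hn⟩ := G.org_eq e
  have h := G.glue_pt (G.rot e) le_rfl (G.len_pos _).le
  rw [G.pt_zero, sub_zero] at h
  rw [h, hn, G.param_add_int, pt, G.sgn_mate_rot]

theorem param_org_rot_pow (e : E) (k : ℕ) :
    G.param (G.org ((G.rot ^ k) e)) = G.param (G.org e) := by
  induction k with
  | zero => simp
  | succ k ih => rw [pow_succ', Equiv.Perm.mul_apply, param_org_rot, ih]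

/-- A point of the surface surrounded by a cycle of `m` half discs. -/
structure Star (x : S) where
  m : ℕ
  m_pos : 0 < m
  P : ℕ → ℂ
  σ : ℕ → ℂ
  r : ℝ
  r_pos : 0 < r
  sign : ∀ j, σ j = 1 ∨ σ j = -1
  mem_strip : ∀ j u, ‖u‖ ≤ r → 0 ≤ u.im → P j + σ j * u ∈ G.strip
  mem_interior : ∀ j u, ‖u‖ ≤ r → 0 < u.im →
    0 < (P j + σ j * u).im ∧ (P j + σ j * u).im < G.height
  center : ∀ j, G.param (P j) = x
  P_periodic : ∀ j, P (j + m) = P j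
  σ_periodic : ∀ j, σ (j + m) = σ j
  glue : ∀ j (t : ℝ), 0 ≤ t → t ≤ r → G.param (P j - σ j * t) = G.param (P (j + 1) + σ (j + 1) * t)
  saturated : ∀ j u z, ‖u‖ ≤ r → 0 ≤ u.im → z ∈ G.strip → G.param z = G.param (P j + σ j * u) →
    ∃ (k : ℕ) (u' : ℂ) (n : ℤ), 0 ≤ u'.im ∧ sectorCoord m k u' = sectorCoord m j u ∧
      z = P k + σ k * u' + n * G.width
  translation_inj : ∀ j k u u' (n : ℤ), ‖u‖ ≤ r → ‖u'‖ ≤ r → 0 ≤ u.im → 0 ≤ u'.im →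
    P j + σ j * u = P k + σ k * u' + n * G.width → sectorCoord m j u = sectorCoord m k u'
  cover : ∀ j z, z ∈ G.strip → ‖z - P j‖ < r →
    ∃ k u, 0 ≤ u.im ∧ ‖u‖ = ‖z - P j‖ ∧ z = P k + σ k * u
  edge : ∀ j (t : ℝ), 0 ≤ t → t ≤ r → (0 < t ∨ x ∉ G.vertices) →
    (0 < (P (j + 1)).im ∧ (P (j + 1)).im < G.height ∧ P j = P (j + 1) ∧ σ j = - σ (j + 1)) ∨
    ∃ (e : E) (s : ℝ) (n : ℤ), 0 < s ∧ s < G.len e ∧ P (j + 1) + σ (j + 1) * t = G.pt e s ∧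
      σ (j + 1) = G.sgn e ∧ P j - σ j * t = G.pt (G.mate e) (G.len e - s) + n * G.width ∧
      σ j = G.sgn (G.mate e)
  eq_two : x ∉ G.vertices → m = 2
  eq_period : ∀ e, G.param (G.org e) = x → m = Function.minimalPeriod G.rot e

/-- The map near a boundary point, in the flat coordinate. -/
def edgeMap (e : E) (s : ℝ) (u : ℂ) : S :=
  if 0 ≤ u.im then G.param (G.pt e s + G.sgn e * u)
  else G.param (G.pt (G.mate e) (G.len e - s) - G.sgn (G.mate e) * u)

/-- `g` is a germ at `0` of a flat coordinate around `y`. -/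
def IsFlatGerm (g : ℂ → S) (y : S) : Prop :=
  (∃ z : ℂ, 0 < z.im ∧ z.im < G.height ∧ G.param z = y ∧
    ∃ η : ℂ, (η = 1 ∨ η = -1) ∧ g = fun u => G.param (z + η * u)) ∨
  ∃ (e : E) (s : ℝ), 0 < s ∧ s < G.len e ∧ G.param (G.pt e s) = y ∧ g = G.edgeMap e s

/-- On the real axis the two halves of `edgeMap` agree by the gluing rule, which applies as long as
s + Re u stays within the edge. -/
theorem edgeMap_of_nonpos {e : E} {s : ℝ} (h0 : 0 < s) (h1 : s < G.len e) :
    ∀ᶠ u : ℂ in 𝓝 0, u.im ≤ 0 →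
      G.edgeMap e s u = G.param (G.pt (G.mate e) (G.len e - s) - G.sgn (G.mate e) * u) := by
  have h2 : ∀ᶠ u : ℂ in 𝓝 0, u.re < G.len e - s :=
    continuous_re.continuousAt.eventually (gt_mem_nhds (by simpa using h1))
  have h3 : ∀ᶠ u : ℂ in 𝓝 0, -s < u.re :=
    continuous_re.continuousAt.eventually (lt_mem_nhds (by simpa using h0))
  filter_upwards [h2, h3] with u hu2 hu3 hu
  unfold edgeMap
  split_ifs with h
  · have hre : u = (u.re : ℂ) := Complex.ext rfl (by simp; linarith)
    have e1 : G.pt e s + G.sgn e * u = G.pt e (s + u.re) := by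
      rw [pt_add, ← hre]
    have e2 : G.pt (G.mate e) (G.len e - s) - G.sgn (G.mate e) * u =
        G.pt (G.mate e) (G.len e - (s + u.re)) := by
      rw [show G.len e - (s + u.re) = (G.len e - s) + (-u.re) by ring, pt_add]
      push_cast; rw [← hre]; ring
    rw [e1, e2, G.glue_pt e (by linarith) (by linarith)]
  · rfl

/-- Exchanging an edge with its mate exchanges the two half discs, that is, turns the flat
coordinate by π. This is the sign ambiguity of flat coordinates at an edge point. -/
theorem edgeMap_neg {e : E} {s : ℝ} (h0 : 0 < s) (h1 : s < G.len e) :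
    ∀ᶠ u : ℂ in 𝓝 0, G.edgeMap (G.mate e) (G.len e - s) u = G.edgeMap e s (-u) := by
  have h2 : ∀ᶠ u : ℂ in 𝓝 0, (-u).im ≤ 0 → G.edgeMap e s (-u) =
      G.param (G.pt (G.mate e) (G.len e - s) - G.sgn (G.mate e) * -u) := by
    have := (continuous_neg (G := ℂ)).tendsto 0
    rw [neg_zero] at this
    exact this.eventually (G.edgeMap_of_nonpos h0 h1)
  filter_upwards [h2] with u hu
  by_cases h : 0 ≤ u.im
  · rw [hu (by simpa using h), edgeMap, if_pos h]
    congr 1; ring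
  · rw [edgeMap, if_neg h, edgeMap, if_pos (by simp; linarith), G.mate_mate, G.len_mate]
    congr 1
    rw [sub_sub_cancel]; ring

/-- Flat coordinates are unique up to sign. -/
theorem IsFlatGerm.unique {g g' : ℂ → S} {y : S} (h : G.IsFlatGerm g y) (h' : G.IsFlatGerm g' y) :
    ∃ η : ℂ, (η = 1 ∨ η = -1) ∧ ∀ᶠ u in 𝓝 0, g u = g' (η * u) := by
  rcases h with ⟨z, hz0, hz1, hzy, η, hη, rfl⟩ | ⟨e, s, h0, h1, hy, rfl⟩
  · rcases h' with ⟨z', hz0', hz1', hzy', η', hη', rfl⟩ | ⟨e', s', h0', h1', hy', rfl⟩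
    · obtain ⟨n, rfl⟩ := G.fiber_interior z z' hz0 hz1 hz0'.le hz1'.le (hzy'.trans hzy.symm)
      refine ⟨η * η', ?_, Eventually.of_forall fun u => ?_⟩
      · rcases hη with rfl | rfl <;> rcases hη' with rfl | rfl <;> simp
      · have : z + n * G.width + η' * (η * η' * u) = z + η * u + n * G.width := by
          rcases hη' with rfl | rfl <;> ring
        simp only [this, G.param_add_int]
    · exact absurd (hy'.trans hzy.symm) (G.pt_ne_interior hz0 hz1)
  · rcases h' with ⟨z', hz0', hz1', hzy', η', hη', rfl⟩ | ⟨e', s', h0', h1', hy', rfl⟩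
    · exact absurd (hy.trans hzy'.symm) (G.pt_ne_interior hz0' hz1')
    · rcases G.fiber_pt h0 h1 h0'.le h1' (hy'.trans hy.symm) with ⟨rfl, rfl⟩ | ⟨rfl, rfl⟩
      · exact ⟨1, Or.inl rfl, by simp⟩
      · refine ⟨-1, Or.inr rfl, ?_⟩
        have := (continuous_neg (G := ℂ)).tendsto 0
        rw [neg_zero] at this
        filter_upwards [this.eventually (G.edgeMap_neg h0 h1)] with u hu
        simp only [neg_neg] at hu
        simp [hu]

namespace Star

variable {G} {x : S} (st : G.Star x)

/-- The `j`-th half disc. -/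
def sector (j : ℕ) (u : ℂ) : S := G.param (st.P j + st.σ j * u)

theorem sector_add_period (j : ℕ) (u : ℂ) : st.sector (j + st.m) u = st.sector j u := by
  simp [sector, st.P_periodic, st.σ_periodic]

theorem sector_congr {j k : ℕ} (h : j ≡ k [MOD st.m]) (u : ℂ) : st.sector j u = st.sector k u := by
  have key : ∀ n j, st.sector (j + st.m * n) u = st.sector j u := by
    intro n
    induction n with
    | zero => simp
    | succ n ih => intro j; rw [mul_add, mul_one, ← add_assoc, sector_add_period, ih]
  rw [← Nat.mod_add_div j st.m, ← Nat.mod_add_div k st.m, key, key, h]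

theorem sector_neg (j : ℕ) {t : ℝ} (h0 : 0 ≤ t) (h1 : t ≤ st.r) :
    st.sector j (-t) = st.sector (j + 1) t := by
  have := st.glue j t h0 h1
  rw [sector, sector, ← this]
  congr 1; ring

theorem norm_eq_of_sectorCoord {j k : ℕ} {u u' : ℂ}
    (h : sectorCoord st.m j u = sectorCoord st.m k u') : ‖u‖ = ‖u'‖ := by
  have h2 : (2 / st.m : ℝ) ≠ 0 := by have := st.m_pos; positivity
  have := congrArg norm h
  rw [norm_sectorCoord st.m_pos, norm_sectorCoord st.m_pos] at this
  exact (Real.rpow_left_inj (norm_nonneg _) (norm_nonneg _) h2).1 this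

/-- Together with `sectorCoord_eq_of_sector`: the half discs in the surface and the sectors in the
plane are subject to the same identifications, so that a plane disc parametrizes the neighborhood
injectively. -/
theorem sector_eq_of_sectorCoord {j k : ℕ} {u u' : ℂ} (hu : 0 ≤ u.im) (hu' : 0 ≤ u'.im)
    (hr : ‖u‖ ≤ st.r) (h : sectorCoord st.m j u = sectorCoord st.m k u') :
    st.sector j u = st.sector k u' := by
  rcases sectorCoord_eq_iff st.m_pos hu hu' h with ⟨rfl, rfl⟩ | ⟨hjk, rfl⟩ | ⟨hjk, t, ht, rfl, rfl⟩ |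
      ⟨hjk, t, ht, rfl, rfl⟩
  · simp [sector, st.center]
  · exact st.sector_congr hjk u
  · rw [st.sector_neg j ht.le (by simpa [abs_of_pos ht] using hr)]
    exact (st.sector_congr hjk _).symm
  · rw [st.sector_neg k ht.le (by simpa [abs_of_pos ht] using hr)]
    exact st.sector_congr hjk _

theorem sectorCoord_eq_of_sector {j k : ℕ} {u u' : ℂ} (hu : 0 ≤ u.im) (hu' : 0 ≤ u'.im)
    (hr : ‖u‖ ≤ st.r) (hr' : ‖u'‖ ≤ st.r) (h : st.sector j u = st.sector k u') :
    sectorCoord st.m j u = sectorCoord st.m k u' := by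
  obtain ⟨k2, u2, n, h2, h3, h4⟩ := st.saturated j u _ hr hu (st.mem_strip k u' hr' hu') h.symm
  have := st.translation_inj k k2 u' u2 n hr' (by rw [st.norm_eq_of_sectorCoord h3]; exact hr)
    hu' h2 h4
  rw [this, h3]

/-- The neighborhood of radius `δ`. -/
def nhd (δ : ℝ) : Set S := {y | ∃ j u, 0 ≤ u.im ∧ ‖u‖ < δ ∧ st.sector j u = y}

/-- Within the strip, the preimage is cut out by the balls of radius δ around all translates of the
centres `P j`: `cover` gives one inclusion and `saturated` the other. -/
theorem isOpen_nhd {δ : ℝ} (hδ : δ ≤ st.r) : IsOpen (st.nhd δ) := by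
  refine G.isOpen_of _ (⋃ (j : ℕ) (n : ℤ), Metric.ball (st.P j + n * G.width) δ)
    (isOpen_iUnion fun _ => isOpen_iUnion fun _ => Metric.isOpen_ball) ?_
  intro z h0 h1
  simp only [Set.mem_iUnion, Metric.mem_ball, dist_eq_norm]
  constructor
  · rintro ⟨j, n, h⟩
    have e1 : z - (st.P j + n * G.width) = (z - n * G.width) - st.P j := by ring
    rw [e1] at h
    obtain ⟨k, u, hu, hun, hz⟩ := st.cover j (z - n * G.width)
      ⟨by simpa using h0, by simpa using h1⟩ (h.trans_le hδ)
    refine ⟨k, u, hu, hun ▸ h, ?_⟩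
    rw [sector, ← hz, ← G.param_add_int _ n]
    congr 1; ring
  · rintro ⟨j, u, hu, hun, h⟩
    obtain ⟨k, u', n, hu', hs, hz⟩ := st.saturated j u z (hun.le.trans hδ) hu ⟨h0, h1⟩ h.symm
    refine ⟨k, n, ?_⟩
    rw [hz, show st.P k + st.σ k * u' + n * G.width - (st.P k + n * G.width) = st.σ k * u' by ring,
      norm_mul, st.norm_eq_of_sectorCoord hs]
    rcases st.sign k with h | h <;> simpa [h] using hun

theorem finite_range_P : (Set.range st.P).Finite := by
  refine ((Finset.range st.m).image st.P).finite_toSet.subset ?_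
  rintro _ ⟨j, rfl⟩
  have key : ∀ n j, st.P (j + st.m * n) = st.P j := by
    intro n
    induction n with
    | zero => simp
    | succ n ih => intro j; rw [mul_add, mul_one, ← add_assoc, st.P_periodic, ih]
  simp only [Finset.coe_image, Set.mem_image, Finset.coe_range, Set.mem_Iio]
  exact ⟨j % st.m, Nat.mod_lt _ st.m_pos, by rw [← key (j / st.m), Nat.mod_add_div]⟩

end Star

theorem isClosed_translates (z : ℂ) : IsClosed (Set.range fun n : ℤ => z + n * G.width) := by
  have hw : (G.width : ℂ) ≠ 0 := by exact_mod_cast G.width_pos.ne'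
  have : (Set.range fun n : ℤ => z + n * G.width) =
      (fun y : ℂ => y.im) ⁻¹' {z.im} ∩
        (fun y : ℂ => (y.re - z.re) / G.width) ⁻¹' (Set.range ((↑) : ℤ → ℝ)) := by
    ext y
    simp only [Set.mem_range, Set.mem_inter_iff, Set.mem_preimage, Set.mem_singleton_iff]
    constructor
    · rintro ⟨n, rfl⟩
      refine ⟨by simp, n, ?_⟩
      have := G.width_pos.ne'
      simp
      field_simp
    · rintro ⟨h1, n, h2⟩
      refine ⟨n, Complex.ext ?_ (by simp [h1])⟩
      have := G.width_pos.ne'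
      replace h2 := h2.symm
      field_simp at h2
      simp
      linarith
  rw [this]
  refine IsClosed.inter (isClosed_singleton.preimage continuous_im) ?_
  exact Int.isClosedEmbedding_coe_real.isClosed_range.preimage
    ((continuous_re.sub continuous_const).div_const _)

/-- The finite set of centres over x and the closed set of all translates of the centres over y are
disjoint, hence have disjoint thickenings. Saturation carries this over to the neighborhoods in the
surface. -/
theorem t2Space_of_stars (hst : ∀ x, Nonempty (G.Star x)) : T2Space S := by
  refine ⟨fun x y hxy => ?_⟩
  obtain ⟨sx⟩ := hst x
  obtain ⟨sy⟩ := hst y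
  set A := Set.range sx.P with hA
  set B := ⋃ z ∈ Set.range sy.P, Set.range fun n : ℤ => z + n * G.width with hB
  have hBc : IsClosed B := sy.finite_range_P.isClosed_biUnion fun z _ => G.isClosed_translates z
  have hd : Disjoint A B := by
    rw [Set.disjoint_left]
    rintro _ ⟨j, rfl⟩ h
    simp only [hB, Set.mem_iUnion] at h
    obtain ⟨_, ⟨k, rfl⟩, n, hn⟩ := h
    apply hxy
    rw [← sx.center j, ← sy.center k, ← hn]
    exact G.param_add_int _ n
  obtain ⟨δ, hδ, hdis⟩ := hd.exists_thickenings sx.finite_range_P.isCompact hBc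
  refine ⟨sx.nhd (min δ sx.r), sy.nhd (min δ sy.r), sx.isOpen_nhd (min_le_right _ _),
    sy.isOpen_nhd (min_le_right _ _), ⟨0, 0, by simp, ?_, ?_⟩, ⟨0, 0, by simp, ?_, ?_⟩, ?_⟩
  · simpa using ⟨hδ, sx.r_pos⟩
  · simp [Star.sector, sx.center]
  · simpa using ⟨hδ, sy.r_pos⟩
  · simp [Star.sector, sy.center]
  · rw [Set.disjoint_left]
    rintro q ⟨j, u, hu, hun, hq⟩ ⟨k, v, hv, hvn, hq'⟩
    obtain ⟨k2, u2, n, hu2, hs, hz⟩ := sx.saturated j u (sy.P k + sy.σ k * v)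
      (hun.le.trans (min_le_right _ _)) hu
      (sy.mem_strip k v (hvn.le.trans (min_le_right _ _)) hv) (hq'.trans hq.symm)
    have hn2 := sx.norm_eq_of_sectorCoord hs
    have norm_sgn : ∀ {c z : ℂ}, c = 1 ∨ c = -1 → ‖c * z‖ = ‖z‖ := by
      rintro c z (rfl | rfl) <;> simp
    refine Set.disjoint_left.1 hdis (?_ : sx.P k2 + sx.σ k2 * u2 ∈ _) ?_
    · rw [Metric.mem_thickening_iff]
      refine ⟨_, ⟨k2, rfl⟩, ?_⟩
      rw [dist_eq_norm, add_sub_cancel_left, norm_sgn (sx.sign _), hn2]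
      exact hun.trans_le (min_le_left _ _)
    · rw [Metric.mem_thickening_iff]
      refine ⟨sy.P k + (-n : ℤ) * G.width, ?_, ?_⟩
      · simp only [hB, Set.mem_iUnion]
        exact ⟨_, ⟨k, rfl⟩, -n, rfl⟩
      · have : sx.P k2 + sx.σ k2 * u2 = sy.P k + sy.σ k * v - n * G.width := by rw [hz]; ring
        rw [dist_eq_norm, this, show sy.P k + sy.σ k * v - n * G.width -
          (sy.P k + (-n : ℤ) * G.width) = sy.σ k * v by push_cast; ring, norm_sgn (sy.sign _)]
        exact hvn.trans_le (min_le_left _ _)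

end CylinderGluing

end

/-! ### Existence of a cycle of half discs around every point -/

noncomputable section

open Filter Complex

namespace CylinderGluing

variable {E S : Type*} [TopologicalSpace S] (G : CylinderGluing E S)

theorem pt_add_mem_strip (e : E) (s : ℝ) {u : ℂ} {r : ℝ} (hr : r < G.height / 2) (hu : ‖u‖ ≤ r)
    (h0 : 0 ≤ u.im) : G.pt e s + G.sgn e * u ∈ G.strip := by
  have := (abs_le.1 ((abs_im_le_norm u).trans hu)).2
  have := G.height_pos
  rcases G.sgn_cases e with ⟨h, h'⟩ | ⟨h, h'⟩ <;> simp [strip, pt, h, h'] <;>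
    constructor <;> linarith

theorem pt_add_mem_interior (e : E) (s : ℝ) {u : ℂ} {r : ℝ} (hr : r < G.height / 2) (hu : ‖u‖ ≤ r)
    (h0 : 0 < u.im) : 0 < (G.pt e s + G.sgn e * u).im ∧
      (G.pt e s + G.sgn e * u).im < G.height := by
  have := (abs_le.1 ((abs_im_le_norm u).trans hu)).2
  have := G.height_pos
  rcases G.sgn_cases e with ⟨h, h'⟩ | ⟨h, h'⟩ <;> simp [pt, h, h'] <;>
    constructor <;> linarith

theorem exists_eq_pt_add (e : E) (s : ℝ) {z : ℂ} (hz : z ∈ G.strip) :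
    ∃ u : ℂ, 0 ≤ u.im ∧ ‖u‖ = ‖z - G.pt e s‖ ∧ z = G.pt e s + G.sgn e * u := by
  rcases G.sgn_cases e with ⟨h, h'⟩ | ⟨h, h'⟩
  · refine ⟨z - G.pt e s, ?_, rfl, by rw [h]; ring⟩
    rw [sub_im, pt_im, h']; simpa using hz.1
  · refine ⟨-(z - G.pt e s), ?_, norm_neg _, by rw [h]; ring⟩
    rw [neg_im, sub_im, pt_im, h']; simpa using hz.2

/-- As r is less than half the height, equal points lie near the same boundary component. Hence the
signs agree and the imaginary parts cancel, leaving an equation between boundary points. -/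
theorem pt_add_eq_pt_add {e e' : E} {s s' : ℝ} {u u' : ℂ} {n : ℤ} {r : ℝ} (hr : r < G.height / 2)
    (hu : ‖u‖ ≤ r) (hu' : ‖u'‖ ≤ r)
    (h : G.pt e s + G.sgn e * u = G.pt e' s' + G.sgn e' * u' + n * G.width) :
    u.im = u'.im ∧ G.pt e (s + u.re) = G.pt e' (s' + u'.re) + n * G.width := by
  have b1 := (abs_le.1 ((abs_im_le_norm u).trans hu)).2
  have b2 := (abs_le.1 ((abs_im_le_norm u').trans hu')).2
  have hh := G.height_pos
  have him := congrArg im h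
  have hre := congrArg re h
  have key : G.sgn e = G.sgn e' ∧ u.im = u'.im := by
    rcases G.sgn_cases e with ⟨h1, h2⟩ | ⟨h1, h2⟩ <;>
    rcases G.sgn_cases e' with ⟨h1', h2'⟩ | ⟨h1', h2'⟩ <;>
    rw [h1, h1'] at him ⊢ <;>
    simp [pt_im, h2, h2'] at him ⊢ <;> linarith
  refine ⟨key.2, ?_⟩
  rw [pt_add, pt_add]
  rw [← re_add_im u, ← re_add_im u', key.2, key.1] at h
  rw [key.1]
  linear_combination h

/-- The cycle of half discs around a boundary point. -/
def boundaryStar {x : S} (m : ℕ) (m_pos : 0 < m) (d : ℕ → E) (s : ℕ → ℝ) (r : ℝ) (r_pos : 0 < r)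
    (hr : r < G.height / 2) (center : ∀ j, G.param (G.pt (d j) (s j)) = x)
    (d_periodic : ∀ j, d (j + m) = d j) (s_periodic : ∀ j, s (j + m) = s j)
    (edge : ∀ j (t : ℝ), 0 ≤ t → t ≤ r → (0 < t ∨ x ∉ G.vertices) →
      ∃ (e : E) (s' : ℝ) (n : ℤ), 0 < s' ∧ s' < G.len e ∧
        G.pt (d (j + 1)) (s (j + 1)) + G.sgn (d (j + 1)) * t = G.pt e s' ∧
        G.sgn (d (j + 1)) = G.sgn e ∧ G.pt (d j) (s j) - G.sgn (d j) * t =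
          G.pt (G.mate e) (G.len e - s') + n * G.width ∧ G.sgn (d j) = G.sgn (G.mate e))
    (vertex : x ∈ G.vertices → ∀ z ∈ G.strip, G.param z = x →
      ∃ (k : ℕ) (n : ℤ), z = G.pt (d k) (s k) + n * G.width)
    (inj : ∀ j k (t t' : ℝ) (n : ℤ), |t| ≤ r → |t'| ≤ r →
      G.pt (d j) (s j + t) = G.pt (d k) (s k + t') + n * G.width → j ≡ k [MOD m] ∧ t = t')
    (eq_two : x ∉ G.vertices → m = 2)
    (eq_period : ∀ e, G.param (G.org e) = x → m = Function.minimalPeriod G.rot e) : G.Star x where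
  m := m
  m_pos := m_pos
  P j := G.pt (d j) (s j)
  σ j := G.sgn (d j)
  r := r
  r_pos := r_pos
  sign j := G.sgn_sign _
  mem_strip j u hu h0 := G.pt_add_mem_strip _ _ hr hu h0
  mem_interior j u hu h0 := G.pt_add_mem_interior _ _ hr hu h0
  center := center
  P_periodic j := by rw [d_periodic, s_periodic]
  σ_periodic j := by rw [d_periodic]
  glue j t h0 h1 := by
    by_cases h : 0 < t ∨ x ∉ G.vertices
    · obtain ⟨e, s', n, hs0, hs1, he, -, he', -⟩ := edge j t h0 h1 h
      rw [he, he', G.param_add_int]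
      exact (G.glue_pt e hs0.le hs1.le).symm
    · have : t = 0 := by
        rw [not_or, not_lt] at h
        linarith
      simp [this, center]
  saturated j u z hu h0 hz hF := by
    -- Saturation has content only on the boundary of the half discs. It is proved for positive
    -- rays; a point of a negative ray is glued to the positive ray of the next half disc.
    have real : ∀ j (t : ℝ), 0 ≤ t → t ≤ r →
        G.param z = G.param (G.pt (d (j + 1)) (s (j + 1)) + G.sgn (d (j + 1)) * t) →
        ∃ (k : ℕ) (u' : ℂ) (n : ℤ), 0 ≤ u'.im ∧ sectorCoord m k u' = sectorCoord m (j + 1) t ∧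
          z = G.pt (d k) (s k) + G.sgn (d k) * u' + n * G.width := by
      intro j t h0 h1 hF
      by_cases h : 0 < t ∨ x ∉ G.vertices
      · obtain ⟨e, s', n, hs0, hs1, he, -, he', -⟩ := edge j t h0 h1 h
        rw [he] at hF
        obtain ⟨n', hz' | hz'⟩ := G.fiber_edge e s' z hs0 hs1 hz.1 hz.2 hF
        · exact ⟨j + 1, t, n', by simp, rfl, by rw [he]; exact hz'⟩
        · refine ⟨j, -t, n' - n, by simp, ?_, ?_⟩
          · rcases h0.eq_or_lt with rfl | h0
            · simp
            · exact sectorCoord_neg j h0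
          · rw [mul_neg, ← sub_eq_add_neg, he', hz', pt]; push_cast; ring
      · rw [not_or, not_lt, not_not] at h
        have : t = 0 := le_antisymm h.1 h0
        subst this
        obtain ⟨k, n, hk⟩ := vertex h.2 z hz (by rw [hF]; simpa using center (j + 1))
        exact ⟨k, 0, n, by simp, by simp, by simpa using hk⟩
    rcases h0.lt_or_eq with h0 | h0
    · have hi := G.pt_add_mem_interior (d j) (s j) hr hu h0
      obtain ⟨n, hn⟩ := G.fiber_interior _ z hi.1 hi.2 hz.1 hz.2 hF
      exact ⟨j, u, n, h0.le, rfl, hn⟩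
    · have hre : u = (u.re : ℂ) := Complex.ext rfl (by simpa using h0.symm)
      have hur := (abs_re_le_norm u).trans hu
      rcases le_total 0 u.re with hp | hp
      · rw [abs_of_nonneg hp] at hur
        -- `real` speaks of the index `j + 1`; periodicity provides a predecessor also for `j = 0`.
        have e1 : j + m - 1 + 1 = j + m := by omega
        rw [hre] at hF ⊢
        obtain ⟨k, u', n, h1, h2, h3⟩ := real (j + m - 1) u.re hp hur (by
          rw [e1, d_periodic, s_periodic]; exact hF)
        rw [e1, sectorCoord_add_period m_pos] at h2
        exact ⟨k, u', n, h1, h2, h3⟩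
      · rw [abs_of_nonpos hp] at hur
        have e2 : u = -((-u.re : ℝ) : ℂ) := by rw [hre]; simp
        rcases hp.eq_or_lt with hp0 | hp0
        · by_cases hxv : x ∈ G.vertices
          · obtain ⟨k, n, hk⟩ := vertex hxv z hz (by rw [hF, hre, hp0]; simpa using center j)
            exact ⟨k, 0, n, by simp, by rw [hre, hp0]; simp, by simpa using hk⟩
          · obtain ⟨k, u', n, h1, h2, h3⟩ := real j 0 le_rfl r_pos.le (by
              rw [hF, hre, hp0]; simp [center])
            exact ⟨k, u', n, h1, by rw [h2, hre, hp0]; simp, h3⟩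
        · obtain ⟨e, s', n, hs0, hs1, he, -, he', -⟩ :=
            edge j (-u.re) (by linarith) hur (Or.inl (by linarith))
          rw [e2, mul_neg, ← sub_eq_add_neg, he', G.param_add_int, ← G.glue_pt e hs0.le hs1.le,
            ← he] at hF
          obtain ⟨k, u', n, h1, h2, h3⟩ := real j (-u.re) (by linarith) hur hF
          refine ⟨k, u', n, h1, ?_, h3⟩
          rw [h2, e2, sectorCoord_neg j (by linarith)]
          simp
  translation_inj j k u u' n hu hu' h0 h0' h := by
    obtain ⟨h1, h2⟩ := G.pt_add_eq_pt_add hr hu hu' h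
    obtain ⟨h3, h4⟩ := inj j k _ _ n ((abs_re_le_norm u).trans hu) ((abs_re_le_norm u').trans hu') h2
    rw [Complex.ext h4 h1]
    exact sectorCoord_congr m_pos h3 u'
  cover j z hz _ := by
    obtain ⟨u, h1, h2, h3⟩ := G.exists_eq_pt_add (d j) (s j) hz
    exact ⟨j, u, h1, h2, h3⟩
  edge j t h0 h1 h := Or.inr (edge j t h0 h1 h)
  eq_two := eq_two
  eq_period := eq_period

/-- A disc cut along its horizontal diameter is a cycle of two half discs with opposite signs. A
radius of at most a quarter of the width keeps it apart from its translates. -/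
theorem nonempty_star_interior {z : ℂ} (h0 : 0 < z.im) (h1 : z.im < G.height) :
    Nonempty (G.Star (G.param z)) := by
  set r : ℝ := min (min z.im (G.height - z.im)) G.width / 4 with hr
  have hw := G.width_pos
  have hm : 0 < min (min z.im (G.height - z.im)) G.width := by
    simp only [lt_min_iff]; exact ⟨⟨h0, by linarith⟩, hw⟩
  have r_pos : 0 < r := by positivity
  have r1 : r ≤ z.im / 4 := by
    have : min (min z.im (G.height - z.im)) G.width ≤ z.im :=
      (min_le_left _ _).trans (min_le_left _ _)
    linarith
  have r2 : r ≤ (G.height - z.im) / 4 := by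
    have : min (min z.im (G.height - z.im)) G.width ≤ G.height - z.im :=
      (min_le_left _ _).trans (min_le_right _ _)
    linarith
  have r3 : r ≤ G.width / 4 := by
    have : min (min z.im (G.height - z.im)) G.width ≤ G.width := min_le_right _ _
    linarith
  set σ : ℕ → ℂ := fun j => if j % 2 = 0 then 1 else -1 with hσ
  have sign : ∀ j, σ j = 1 ∨ σ j = -1 := fun j => by simp only [hσ]; split_ifs <;> simp
  have inter : ∀ j u, ‖u‖ ≤ r → 0 < (z + σ j * u).im ∧ (z + σ j * u).im < G.height := by
    intro j u hu
    have := abs_le.1 ((abs_im_le_norm u).trans hu)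
    rcases sign j with h | h <;> simp [h] <;> constructor <;> linarith
  have succ : ∀ j, σ j = -σ (j + 1) := by
    intro j
    simp only [hσ]
    rcases Nat.mod_two_eq_zero_or_one j with h | h
    · simp [h, show (j + 1) % 2 = 1 by omega]
    · simp [h, show (j + 1) % 2 = 0 by omega]
  have opp : ∀ j k (t : ℝ), ¬ j ≡ k [MOD 2] → sectorCoord 2 j t = sectorCoord 2 k (-t) := by
    intro j k t hjk
    rcases lt_trichotomy t 0 with h | rfl | h
    · have h2 : (t : ℂ) = -((-t : ℝ) : ℂ) := by simp
      rw [h2, sectorCoord_neg j (by linarith), neg_neg]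
      exact sectorCoord_congr two_pos (by unfold Nat.ModEq at *; omega) _
    · simp
    · rw [sectorCoord_neg k h]
      exact sectorCoord_congr two_pos (by unfold Nat.ModEq at *; omega) _
  refine ⟨⟨2, two_pos, fun _ => z, σ, r, r_pos, sign, ?_, fun j u hu _ => inter j u hu, fun _ => rfl,
    fun _ => rfl, ?_, ?_, ?_, ?_, ?_, ?_, fun _ => rfl, ?_⟩⟩
  · intro j u hu _
    exact ⟨(inter j u hu).1.le, (inter j u hu).2.le⟩
  · intro j; simp [hσ]
  · intro j t _ _
    rw [succ j]; congr 1; ring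
  · intro j u y hu hu0 hy hF
    obtain ⟨n, hn⟩ := G.fiber_interior _ y (inter j u hu).1 (inter j u hu).2 hy.1 hy.2 hF
    exact ⟨j, u, n, hu0, rfl, hn⟩
  · intro j k u u' n hu hu' hu0 hu0' h
    have e1 : (n : ℂ) * G.width = σ j * u - σ k * u' := by linear_combination -h
    have nsg : ∀ j (v : ℂ), ‖σ j * v‖ = ‖v‖ := by
      intro j v; rcases sign j with h | h <;> simp [h]
    have e2 : ‖(n : ℂ) * G.width‖ ≤ r + r := by
      rw [e1]
      refine (norm_sub_le _ _).trans ?_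
      rw [nsg, nsg]; linarith
    have hn : n = 0 := by
      by_contra hn
      have h1 : (1 : ℝ) ≤ |(n : ℝ)| := by exact_mod_cast Int.one_le_abs hn
      rw [norm_mul, norm_intCast, norm_real, Real.norm_of_nonneg hw.le] at e2
      nlinarith
    subst hn
    have h : σ j * u = σ k * u' := by simpa using h
    by_cases hjk : j ≡ k [MOD 2]
    · have : σ j = σ k := by
        simp only [hσ]; rw [hjk]
      rw [this] at h
      have h0 : σ k ≠ 0 := by rcases sign k with h | h <;> simp [h]
      rw [mul_left_cancel₀ h0 h]
      exact sectorCoord_congr two_pos hjk u'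
    · have : σ j = - σ k := by
        simp only [hσ]
        unfold Nat.ModEq at hjk
        rcases Nat.mod_two_eq_zero_or_one j with h | h
        · simp [h, show k % 2 = 1 by omega]
        · simp [h, show k % 2 = 0 by omega]
      rw [this] at h
      have h0 : σ k ≠ 0 := by rcases sign k with h | h <;> simp [h]
      have h2 : u' = -u := mul_left_cancel₀ h0 (by rw [← h]; ring)
      have him : u.im = 0 := by
        rw [h2, neg_im] at hu0'; linarith
      have hre : u = (u.re : ℂ) := Complex.ext rfl (by simpa using him)
      rw [h2, hre]
      exact opp j k _ hjk
  · intro _ y hy hyr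
    rcases le_total 0 (y - z).im with h | h
    · exact ⟨0, y - z, h, rfl, by simp [hσ]⟩
    · exact ⟨1, -(y - z), by rw [neg_im]; linarith, norm_neg _, by simp [hσ]⟩
  · intro j t _ _ _
    exact Or.inl ⟨h0, h1, rfl, succ j⟩
  · intro e he
    exact absurd he (by simpa using G.pt_ne_interior (e := e) (s := 0) h0 h1)

/-- One half disc sits at the point of `e`, the other at the corresponding point of `mate e`; the
radius is so small that neither reaches the end of its edge. -/
theorem nonempty_star_edge {e : E} {s : ℝ} (h0 : 0 < s) (h1 : s < G.len e) :
    Nonempty (G.Star (G.param (G.pt e s))) := by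
  set r : ℝ := min (min s (G.len e - s)) G.height / 4 with hr
  have hh := G.height_pos
  have hm : 0 < min (min s (G.len e - s)) G.height := by
    simp only [lt_min_iff]; exact ⟨⟨h0, by linarith⟩, hh⟩
  have r_pos : 0 < r := by positivity
  have r1 : r < s := by
    have : min (min s (G.len e - s)) G.height ≤ s := (min_le_left _ _).trans (min_le_left _ _)
    linarith
  have r2 : r < G.len e - s := by
    have : min (min s (G.len e - s)) G.height ≤ G.len e - s :=
      (min_le_left _ _).trans (min_le_right _ _)
    linarith
  have r3 : r < G.height / 2 := by
    have : min (min s (G.len e - s)) G.height ≤ G.height := min_le_right _ _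
    linarith
  have hxv := G.pt_notMem_vertices h0 h1
  refine ⟨G.boundaryStar 2 two_pos (fun j => if j % 2 = 0 then e else G.mate e)
    (fun j => if j % 2 = 0 then s else G.len e - s) r r_pos r3 ?_ ?_ ?_ ?_ (fun h => absurd h hxv)
    ?_ (fun _ => rfl) (fun e h => absurd ⟨e, h⟩ hxv)⟩
  · intro j
    split_ifs
    · rfl
    · exact (G.glue_pt e h0.le h1.le).symm
  · intro j; simp
  · intro j; simp
  · intro j t ht0 ht1 _
    rcases Nat.mod_two_eq_zero_or_one j with h | h
    · have h' : ¬ (j + 1) % 2 = 0 := by omega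
      rw [if_pos h, if_pos h, if_neg h', if_neg h']
      refine ⟨G.mate e, G.len e - s + t, 0, by linarith, by rw [G.len_mate]; linarith,
        by rw [pt_add], rfl, ?_, by rw [G.mate_mate]⟩
      rw [G.mate_mate, G.len_mate, show G.len e - (G.len e - s + t) = s + (-t) by ring, pt_add]
      push_cast; ring
    · have h' : (j + 1) % 2 = 0 := by omega
      have h : ¬ j % 2 = 0 := by omega
      rw [if_neg h, if_neg h, if_pos h', if_pos h']
      refine ⟨e, s + t, 0, by linarith, by linarith, by rw [pt_add], rfl, ?_, rfl⟩
      rw [show G.len e - (s + t) = G.len e - s + (-t) by ring, pt_add]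
      push_cast; ring
  · intro j k t t' n ht ht' h
    rw [abs_le] at ht ht'
    unfold Nat.ModEq
    rcases Nat.mod_two_eq_zero_or_one j with hj | hj <;>
    rcases Nat.mod_two_eq_zero_or_one k with hk | hk <;>
    simp only [hj, hk, if_true, one_ne_zero, if_false] at h ⊢
    · have := G.pt_inj _ _ _ _ n (by linarith) (by linarith) (by linarith) (by linarith) h
      exact ⟨trivial, by linarith [this.2]⟩
    · have := G.pt_inj _ _ _ _ n (by linarith) (by linarith) (by linarith)
        (by rw [G.len_mate]; linarith) h
      exact absurd this.1.symm (G.mate_ne e)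
    · have := G.pt_inj _ _ _ _ n (by linarith) (by rw [G.len_mate]; linarith) (by linarith)
        (by linarith) h
      exact absurd this.1 (G.mate_ne e)
    · have := G.pt_inj _ _ _ _ n (by linarith) (by rw [G.len_mate]; linarith) (by linarith)
        (by rw [G.len_mate]; linarith) h
      exact ⟨trivial, by linarith [this.2]⟩

/-- The half discs are centred at the origins of e, rot e, rot² e, …, and their number is the
period. The negative ray at one origin runs along the preceding edge, the mate of the next edge of
the cycle. A radius below half of every edge length separates the two ends of an edge. -/
theorem nonempty_star_vertex [Finite E] (e : E) : Nonempty (G.Star (G.param (G.org e))) := by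
  have : Nonempty E := ⟨e⟩
  obtain ⟨e₀, he₀⟩ := Finite.exists_min G.len
  have hl := G.len_pos e₀
  have hh := G.height_pos
  set r : ℝ := min (G.len e₀) G.height / 4 with hr
  have r_pos : 0 < r := by
    have : 0 < min (G.len e₀) G.height := lt_min hl hh
    positivity
  have r1 : ∀ e, r < G.len e / 2 := by
    intro e
    have : min (G.len e₀) G.height ≤ G.len e₀ := min_le_left _ _
    linarith [he₀ e]
  have r2 : r < G.height / 2 := by
    have : min (G.len e₀) G.height ≤ G.height := min_le_right _ _
    linarith
  have hper := (G.rot.injective.mem_periodicPts e)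
  have hxv : G.param (G.org e) ∈ G.vertices := ⟨e, rfl⟩
  set m := Function.minimalPeriod G.rot e with hm
  have m_pos : 0 < m := Function.minimalPeriod_pos_of_mem_periodicPts hper
  have pow_m : (G.rot ^ m) e = e := by
    rw [← Equiv.Perm.iterate_eq_pow]; exact Function.isPeriodicPt_minimalPeriod _ _
  have rot_inj : ∀ j k, (G.rot ^ j) e = (G.rot ^ k) e → j ≡ k [MOD m] := by
    intro j k h
    rw [← Equiv.Perm.iterate_eq_pow, ← Equiv.Perm.iterate_eq_pow,
      ← Function.iterate_mod_minimalPeriod_eq (n := j),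
      ← Function.iterate_mod_minimalPeriod_eq (n := k),
      Function.iterate_eq_iterate_iff_of_lt_minimalPeriod (Nat.mod_lt _ m_pos)
        (Nat.mod_lt _ m_pos)] at h
    exact h
  -- Points before an origin are rewritten as points near the end of the preceding edge, so that
  -- `pt_inj`, which needs parameters within an edge, can be used.
  have back : ∀ j t, |t| ≤ r → t < 0 → ∃ n : ℤ, G.pt ((G.rot ^ j) e) (0 + t) =
      G.pt (G.mate ((G.rot ^ (j + 1)) e)) (G.len ((G.rot ^ (j + 1)) e) + t) + n * G.width := by
    intro j t _ _
    obtain ⟨n, hn⟩ := G.org_eq ((G.rot ^ j) e)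
    refine ⟨n, ?_⟩
    rw [pow_succ', Equiv.Perm.mul_apply, pt, hn, pt, G.sgn_mate_rot]
    push_cast; ring
  refine ⟨G.boundaryStar m m_pos (fun j => (G.rot ^ j) e) (fun _ => 0) r r_pos r2 ?_ ?_
    (fun _ => rfl) ?_ ?_ ?_ (fun h => absurd hxv h) ?_⟩
  · intro j; rw [pt_zero]; exact G.param_org_rot_pow e j
  · intro j; rw [pow_add, Equiv.Perm.mul_apply, pow_m]
  · intro j t ht0 ht1 h
    have ht : 0 < t := h.resolve_right (fun h => h hxv)
    have hl := r1 ((G.rot ^ (j + 1)) e)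
    obtain ⟨n, hn⟩ := G.org_eq ((G.rot ^ j) e)
    refine ⟨(G.rot ^ (j + 1)) e, t, n, ht, by linarith, by simp [pt], rfl, ?_, ?_⟩
    · rw [pow_succ', Equiv.Perm.mul_apply, pt_zero, pt, G.sgn_mate_rot]
      conv_lhs => rw [hn]
      push_cast; ring
    · rw [pow_succ', Equiv.Perm.mul_apply, G.sgn_mate_rot]
  · intro _ z hz hF
    simpa using G.fiber_vertex e z hz.1 hz.2 hF
  · intro j k t t' n ht ht' h
    have b := abs_le.1 ht
    have b' := abs_le.1 ht'
    have hj := r1 ((G.rot ^ j) e)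
    have hk := r1 ((G.rot ^ k) e)
    have hj1 := r1 ((G.rot ^ (j + 1)) e)
    have hk1 := r1 ((G.rot ^ (k + 1)) e)
    have hmj := G.len_mate ((G.rot ^ (j + 1)) e)
    have hmk := G.len_mate ((G.rot ^ (k + 1)) e)
    have mate_inj : ∀ {a b : E}, G.mate a = G.mate b → a = b := fun {a b} h => by
      rw [← G.mate_mate a, h, G.mate_mate]
    rcases lt_or_ge t 0 with hn | hn <;> rcases lt_or_ge t' 0 with hn' | hn'
    · obtain ⟨i, hi⟩ := back j t ht hn
      obtain ⟨i', hi'⟩ := back k t' ht' hn'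
      rw [hi, hi'] at h
      have h' : G.pt (G.mate ((G.rot ^ (j + 1)) e)) (G.len ((G.rot ^ (j + 1)) e) + t) =
          G.pt (G.mate ((G.rot ^ (k + 1)) e)) (G.len ((G.rot ^ (k + 1)) e) + t') + (i' + n - i : ℤ) * G.width := by
        push_cast; linear_combination h
      have := G.pt_inj _ _ _ _ _ (by linarith) (by linarith) (by linarith) (by linarith) h'
      have h2 := mate_inj this.1
      rw [h2] at this
      refine ⟨Nat.ModEq.add_right_cancel' 1 (rot_inj _ _ h2), by linarith [this.2]⟩
    · obtain ⟨i, hi⟩ := back j t ht hn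
      rw [hi] at h
      have h' : G.pt (G.mate ((G.rot ^ (j + 1)) e)) (G.len ((G.rot ^ (j + 1)) e) + t) =
          G.pt ((G.rot ^ k) e) (0 + t') + (n - i : ℤ) * G.width := by
        push_cast; linear_combination h
      have := G.pt_inj _ _ _ _ _ (by linarith) (by linarith) (by linarith) (by linarith) h'
      linarith [this.2]
    · obtain ⟨i', hi'⟩ := back k t' ht' hn'
      rw [hi'] at h
      have h' : G.pt ((G.rot ^ j) e) (0 + t) =
          G.pt (G.mate ((G.rot ^ (k + 1)) e)) (G.len ((G.rot ^ (k + 1)) e) + t') + (i' + n : ℤ) * G.width := by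
        push_cast; linear_combination h
      have := G.pt_inj _ _ _ _ _ (by linarith) (by linarith) (by linarith) (by linarith) h'
      linarith [this.2]
    · have := G.pt_inj _ _ _ _ n (by linarith) (by linarith) (by linarith) (by linarith) h
      exact ⟨rot_inj _ _ this.1, by linarith [this.2]⟩
  · intro e' he'
    obtain ⟨k, rfl⟩ := G.eq_rot_pow_of_vertex he'
    rw [← Equiv.Perm.iterate_eq_pow, Function.minimalPeriod_apply_iterate hper]

theorem nonempty_star [Finite E] (x : S) : Nonempty (G.Star x) := by
  obtain ⟨z, h0, h1, rfl⟩ := G.surj x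
  by_cases h : 0 < z.im ∧ z.im < G.height
  · exact G.nonempty_star_interior h.1 h.2
  · have hb : z.im = 0 ∨ z.im = G.height := by
      rw [not_and_or, not_lt, not_lt] at h
      rcases h with h | h
      · exact Or.inl (le_antisymm h h0)
      · exact Or.inr (le_antisymm h1 h)
    obtain ⟨e, s, n, hs0, hs1, rfl⟩ := G.exists_pt z hb
    rw [G.param_add_int]
    rcases hs0.eq_or_lt with rfl | hs0
    · simpa using G.nonempty_star_vertex e
    · exact G.nonempty_star_edge hs0 hs1

end CylinderGluing

end

/-! ### Charts around the points of the glued surface -/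

noncomputable section

open Filter Complex

namespace CylinderGluing

variable {E S : Type*} [TopologicalSpace S] {G : CylinderGluing E S}

namespace Star

variable {x : S} (st : G.Star x)

/-- The radius of the chart. -/
def radius : ℝ := st.r ^ (2 / st.m : ℝ)

theorem radius_pos : 0 < st.radius := Real.rpow_pos_of_pos st.r_pos _

theorem norm_sectorCoord_le {j : ℕ} {u : ℂ} :
    ‖sectorCoord st.m j u‖ ≤ st.radius ↔ ‖u‖ ≤ st.r := by
  have := st.m_pos
  rw [norm_sectorCoord st.m_pos, radius]
  exact Real.rpow_le_rpow_iff (norm_nonneg _) st.r_pos.le (by positivity)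

theorem norm_sectorCoord_lt {j : ℕ} {u : ℂ} :
    ‖sectorCoord st.m j u‖ < st.radius ↔ ‖u‖ < st.r := by
  have := st.m_pos
  rw [norm_sectorCoord st.m_pos, radius]
  exact Real.rpow_lt_rpow_iff (norm_nonneg _) st.r_pos.le (by positivity)

/-- The parametrization of a neighborhood by a disc. -/
def psi (ζ : ℂ) : S :=
  st.sector (exists_sectorCoord_eq st.m_pos ζ).choose
    (exists_sectorCoord_eq st.m_pos ζ).choose_spec.2.choose

theorem psi_sectorCoord (j : ℕ) {u : ℂ} (hu : 0 ≤ u.im) (hr : ‖u‖ ≤ st.r) :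
    st.psi (sectorCoord st.m j u) = st.sector j u := by
  have h := (exists_sectorCoord_eq st.m_pos (sectorCoord st.m j u)).choose_spec.2.choose_spec
  refine (st.sector_eq_of_sectorCoord hu h.1 hr h.2.symm).symm

theorem exists_rep {ζ : ℂ} (hζ : ‖ζ‖ ≤ st.radius) :
    ∃ j < st.m, ∃ u : ℂ, 0 ≤ u.im ∧ ‖u‖ ≤ st.r ∧ sectorCoord st.m j u = ζ ∧
      st.psi ζ = st.sector j u := by
  obtain ⟨j, hj, u, hu, rfl⟩ := exists_sectorCoord_eq st.m_pos ζ
  have hr := st.norm_sectorCoord_le.1 hζ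
  exact ⟨j, hj, u, hu, hr, rfl, st.psi_sectorCoord j hu hr⟩

theorem continuous_sector (j : ℕ) : Continuous (st.sector j) :=
  G.continuous_param.comp (continuous_const.add (continuous_const.mul continuous_id))

/-- The disc consists of finitely many closed sectors, each the image of a compact half disc on
which the composition is continuous; so the preimage of a closed set is a finite union of compact
sets. -/
theorem continuousOn_psi : ContinuousOn st.psi (Metric.closedBall 0 st.radius) := by
  rw [continuousOn_iff_isClosed]
  intro C hC
  have hH : IsCompact {u : ℂ | 0 ≤ u.im ∧ ‖u‖ ≤ st.r} := by
    have : {u : ℂ | 0 ≤ u.im ∧ ‖u‖ ≤ st.r} = Metric.closedBall 0 st.r ∩ {u | 0 ≤ u.im} := by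
      ext u; simp [and_comm]
    rw [this]
    exact (isCompact_closedBall _ _).inter_right (isClosed_le continuous_const continuous_im)
  refine ⟨⋃ j ∈ Finset.range st.m, sectorCoord st.m j ''
    ({u : ℂ | 0 ≤ u.im ∧ ‖u‖ ≤ st.r} ∩ st.sector j ⁻¹' C), ?_, ?_⟩
  · refine isClosed_biUnion_finset fun j _ => ?_
    refine ((hH.inter_right (hC.preimage (st.continuous_sector j))).image_of_continuousOn
      ((continuousOn_sectorCoord st.m_pos j).mono ?_)).isClosed
    rintro u ⟨h, -⟩
    exact h.1
  · ext ζ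
    simp only [Set.mem_inter_iff, Set.mem_preimage, Metric.mem_closedBall, dist_zero_right,
      Set.mem_iUnion, Finset.mem_range, Set.mem_image]
    refine and_congr_left fun hζ => ?_
    constructor
    · intro h
      obtain ⟨j, hj, u, hu, hr, rfl, hp⟩ := st.exists_rep hζ
      exact ⟨j, hj, u, ⟨⟨hu, hr⟩, hp ▸ h⟩, rfl⟩
    · rintro ⟨j, -, u, ⟨⟨hu, hr⟩, h⟩, rfl⟩
      rw [st.psi_sectorCoord j hu hr]; exact h

theorem injOn_psi : Set.InjOn st.psi (Metric.closedBall 0 st.radius) := by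
  intro ζ hζ ζ' hζ' h
  rw [mem_closedBall_zero_iff] at hζ hζ'
  obtain ⟨j, -, u, hu, hr, rfl, hp⟩ := st.exists_rep hζ
  obtain ⟨k, -, v, hv, hr', rfl, hp'⟩ := st.exists_rep hζ'
  exact st.sectorCoord_eq_of_sector hu hv hr hr' (by rw [← hp, ← hp', h])

theorem psi_image_ball : st.psi '' Metric.ball 0 st.radius = st.nhd st.r := by
  ext y
  constructor
  · rintro ⟨ζ, hζ, rfl⟩
    rw [mem_ball_zero_iff] at hζ
    obtain ⟨j, -, u, hu, hr, rfl, hp⟩ := st.exists_rep hζ.le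
    exact ⟨j, u, hu, st.norm_sectorCoord_lt.1 hζ, hp.symm⟩
  · rintro ⟨j, u, hu, hr, rfl⟩
    exact ⟨sectorCoord st.m j u, mem_ball_zero_iff.2 (st.norm_sectorCoord_lt.2 hr),
      st.psi_sectorCoord j hu hr.le⟩

/-- By compactness the rest of the closed disc has closed image, which by injectivity misses the
image of `O`, and the whole open disc has open image by `isOpen_nhd`. -/
theorem isOpen_psi_image [T2Space S] {O : Set ℂ} (hO : IsOpen O)
    (hsub : O ⊆ Metric.ball 0 st.radius) : IsOpen (st.psi '' O) := by
  have hc : IsClosed (st.psi '' (Metric.closedBall 0 st.radius \ O)) :=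
    (((isCompact_closedBall _ _).diff hO).image_of_continuousOn
      (st.continuousOn_psi.mono Set.sdiff_subset)).isClosed
  have : st.psi '' O = st.nhd st.r ∩ (st.psi '' (Metric.closedBall 0 st.radius \ O))ᶜ := by
    rw [← st.psi_image_ball]
    ext y
    constructor
    · rintro ⟨ζ, hζ, rfl⟩
      refine ⟨⟨ζ, hsub hζ, rfl⟩, ?_⟩
      rintro ⟨ζ', ⟨h1, h2⟩, h3⟩
      exact h2 (st.injOn_psi h1 (Metric.ball_subset_closedBall (hsub hζ)) h3 ▸ hζ)
    · rintro ⟨⟨ζ, hζ, rfl⟩, h⟩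
      by_contra hc
      exact h ⟨ζ, ⟨Metric.ball_subset_closedBall hζ, fun h' => hc ⟨ζ, h', rfl⟩⟩, rfl⟩
  rw [this]
  exact (st.isOpen_nhd le_rfl).inter hc.isOpen_compl

/-- The chart around a point surrounded by a cycle of half discs. -/
def chart [T2Space S] : OpenPartialHomeomorph S ℂ where
  toFun := Function.invFunOn st.psi (Metric.ball 0 st.radius)
  invFun := st.psi
  source := st.psi '' Metric.ball 0 st.radius
  target := Metric.ball 0 st.radius
  map_source' _ h := Function.invFunOn_mem h
  map_target' _ h := ⟨_, h, rfl⟩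
  left_inv' _ h := Function.invFunOn_eq h
  right_inv' _ h := (st.injOn_psi.mono Metric.ball_subset_closedBall).leftInvOn_invFunOn h
  open_source := st.isOpen_psi_image Metric.isOpen_ball subset_rfl
  open_target := Metric.isOpen_ball
  continuousOn_toFun := by
    have hinj := st.injOn_psi.mono Metric.ball_subset_closedBall
    rw [continuousOn_iff']
    intro t ht
    refine ⟨st.psi '' (t ∩ Metric.ball 0 st.radius), st.isOpen_psi_image
      (ht.inter Metric.isOpen_ball) Set.inter_subset_right, ?_⟩
    ext y
    constructor
    · rintro ⟨h1, h2⟩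
      refine ⟨⟨_, ⟨h1, Function.invFunOn_mem h2⟩, Function.invFunOn_eq h2⟩, h2⟩
    · rintro ⟨⟨ζ, ⟨h1, h2⟩, rfl⟩, h3⟩
      refine ⟨?_, h3⟩
      rw [Set.mem_preimage, hinj.leftInvOn_invFunOn h2]
      exact h1
  continuousOn_invFun := st.continuousOn_psi.mono Metric.ball_subset_closedBall

theorem psi_zero : st.psi 0 = x := by
  have := st.psi_sectorCoord 0 (u := 0) (by simp) (by simpa using st.r_pos.le)
  rw [sectorCoord_zero] at this
  rw [this, sector, mul_zero, add_zero, st.center]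

theorem mem_chart_source [T2Space S] : x ∈ st.chart.source :=
  ⟨0, Metric.mem_ball_self st.radius_pos, st.psi_zero⟩

theorem chart_self [T2Space S] : st.chart x = 0 := by
  have h : st.chart (st.psi 0) = 0 := st.chart.right_inv (Metric.mem_ball_self st.radius_pos)
  rwa [st.psi_zero] at h

/-- Away from the center, or everywhere if the center is not a vertex, the inverse of the chart is a
holomorphic function followed by a flat coordinate. -/
theorem exists_branch {a : ℂ} (ha : ‖a‖ < st.radius) (h : a ≠ 0 ∨ x ∉ G.vertices) :
    ∃ (j : ℕ) (u₀ : ℂ) (U : ℂ → ℂ), ‖u₀‖ < st.r ∧ (0 < u₀.im ∨ 0 ≤ u₀.re ∧ u₀.im = 0) ∧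
      (0 < u₀.im ∨ 0 < u₀.re ∨ x ∉ G.vertices) ∧ AnalyticAt ℂ U a ∧ U a = u₀ ∧
      (∀ᶠ ζ in 𝓝 a, deriv U ζ ^ 2 = (st.m / 2 : ℂ) ^ 2 * ζ ^ ((st.m : ℤ) - 2)) ∧
      st.psi a = st.sector (j + 1) u₀ ∧
      (∀ᶠ ζ in 𝓝 a, 0 ≤ (U ζ).im → st.psi ζ = st.sector (j + 1) (U ζ)) ∧
      (u₀.im = 0 → ∀ᶠ ζ in 𝓝 a, (U ζ).im ≤ 0 → st.psi ζ = st.sector j (-U ζ)) := by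
  have main : ∃ (j : ℕ) (u₀ : ℂ) (U : ℂ → ℂ), ‖u₀‖ < st.r ∧ (0 < u₀.im ∨ 0 ≤ u₀.re ∧ u₀.im = 0) ∧
      (0 < u₀.im ∨ 0 < u₀.re ∨ x ∉ G.vertices) ∧ AnalyticAt ℂ U a ∧ U a = u₀ ∧
      (∀ᶠ ζ in 𝓝 a, deriv U ζ ^ 2 = (st.m / 2 : ℂ) ^ 2 * ζ ^ ((st.m : ℤ) - 2)) ∧
      (∀ᶠ ζ in 𝓝 a, 0 ≤ (U ζ).im → sectorCoord st.m (j + 1) (U ζ) = ζ) ∧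
      (u₀.im = 0 → ∀ᶠ ζ in 𝓝 a, (U ζ).im ≤ 0 → sectorCoord st.m j (-U ζ) = ζ) := by
    by_cases ha0 : a = 0
    -- At a centre that is not a vertex m = 2, the sector coordinates 2 and 1 are ζ = u and ζ = -u,
    -- and the identity serves as the branch U.
    · have hx := h.resolve_left (not_not.2 ha0)
      have hm := st.eq_two hx
      subst ha0
      have h1 : ∀ u : ℂ, sectorCoord 2 (1 + 1) u = u := by
        intro u
        by_cases hu : u = 0
        · simp [hu]
        rw [sectorCoord_of_ne _ _ hu]
        conv_rhs => rw [← exp_log hu]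
        rw [exp_eq_exp_iff_exists_int]
        exact ⟨1, by push_cast; ring⟩
      have h2 : ∀ u : ℂ, sectorCoord 2 1 u = -u := by
        intro u
        by_cases hu : u = 0
        · simp [hu]
        rw [sectorCoord_of_ne _ _ hu]
        have : (2 / (2 : ℕ) : ℂ) * (log u + Real.pi * (1 : ℕ) * I) = log u + Real.pi * I := by
          push_cast; ring
        rw [this, exp_add, exp_log hu, exp_pi_mul_I]; ring
      refine ⟨1, 0, id, by simpa using st.r_pos, by simp, Or.inr (Or.inr hx), analyticAt_id, rfl, ?_,
        ?_, ?_⟩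
      · rw [hm]; simp
      · rw [hm]; exact Eventually.of_forall fun ζ _ => h1 ζ
      · intro _
        rw [hm]; exact Eventually.of_forall fun ζ _ => by rw [h2]; simp
    · obtain ⟨j, -, u, hu, -, rfl, -⟩ := st.exists_rep ha.le
      have hr := st.norm_sectorCoord_lt.1 ha
      have hu0 : u ≠ 0 := by rintro rfl; simp at ha0
      have conv : ∀ j (u₀ : ℂ), ‖u₀‖ < st.r → (0 < u₀.im ∨ 0 < u₀.re ∧ u₀.im = 0) →
          ∀ a, a = sectorCoord st.m (j + 1) u₀ →
          ∃ (j : ℕ) (u₀ : ℂ) (U : ℂ → ℂ), ‖u₀‖ < st.r ∧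
            (0 < u₀.im ∨ 0 ≤ u₀.re ∧ u₀.im = 0) ∧
            (0 < u₀.im ∨ 0 < u₀.re ∨ x ∉ G.vertices) ∧ AnalyticAt ℂ U a ∧ U a = u₀ ∧
            (∀ᶠ ζ in 𝓝 a, deriv U ζ ^ 2 = (st.m / 2 : ℂ) ^ 2 * ζ ^ ((st.m : ℤ) - 2)) ∧
            (∀ᶠ ζ in 𝓝 a, 0 ≤ (U ζ).im → sectorCoord st.m (j + 1) (U ζ) = ζ) ∧
            (u₀.im = 0 → ∀ᶠ ζ in 𝓝 a, (U ζ).im ≤ 0 → sectorCoord st.m j (-U ζ) = ζ) := by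
        intro j u₀ h1 h2 a ha
        obtain ⟨U, hU, hUa, hd, hs, hs'⟩ := exists_sector_branch st.m_pos j h2 ha
        exact ⟨j, u₀, U, h1, h2.imp_right fun h => ⟨h.1.le, h.2⟩,
          h2.imp_right fun h => Or.inl h.1, hU, hUa, hd, hs.mono fun ζ h _ => h, hs'⟩
      have hm := st.m_pos
      rcases hu.lt_or_eq with hi | hi
      · refine conv (j + st.m - 1) u hr (Or.inl hi) _ ?_
        rw [Nat.sub_add_cancel (by omega), sectorCoord_add_period hm]
      · have hre : u = (u.re : ℂ) := Complex.ext rfl (by simpa using hi.symm)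
        have hre0 : u.re ≠ 0 := fun h => hu0 (by rw [hre, h]; simp)
        rcases lt_or_gt_of_ne hre0 with hn | hp
        -- A point on the negative ray of sector `j` is treated as a point on the positive ray of
        -- sector `j + 1`.
        · refine conv j (-u) (by rwa [norm_neg]) (Or.inr ⟨by simpa using hn, by simp [← hi]⟩) _ ?_
          have h2 : u = -((-u.re : ℝ) : ℂ) := by rw [hre]; simp
          conv_lhs => rw [h2]
          rw [sectorCoord_neg j (by linarith)]
          congr 1
          conv_rhs => rw [hre]
          simp
        · refine conv (j + st.m - 1) u hr (Or.inr ⟨hp, hi.symm⟩) _ ?_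
          rw [Nat.sub_add_cancel (by omega), sectorCoord_add_period hm]
  obtain ⟨j, u₀, U, h1, h2, h3, hU, hUa, hd, h4, h5⟩ := main
  have h0 : 0 ≤ u₀.im := by rcases h2 with h | h <;> [exact h.le; exact h.2.ge]
  have hball : ∀ᶠ ζ in 𝓝 a, ‖U ζ‖ < st.r :=
    hU.continuousAt.norm.eventually_lt_const (by simpa only [hUa] using h1)
  refine ⟨j, u₀, U, h1, h2, h3, hU, hUa, hd, ?_, ?_, ?_⟩
  · have := h4.self_of_nhds
    rw [hUa] at this
    rw [← st.psi_sectorCoord (j + 1) h0 h1.le, this h0]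
  · filter_upwards [h4, hball] with ζ hζ hb h
    rw [← st.psi_sectorCoord (j + 1) h hb.le, hζ h]
  · intro him
    filter_upwards [h5 him, hball] with ζ hζ hb h
    rw [← st.psi_sectorCoord j (by simpa using h) (by rw [norm_neg]; exact hb.le), hζ h]

/-- Subtracting its value at `a` from the branch gives a flat coordinate at `psi a`. If that point
is on an edge, the two halves of `edgeMap` come from the two one-sided formulas of `exists_branch`.
-/
theorem exists_flatGerm {a : ℂ} (ha : ‖a‖ < st.radius) (h : a ≠ 0 ∨ x ∉ G.vertices) :
    ∃ (g : ℂ → S) (U : ℂ → ℂ), G.IsFlatGerm g (st.psi a) ∧ AnalyticAt ℂ U a ∧ U a = 0 ∧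
      (∀ᶠ ζ in 𝓝 a, deriv U ζ ^ 2 = (st.m / 2 : ℂ) ^ 2 * ζ ^ ((st.m : ℤ) - 2)) ∧
      ∀ᶠ ζ in 𝓝 a, st.psi ζ = g (U ζ) := by
  obtain ⟨j, u₀, U, h1, h2, h3, hU, hUa, hd, hpa, h4, h5⟩ := st.exists_branch ha h
  have hd' : ∀ᶠ ζ in 𝓝 a, deriv (fun ζ => U ζ - u₀) ζ ^ 2 =
      (st.m / 2 : ℂ) ^ 2 * ζ ^ ((st.m : ℤ) - 2) := by
    filter_upwards [hd] with ζ hζ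
    rw [deriv_sub_const]; exact hζ
  by_cases hi : 0 < u₀.im
  · have hin := st.mem_interior (j + 1) u₀ h1.le hi
    refine ⟨fun u => G.param (st.P (j + 1) + st.σ (j + 1) * u₀ + st.σ (j + 1) * u),
      fun ζ => U ζ - u₀, Or.inl ⟨_, hin.1, hin.2, hpa.symm, _, st.sign _, rfl⟩,
      hU.sub analyticAt_const, by simp [hUa], hd', ?_⟩
    have : ∀ᶠ ζ in 𝓝 a, 0 < (U ζ).im :=
      (continuous_im.continuousAt.comp hU.continuousAt).eventually_const_lt
        (by simpa [hUa] using hi)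
    filter_upwards [h4, this] with ζ hζ hi
    rw [hζ hi.le, sector]
    congr 1; ring
  · have h2' := h2.resolve_left hi
    set t := u₀.re with ht
    have hu₀ : u₀ = t := Complex.ext rfl (by simpa using h2'.2)
    have htr : t ≤ st.r := (le_abs_self _).trans ((abs_re_le_norm u₀).trans h1.le)
    rcases st.edge j t h2'.1 htr (h3.resolve_left hi) with ⟨i1, i2, hP, hσ⟩ |
      ⟨e, s, n, hs0, hs1, he, hσe, he', hσe'⟩
    · have hin : 0 < (st.P (j + 1) + st.σ (j + 1) * u₀).im ∧
          (st.P (j + 1) + st.σ (j + 1) * u₀).im < G.height := by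
        rcases st.sign (j + 1) with h | h <;> rw [h] <;> simp [h2'.2, i1, i2]
      refine ⟨fun u => G.param (st.P (j + 1) + st.σ (j + 1) * u₀ + st.σ (j + 1) * u),
        fun ζ => U ζ - u₀, Or.inl ⟨_, hin.1, hin.2, hpa.symm, _, st.sign _, rfl⟩,
        hU.sub analyticAt_const, by simp [hUa], hd', ?_⟩
      filter_upwards [h4, h5 h2'.2] with ζ hζ hζ'
      rcases le_total 0 (U ζ).im with hp | hn
      · rw [hζ hp, sector]
        congr 1; ring
      · rw [hζ' hn, sector, hP, hσ]
        congr 1; ring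
    · refine ⟨G.edgeMap e s, fun ζ => U ζ - u₀, Or.inr ⟨e, s, hs0, hs1, ?_, rfl⟩,
        hU.sub analyticAt_const, by simp [hUa], hd', ?_⟩
      · rw [hpa, sector, ← he, ← hu₀]
      · filter_upwards [h4, h5 h2'.2] with ζ hζ hζ'
        rw [edgeMap]
        have him : (U ζ - u₀).im = (U ζ).im := by rw [sub_im, h2'.2, sub_zero]
        split_ifs with hp
        · rw [him] at hp
          rw [hζ hp, sector, ← he, hσe, hu₀]
          congr 1; ring
        · rw [him] at hp
          rw [hζ' (not_le.1 hp).le, sector, ← G.param_add_int _ (-n)]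
          congr 1
          rw [hσe'] at he' ⊢
          rw [hu₀]
          push_cast
          linear_combination he'

end Star

end CylinderGluing

end

/-! ### The complex structure and the quadratic differential -/

noncomputable section

open Filter Complex

namespace CylinderGluing

variable {E S : Type*} [TopologicalSpace S] (G : CylinderGluing E S)

theorem IsFlatGerm.apply_zero {G : CylinderGluing E S} {g : ℂ → S} {y : S}
    (h : G.IsFlatGerm g y) : g 0 = y := by
  rcases h with ⟨z, -, -, rfl, η, -, rfl⟩ | ⟨e, s, -, -, rfl, rfl⟩ <;> simp [edgeMap]

theorem IsFlatGerm.notMem_vertices {G : CylinderGluing E S} {g : ℂ → S} {y : S}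
    (h : G.IsFlatGerm g y) : y ∉ G.vertices := by
  rcases h with ⟨z, h0, h1, rfl, -⟩ | ⟨e, s, h0, h1, rfl, -⟩
  · exact G.interior_notMem_vertices h0 h1
  · exact G.pt_notMem_vertices h0 h1

/-- The coefficient of the quadratic differential in the chart around a cone point of angle
`m * π`. -/
def coneCoeff (m : ℕ) (ζ : ℂ) : ℂ := (m / 2 : ℂ) ^ 2 * ζ ^ ((m : ℤ) - 2)

theorem coneCoeff_ne_zero {m : ℕ} (hm : 0 < m) {a : ℂ} (h : a ≠ 0 ∨ m = 2) :
    coneCoeff m a ≠ 0 := by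
  have hm' : (m : ℂ) ≠ 0 := by exact_mod_cast hm.ne'
  rcases h with h | rfl
  · exact mul_ne_zero (by simpa using hm') (zpow_ne_zero _ h)
  · simp [coneCoeff]

theorem analyticAt_coneCoeff {m : ℕ} {a : ℂ} (h : a ≠ 0 ∨ m = 2) : AnalyticAt ℂ (coneCoeff m) a := by
  rcases h with h | rfl
  · exact analyticAt_const.mul (analyticAt_id.zpow h)
  · have : coneCoeff 2 = fun _ => 1 := by ext; simp [coneCoeff]
    rw [this]; exact analyticAt_const

theorem Star.eq_psi {G : CylinderGluing E S} [T2Space S] {x : S} (st : G.Star x) {y : S}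
    (hy : y ∈ st.chart.source) : st.psi (st.chart y) = y := st.chart.left_inv hy

theorem Star.chart_psi {G : CylinderGluing E S} [T2Space S] {x : S} (st : G.Star x) {ζ : ℂ}
    (h : ‖ζ‖ < st.radius) : st.chart (st.psi ζ) = ζ := st.chart.right_inv (mem_ball_zero_iff.2 h)

theorem Star.norm_chart_lt {G : CylinderGluing E S} [T2Space S] {x : S} (st : G.Star x) {y : S}
    (hy : y ∈ st.chart.source) : ‖st.chart y‖ < st.radius :=
  mem_ball_zero_iff.1 (st.chart.map_source hy)

theorem Star.chart_ne_zero_or {G : CylinderGluing E S} [T2Space S] {x : S} (st : G.Star x) {y : S}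
    (hy : y ∈ st.chart.source) (hv : y ∉ G.vertices) : st.chart y ≠ 0 ∨ x ∉ G.vertices := by
  by_cases h : st.chart y = 0
  · right
    have := st.eq_psi hy
    rw [h, st.psi_zero] at this
    rwa [this]
  · exact Or.inl h

/-- A map which is a flat coordinate after a holomorphic change of variables is holomorphic in the
charts. -/
theorem Star.analyticAt_chart_comp {G : CylinderGluing E S} [T2Space S] {x : S} (st : G.Star x)
    {f g : ℂ → S} {U : ℂ → ℂ} {z : ℂ} (hg : G.IsFlatGerm g (f z)) (hU : AnalyticAt ℂ U z)
    (hU0 : U z = 0) (hf : ∀ᶠ w in 𝓝 z, f w = g (U w)) (hz : f z ∈ st.chart.source) :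
    AnalyticAt ℂ (st.chart ∘ f) z ∧
      ∀ᶠ w in 𝓝 z, coneCoeff st.m (st.chart (f w)) * deriv (st.chart ∘ f) w ^ 2 = deriv U w ^ 2 := by
  set a := st.chart (f z) with ha
  have hcase := st.chart_ne_zero_or hz hg.notMem_vertices
  have hab := st.norm_chart_lt hz
  have hm2 : a ≠ 0 ∨ st.m = 2 := hcase.imp_right st.eq_two
  obtain ⟨g₂, U₂, hg₂, hU₂, hU₂0, hd₂, hψ⟩ := st.exists_flatGerm hab hcase
  rw [st.eq_psi hz] at hg₂
  have hne : deriv U₂ a ≠ 0 := by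
    intro h
    have := hd₂.self_of_nhds
    rw [h] at this
    exact coneCoeff_ne_zero st.m_pos hm2 (by rw [coneCoeff, ← this]; simp)
  -- Near `z` the map `st.chart ∘ f` equals V(ηU), where V inverts the branch U₂ belonging to the
  -- chart and η = ±1 compares the two flat coordinates. This is holomorphic.
  obtain ⟨V, hV, hV0, hUV, -⟩ := hU₂.exists_analyticAt_rightInverse hne
  rw [hU₂0] at hV hV0 hUV
  obtain ⟨η, hη, huniq⟩ := IsFlatGerm.unique G hg hg₂
  have hηU : AnalyticAt ℂ (fun w => η * U w) z := analyticAt_const.mul hU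
  have hηU0 : η * U z = 0 := by rw [hU0, mul_zero]
  have hT' : AnalyticAt ℂ (fun w => V (η * U w)) z :=
    AnalyticAt.fun_comp (by rwa [hηU0]) hηU
  have hTz : V (η * U z) = a := by rw [hηU0, hV0]
  have tU : Tendsto U (𝓝 z) (𝓝 0) := hU0 ▸ hU.continuousAt.tendsto
  have tηU : Tendsto (fun w => η * U w) (𝓝 z) (𝓝 0) := by
    have := hηU.continuousAt.tendsto; rwa [hηU0] at this
  have tT : Tendsto (fun w => V (η * U w)) (𝓝 z) (𝓝 a) := by
    have := hT'.continuousAt.tendsto; rwa [hTz] at this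
  have hT : ∀ᶠ w in 𝓝 z, st.chart (f w) = V (η * U w) := by
    filter_upwards [hf, tU.eventually huniq, tηU.eventually hUV, tT.eventually hψ,
      tT.norm.eventually_lt_const hab] with w h1 h2 h3 h4 h5
    rw [h1, h2, ← st.chart_psi h5, h4, h3]
  have hTan : AnalyticAt ℂ (st.chart ∘ f) z := hT'.congr (hT.mono fun w hw => hw.symm)
  refine ⟨hTan, ?_⟩
  have hrel : ∀ᶠ w in 𝓝 z, U₂ (st.chart (f w)) = η * U w := by
    filter_upwards [hT, tηU.eventually hUV] with w h1 h2
    rw [h1, h2]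
  have tTf : Tendsto (fun w => st.chart (f w)) (𝓝 z) (𝓝 a) := hTan.continuousAt.tendsto
  filter_upwards [hrel.eventually_nhds, hTan.eventually_analyticAt, hU.eventually_analyticAt,
    tTf.eventually hU₂.eventually_analyticAt, tTf.eventually hd₂] with w h1 h2 h3 h4 h5
  -- The chain rule for U₂ ∘ chart ∘ f = ηU; the sign η disappears on squaring.
  have e1 : deriv (U₂ ∘ (st.chart ∘ f)) w = deriv (fun w => η * U w) w := Filter.EventuallyEq.deriv_eq h1
  rw [deriv_comp w h4.differentiableAt h2.differentiableAt,
    deriv_const_mul _ h3.differentiableAt] at e1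
  rw [coneCoeff, ← h5, ← mul_pow]
  change (deriv U₂ ((st.chart ∘ f) w) * _) ^ 2 = _
  rw [e1]
  rcases hη with rfl | rfl <;> ring

/-- The holomorphic structure and the transition rule. -/
theorem Star.transition {G : CylinderGluing E S} [T2Space S] {x x' : S} (st : G.Star x)
    (st' : G.Star x') (hst : ∀ h : x = x', h ▸ st = st') {a : ℂ} (ha : ‖a‖ < st.radius)
    (hs : st.psi a ∈ st'.chart.source) :
    AnalyticAt ℂ (st'.chart ∘ st.psi) a ∧ ∀ᶠ w in 𝓝 a,
      coneCoeff st.m w = coneCoeff st'.m (st'.chart (st.psi w)) * deriv (st'.chart ∘ st.psi) w ^ 2 := by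
  by_cases h : a ≠ 0 ∨ x ∉ G.vertices
  · obtain ⟨g, U, hg, hU, hU0, hd, hf⟩ := st.exists_flatGerm ha h
    obtain ⟨h1, h2⟩ := st'.analyticAt_chart_comp hg hU hU0 hf hs
    refine ⟨h1, ?_⟩
    filter_upwards [h2, hd] with w h3 h4
    rw [h3, h4, coneCoeff]
  -- There is no flat coordinate at a vertex. But a vertex lies in no chart centred at another
  -- point, so both charts coincide and the transition map is the identity.
  · rw [not_or, not_not, not_not] at h
    obtain ⟨rfl, hx⟩ := h
    rw [st.psi_zero] at hs
    have hxx : x = x' := by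
      by_contra hne
      have h0 : st'.chart x ≠ 0 := by
        intro h0
        have := st'.eq_psi hs
        rw [h0, st'.psi_zero] at this
        exact hne this.symm
      obtain ⟨g, U, hg, -⟩ := st'.exists_flatGerm (st'.norm_chart_lt hs) (Or.inl h0)
      rw [st'.eq_psi hs] at hg
      exact hg.notMem_vertices hx
    subst hxx
    obtain rfl : st = st' := hst rfl
    have hid : (st.chart ∘ st.psi) =ᶠ[𝓝 0] id := by
      filter_upwards [continuous_norm.continuousAt.eventually_lt_const ha] with w hw
      exact st.chart_psi hw
    refine ⟨analyticAt_id.congr hid.symm, ?_⟩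
    filter_upwards [hid.eventually_nhds] with w hw
    have h1 : st.chart (st.psi w) = w := hw.self_of_nhds
    rw [Filter.EventuallyEq.deriv_eq hw, h1]; simp

variable [Finite E]

theorem t2Space (G : CylinderGluing E S) : T2Space S := G.t2Space_of_stars G.nonempty_star

/-- A choice of half discs around every point. -/
def star (x : S) : G.Star x := Classical.choice (G.nonempty_star x)

/-- The chart around a point. -/
def chartAround (x : S) : OpenPartialHomeomorph S ℂ :=
  haveI := G.t2Space
  (G.star x).chart

theorem chartAround_symm_zero (x : S) : (G.chartAround x).symm 0 = x := (G.star x).psi_zero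

theorem chartAround_self (x : S) : G.chartAround x x = 0 :=
  haveI := G.t2Space
  (G.star x).chart_self

theorem mem_chartAround_target (x : S) {a : ℂ} :
    a ∈ (G.chartAround x).target ↔ ‖a‖ < (G.star x).radius := mem_ball_zero_iff

theorem mem_chartAround_source (x : S) : x ∈ (G.chartAround x).source :=
  haveI := G.t2Space
  (G.star x).mem_chart_source

/-- The atlas of the glued surface. -/
abbrev chartedSpace : ChartedSpace ℂ S where
  atlas := Set.range G.chartAround
  chartAt := G.chartAround
  mem_chart_source := G.mem_chartAround_source
  chart_mem_atlas x := ⟨x, rfl⟩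

theorem chartAround_transition (x x' : S) {a : ℂ} (ha : a ∈ (G.chartAround x).target)
    (hs : (G.chartAround x).symm a ∈ (G.chartAround x').source) :
    AnalyticAt ℂ (G.chartAround x' ∘ (G.chartAround x).symm) a ∧ ∀ᶠ w in 𝓝 a,
      coneCoeff (G.star x).m w =
        coneCoeff (G.star x').m (G.chartAround x' ((G.chartAround x).symm w)) *
          deriv (G.chartAround x' ∘ (G.chartAround x).symm) w ^ 2 :=
  haveI := G.t2Space
  (G.star x).transition (G.star x') (by rintro rfl; rfl) ((G.mem_chartAround_target x).1 ha) hs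

theorem isManifold : letI := G.chartedSpace; IsManifold 𝓘(ℂ) ω S := by
  let := G.chartedSpace
  refine isManifold_of_contDiffOn _ _ _ ?_
  rintro _ _ ⟨x, rfl⟩ ⟨x', rfl⟩ a ha
  simp only [modelWithCornersSelf_coe, modelWithCornersSelf_coe_symm, Set.preimage_id_eq, id_eq,
    Set.range_id, Set.inter_univ, OpenPartialHomeomorph.trans_source,
    OpenPartialHomeomorph.symm_source] at ha
  exact (G.chartAround_transition x x' ha.1 ha.2).1.contDiffAt.contDiffWithinAt

/-- The quadratic differential of the glued surface. -/
def quadraticDifferential : letI := G.chartedSpace; QuadraticDifferential S :=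
  letI := G.chartedSpace
  -- The coefficient has to depend on the chart alone; the point around which the chart was built is
  -- recovered as the preimage of 0.
  { coeff := fun e => coneCoeff (G.star (e.symm 0)).m
    meromorphic := by
      rintro _ ⟨x, rfl⟩ a -
      exact (MeromorphicAt.const _ _).mul ((MeromorphicAt.id _).zpow _)
    transition := by
      rintro _ ⟨x, rfl⟩ _ ⟨x', rfl⟩ a ha
      rw [OpenPartialHomeomorph.trans_source, OpenPartialHomeomorph.symm_source] at ha
      have hm : ∀ y, (G.star ((G.chartAround y).symm 0)).m = (G.star y).m := fun y =>
        congrArg (fun y => (G.star y).m) (G.chartAround_symm_zero y)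
      simp only [hm]
      exact (G.chartAround_transition x x' ha.1 ha.2).2.filter_mono nhdsWithin_le_nhds }

theorem coeff_chartAround (x : S) : letI := G.chartedSpace
    G.quadraticDifferential.coeff (G.chartAround x) = coneCoeff (G.star x).m :=
  congrArg (fun y => coneCoeff (G.star y).m) (G.chartAround_symm_zero x)

theorem order_eq (x : S) : letI := G.chartedSpace
    G.quadraticDifferential.order x = (((G.star x).m : ℤ) - 2 : ℤ) := by
  let := G.chartedSpace
  have hm : ((G.star x).m : ℂ) ≠ 0 := by exact_mod_cast (G.star x).m_pos.ne'
  change meromorphicOrderAt (G.quadraticDifferential.coeff (G.chartAround x)) (G.chartAround x x) = _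
  have hmer : MeromorphicAt (coneCoeff (G.star x).m) 0 :=
    (MeromorphicAt.const _ _).mul ((MeromorphicAt.id _).zpow _)
  rw [G.coeff_chartAround, chartAround_self, meromorphicOrderAt_eq_int_iff hmer]
  refine ⟨fun _ => ((G.star x).m / 2 : ℂ) ^ 2, analyticAt_const, by simpa using hm, ?_⟩
  exact Eventually.of_forall fun z => by simp [coneCoeff, mul_comm]

theorem order_of_notMem_vertices {x : S} (hx : x ∉ G.vertices) : letI := G.chartedSpace
    G.quadraticDifferential.order x = 0 := by
  rw [G.order_eq, (G.star x).eq_two hx]; rfl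

theorem order_org (e : E) : letI := G.chartedSpace
    G.quadraticDifferential.order (G.param (G.org e)) =
      ((Function.minimalPeriod G.rot e : ℤ) - 2 : ℤ) := by
  rw [G.order_eq, (G.star _).eq_period e rfl]

theorem flat_param {z : ℂ} (h0 : 0 < z.im) (h1 : z.im < G.height) (x : S)
    (hz : G.param z ∈ (G.chartAround x).source) :
    AnalyticAt ℂ (G.chartAround x ∘ G.param) z ∧ ∀ᶠ w in 𝓝 z,
      coneCoeff (G.star x).m (G.chartAround x (G.param w)) *
        deriv (G.chartAround x ∘ G.param) w ^ 2 = 1 := by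
  have := G.t2Space
  have := (G.star x).analyticAt_chart_comp (f := G.param) (g := fun u => G.param (z + 1 * u))
    (U := fun w => w - z) (z := z) (Or.inl ⟨z, h0, h1, rfl, 1, Or.inl rfl, rfl⟩)
    (analyticAt_id.sub analyticAt_const) (sub_self z)
    (Eventually.of_forall fun w => by simp) hz
  refine ⟨this.1, this.2.mono fun w hw => ?_⟩
  have hd : deriv (fun w => w - z) w = 1 := by simp
  rw [hd, one_pow] at hw
  exact hw

theorem isFlatOn_param : letI := G.chartedSpace
    G.quadraticDifferential.IsFlatOn G.param {z | 0 < z.im ∧ z.im < G.height} := by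
  let := G.chartedSpace
  rintro z ⟨h0, h1⟩ _ ⟨x, rfl⟩ hz
  rw [G.coeff_chartAround]
  obtain ⟨h2, h3⟩ := G.flat_param h0 h1 x hz
  exact ⟨h2, h3.filter_mono nhdsWithin_le_nhds⟩

/-- A cycle of length 2 is a regular point. Without such cycles every end point of an edge is a
singularity, so the cylinder is maximal as soon as both boundary components carry an edge. -/
theorem isOneCylinderJenkinsStrebel : letI := G.chartedSpace
    (∀ e, Function.minimalPeriod G.rot e ≠ 2) → (∃ e, (G.org e).im = 0) →
    (∃ e, (G.org e).im = G.height) → G.quadraticDifferential.IsOneCylinderJenkinsStrebel := by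
  let := G.chartedSpace
  rintro hm ⟨e₀, he₀⟩ ⟨e₁, he₁⟩
  have hne : ∀ e, G.quadraticDifferential.order (G.param (G.org e)) ≠ 0 := by
    intro e h
    rw [G.order_org] at h
    have : ((Function.minimalPeriod G.rot e : ℤ) - 2 : ℤ) = 0 := by exact_mod_cast h
    exact hm e (by omega)
  refine ⟨G.width, G.height, G.param, G.width_pos, G.height_pos, G.continuous_param.continuousOn,
    G.periodic, G.isFlatOn_param, ?_, ?_, ?_, ⟨_, he₀, hne e₀⟩, ⟨_, he₁, hne e₁⟩⟩
  · intro z z' h0 h1 h0' h1' h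
    exact G.fiber_interior z z' h0 h1 h0'.le h1'.le h.symm
  · rw [Set.eq_univ_iff_forall]
    intro x
    obtain ⟨z, h0, h1, h⟩ := G.surj x
    exact ⟨z, ⟨h0, h1⟩, h⟩
  · rw [Set.disjoint_left]
    rintro _ ⟨z, ⟨h0, h1⟩, rfl⟩ ⟨z', hz', h⟩
    have hs : 0 ≤ z'.im ∧ z'.im ≤ G.height := by
      have := G.height_pos
      rcases hz' with h | h <;> constructor <;> linarith
    obtain ⟨n, hn⟩ := G.fiber_interior z z' h0 h1 hs.1 hs.2 h
    have := congrArg im hn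
    simp at this
    rcases hz' with h | h <;> linarith

/-- If two edges of the same boundary component are glued, then the quadratic differential is not
the square of an Abelian differential. -/
theorem not_isGlobalSquare {e : E} (he : G.sgn e = G.sgn (G.mate e)) : letI := G.chartedSpace
    ¬ G.quadraticDifferential.IsGlobalSquare := by
  let := G.chartedSpace
  have := G.t2Space
  rintro ⟨η, hη⟩
  -- The pullback of η to the strip, computed at each point in the chart around its image; `hf_eq`
  -- shows that any other chart gives the same value.
  set f : ℂ → ℂ := fun z => η.coeff (G.chartAround (G.param z))
    (G.chartAround (G.param z) (G.param z)) * deriv (G.chartAround (G.param z) ∘ G.param) z with hf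
  -- The relation q = η² is known only off discrete sets; away from the vertices both sides are
  -- continuous, so it holds at every point.
  have hcoef : ∀ x y, y ∈ (G.chartAround x).source → y ∉ G.vertices →
      η.coeff (G.chartAround x) (G.chartAround x y) ^ 2 =
        coneCoeff (G.star x).m (G.chartAround x y) := by
    intro x y hy hv
    have ht := (G.chartAround x).map_source hy
    have h1 := hη _ ⟨x, rfl⟩ _ ht
    rw [G.coeff_chartAround] at h1
    have c1 : ContinuousAt (coneCoeff (G.star x).m) (G.chartAround x y) :=
      (analyticAt_coneCoeff (((G.star x).chart_ne_zero_or hy hv).imp_right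
        (G.star x).eq_two)).continuousAt
    have c2 : ContinuousAt (fun w => η.coeff (G.chartAround x) w ^ 2) (G.chartAround x y) :=
      ((η.analytic _ ⟨x, rfl⟩ _ ht).pow 2).continuousAt
    exact (tendsto_nhds_unique ((c1.mono_left nhdsWithin_le_nhds).congr' h1)
      (c2.mono_left nhdsWithin_le_nhds)).symm
  have hf_eq : ∀ z : ℂ, 0 < z.im → z.im < G.height → ∀ x, G.param z ∈ (G.chartAround x).source →
      f z = η.coeff (G.chartAround x) (G.chartAround x (G.param z)) *
        deriv (G.chartAround x ∘ G.param) z := by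
    intro z h0 h1 x hx
    set e' := G.chartAround (G.param z) with he'
    have hs := G.mem_chartAround_source (G.param z)
    have ht : e' (G.param z) ∈ e'.target := e'.map_source hs
    have hsym : e'.symm (e' (G.param z)) = G.param z := e'.left_inv hs
    have h2 := η.transition e' ⟨_, rfl⟩ (G.chartAround x) ⟨x, rfl⟩ (e' (G.param z))
      (by rw [OpenPartialHomeomorph.trans_source, OpenPartialHomeomorph.symm_source]
          exact ⟨ht, by rw [Set.mem_preimage, hsym]; exact hx⟩)
    have h3 := (G.chartAround_transition (G.param z) x ht (by rw [← he', hsym]; exact hx)).1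
    have h4 := (G.flat_param h0 h1 _ hs).1
    have h5 : (G.chartAround x ∘ G.param) =ᶠ[𝓝 z]
        (G.chartAround x ∘ e'.symm) ∘ (e' ∘ G.param) := by
      filter_upwards [G.continuous_param.continuousAt.eventually_mem
        (e'.open_source.mem_nhds hs)] with w hw
      simp only [Function.comp_apply, e'.left_inv hw]
    rw [h5.deriv_eq, deriv_comp z h3.differentiableAt h4.differentiableAt]
    simp only [hf]
    rw [← he', h2, hsym]
    simp only [Function.comp_def]
    ring
  set D : Set ℂ := {z | 0 < z.im ∧ z.im < G.height} with hD
  have hsq : Set.EqOn (f ^ 2) ((fun _ => 1) ^ 2) D := by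
    rintro z ⟨h0, h1⟩
    have hs := G.mem_chartAround_source (G.param z)
    have := (G.flat_param h0 h1 _ hs).2.self_of_nhds
    rw [← hcoef _ _ hs (G.interior_notMem_vertices h0 h1)] at this
    simp only [Pi.pow_apply, hf, mul_pow, this, one_pow]
  have hcont : ContinuousOn f D := by
    rintro z ⟨h0, h1⟩
    refine ContinuousAt.continuousWithinAt ?_
    have hs := G.mem_chartAround_source (G.param z)
    have h4 := (G.flat_param h0 h1 _ hs).1
    have hc : ContinuousAt (fun w => η.coeff (G.chartAround (G.param z))
        (G.chartAround (G.param z) (G.param w)) *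
        deriv (G.chartAround (G.param z) ∘ G.param) w) z := by
      refine ContinuousAt.mul ?_ h4.deriv.continuousAt
      exact ContinuousAt.comp' (η.analytic _ ⟨_, rfl⟩ _
        ((G.chartAround (G.param z)).map_source hs)).continuousAt h4.continuousAt
    refine hc.congr ?_
    filter_upwards [G.continuous_param.continuousAt.eventually_mem
      ((G.chartAround (G.param z)).open_source.mem_nhds hs),
      continuous_im.continuousAt.eventually_const_lt h0,
      continuous_im.continuousAt.eventually_lt_const h1] with w hw hw0 hw1
    exact (hf_eq w hw0 hw1 _ hw).symm
  have hconn : IsPreconnected D := by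
    have : Convex ℝ D := (convex_halfSpace_im_gt 0).inter (convex_halfSpace_im_lt G.height)
    exact this.isPreconnected
  -- A continuous square root of 1 on the connected open strip is constant.
  obtain ⟨c, hc0, hc⟩ : ∃ c : ℂ, c ≠ 0 ∧ ∀ z ∈ D, f z = c := by
    rcases hconn.eq_or_eq_neg_of_sq_eq hcont continuousOn_const hsq (by simp) with h | h
    · exact ⟨1, one_ne_zero, fun z hz => h hz⟩
    · exact ⟨-1, by simp, fun z hz => h hz⟩
  set s : ℝ := G.len e / 2 with hs
  have hl := G.len_pos e
  have hs0 : 0 < s := by positivity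
  have hs1 : s < G.len e := by linarith
  set y := G.param (G.pt e s) with hy
  have hgerm : G.IsFlatGerm (G.edgeMap e s) y := Or.inr ⟨e, s, hs0, hs1, rfl, rfl⟩
  have hg0 : G.edgeMap e s 0 = y := hgerm.apply_zero
  have hsrc := G.mem_chartAround_source y
  set V := G.chartAround y ∘ G.edgeMap e s with hV
  have hVan : AnalyticAt ℂ V 0 :=
    ((G.star y).analyticAt_chart_comp (f := G.edgeMap e s) (U := id) (z := 0) (by rwa [hg0])
      analyticAt_id rfl (by simp) (by rw [hg0]; exact hsrc)).1
  have hV0 : V 0 = 0 := by simp only [hV, Function.comp_apply, hg0, chartAround_self]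
  -- The pullback of η by the flat coordinate across the midpoint of `e`; its continuity at 0 is to
  -- be contradicted.
  set h : ℂ → ℂ := fun u => η.coeff (G.chartAround y) (V u) * deriv V u with hh
  have hhc : ContinuousAt h 0 := by
    refine ContinuousAt.mul ?_ hVan.deriv.continuousAt
    refine ContinuousAt.comp' (η.analytic _ ⟨_, rfl⟩ _ ?_).continuousAt hVan.continuousAt
    rw [hV0, ← G.chartAround_self y]
    exact (G.chartAround y).map_source hsrc
  have side : ∀ (p σ v : ℂ), (σ = 1 ∨ σ = -1) → (p + σ * v) ∈ D →
      (∀ᶠ u in 𝓝 v, G.edgeMap e s u = G.param (p + σ * u)) →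
      G.param (p + σ * v) ∈ (G.chartAround y).source → h v = c * σ := by
    intro p σ v hσ hpD hev hsrc
    have e1 : V =ᶠ[𝓝 v] fun u => (G.chartAround y ∘ G.param) (p + σ * u) := by
      filter_upwards [hev] with u hu
      simp only [hV, Function.comp_apply, hu]
    have hlin : HasDerivAt (fun u => p + σ * u) σ v := by
      simpa using ((hasDerivAt_id v).const_mul σ).const_add p
    have e2 : deriv V v = deriv (G.chartAround y ∘ G.param) (p + σ * v) * σ := by
      rw [e1.deriv_eq]
      exact ((G.flat_param hpD.1 hpD.2 y hsrc).1.differentiableAt.hasDerivAt.comp v hlin).deriv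
    simp only [hh]
    rw [e2, e1.eq_of_nhds, ← hc _ hpD, hf_eq _ hpD.1 hpD.2 y hsrc]
    simp only [Function.comp_apply]; ring
  have tend : ∀ σ : ℂ, (σ = I ∨ σ = -I) →
      Tendsto (fun t : ℝ => (t : ℂ) * σ) (𝓝[>] 0) (𝓝 0) := by
    intro σ _
    have : Continuous fun t : ℝ => (t : ℂ) * σ := by fun_prop
    have := this.tendsto 0
    simp only [ofReal_zero, zero_mul] at this
    exact this.mono_left nhdsWithin_le_nhds
  have hsrc' : ∀ᶠ t : ℝ in 𝓝[>] 0, t < G.height / 2 :=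
    mem_nhdsWithin_of_mem_nhds (Iio_mem_nhds (by have := G.height_pos; positivity))
  -- The value of `h` at 0 as a limit along the ray in direction σ = ±i. On that side the flat
  -- coordinate is `param` after an affine map with slope `sgn e' * (σ / I)`.
  have lim : ∀ (e' : E) (s' : ℝ) (σ : ℂ), (σ = I ∨ σ = -I) →
      G.param (G.pt e' s') = y →
      (∀ u : ℂ, 0 < (u / σ).re → G.edgeMap e s u =
        G.param (G.pt e' s' + (G.sgn e' * (σ / I)) * u)) → h 0 = c * (G.sgn e' * (σ / I)) := by
    intro e' s' σ hσ hy' hE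
    have hσ0 : σ ≠ 0 := by rcases hσ with rfl | rfl <;> simp
    have hσI : σ / I = 1 ∨ σ / I = -1 := by
      rcases hσ with rfl | rfl
      · left; exact div_self I_ne_zero
      · right; rw [neg_div, div_self I_ne_zero]
    have hcont2 : ContinuousAt (fun u => G.param (G.pt e' s' + (G.sgn e' * (σ / I)) * u)) 0 :=
      (G.continuous_param.comp (continuous_const.add
        (continuous_const.mul continuous_id))).continuousAt
    have hm := hcont2.eventually_mem ((G.chartAround y).open_source.mem_nhds
      (by simpa [hy'] using hsrc))
    refine tendsto_nhds_unique (hhc.tendsto.comp (tend σ hσ)) ?_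
    refine (tendsto_congr' ?_).2 tendsto_const_nhds
    filter_upwards [(tend σ hσ).eventually hm, hsrc', self_mem_nhdsWithin] with t h1 h2 h3
    have h3' : (0 : ℝ) < t := h3
    refine side (G.pt e' s') _ _ ?_ ?_ ?_ h1
    · rcases G.sgn_sign e' with h | h <;> rcases hσI with h' | h' <;> simp [h, h']
    · have e3 : G.sgn e' * (σ / I) * (t * σ) = G.sgn e' * (t * I) := by
        have : σ * σ = -1 := by rcases hσ with rfl | rfl <;> simp
        have h4 : σ / I * σ = I := by rw [div_mul_eq_mul_div, this]; simp
        linear_combination (G.sgn e' * t) * h4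
      rw [e3]
      refine G.pt_add_mem_interior e' s' (r := t) h2 ?_ (by simpa using h3')
      simp [abs_of_pos h3']
    · have hcc : ContinuousAt (fun u : ℂ => (u / σ).re) (t * σ) :=
        (continuous_re.comp (continuous_id.div_const σ)).continuousAt
      filter_upwards [hcc.eventually_const_lt
        (show 0 < ((t * σ : ℂ) / σ).re by rw [mul_div_cancel_right₀ _ hσ0]; simpa using h3')]
        with u hu
      exact hE u hu
  have l1 := lim e s I (Or.inl rfl) rfl (by
    intro u hu
    have : 0 ≤ u.im := by
      rw [div_I] at hu
      simpa using hu.le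
    rw [edgeMap, if_pos this, div_self I_ne_zero, mul_one])
  have l2 := lim (G.mate e) (G.len e - s) (-I) (Or.inr rfl) (G.glue_pt e hs0.le hs1.le).symm (by
    intro u hu
    have : ¬ 0 ≤ u.im := by
      rw [div_neg, div_I] at hu
      simpa using hu
    rw [edgeMap, if_neg this, neg_div, div_self I_ne_zero]
    congr 1; ring)
  -- The limits from above and below are c · sgn e and -c · sgn (mate e). With equal signs they
  -- force c = 0.
  rw [l1, ← he, div_self I_ne_zero, neg_div, div_self I_ne_zero] at l2
  rcases G.sgn_sign e with h | h <;> rw [h] at l2 <;> simp at l2 <;>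
    · apply hc0
      have : c + c = 0 := by first | linear_combination l2 | linear_combination -l2
      simpa using this

end CylinderGluing

end

noncomputable section

open Complex

/-! ### Subdivision of the boundary of a cylinder by two lists of edges -/

section PartialSums

variable {α : Type*} (len : α → ℝ)

/-- The sum of the lengths of the first `i` entries. -/
def List.lenSum (l : List α) (i : ℕ) : ℝ := ((l.take i).map len).sum

namespace List

variable {len}

@[simp] theorem lenSum_zero (l : List α) : l.lenSum len 0 = 0 := by simp [lenSum]

theorem lenSum_succ (l : List α) {i : ℕ} (h : i < l.length) :
    l.lenSum len (i + 1) = l.lenSum len i + len l[i] := by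
  rw [lenSum, lenSum, List.take_succ_eq_append_getElem h, List.map_append, List.sum_append]
  simp

theorem lenSum_length (l : List α) : l.lenSum len l.length = (l.map len).sum := by simp [lenSum]

theorem lenSum_cons (a : α) (l : List α) (i : ℕ) :
    (a :: l).lenSum len (i + 1) = len a + l.lenSum len i := by simp [lenSum]

theorem lenSum_le_succ (hlen : ∀ a, 0 < len a) (l : List α) (i : ℕ) :
    l.lenSum len i ≤ l.lenSum len (i + 1) := by
  by_cases h : i < l.length
  · rw [l.lenSum_succ h]; linarith [hlen l[i]]
  · simp [lenSum, List.take_of_length_le (not_lt.1 h),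
      List.take_of_length_le ((not_lt.1 h).trans (Nat.le_succ i))]

theorem lenSum_mono (hlen : ∀ a, 0 < len a) (l : List α) : Monotone (l.lenSum len) :=
  monotone_nat_of_le_succ (l.lenSum_le_succ hlen)

theorem lenSum_nonneg (hlen : ∀ a, 0 < len a) (l : List α) (i : ℕ) : 0 ≤ l.lenSum len i := by
  have := l.lenSum_mono hlen (Nat.zero_le i)
  rwa [lenSum_zero] at this

theorem exists_lenSum_le (l : List α) :
    ∀ x : ℝ, 0 ≤ x → x < (l.map len).sum →
      ∃ (i : ℕ) (h : i < l.length) (s : ℝ), 0 ≤ s ∧ s < len l[i] ∧ x = l.lenSum len i + s := by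
  induction l with
  | nil => intro x h0 h1; simp at h1; linarith
  | cons a l ih =>
    intro x h0 h1
    rw [List.map_cons, List.sum_cons] at h1
    by_cases h : x < len a
    · exact ⟨0, by simp, x, h0, by simpa using h, by simp⟩
    · obtain ⟨i, hi, s, hs0, hs1, hx⟩ := ih (x - len a) (by linarith) (by linarith)
      exact ⟨i + 1, by simpa using hi, s, hs0, by simpa using hs1, by
        rw [lenSum_cons]; linarith⟩

theorem lenSum_add_inj (hlen : ∀ a, 0 < len a) (l : List α) {i j : ℕ} (hi : i < l.length)
    (hj : j < l.length) {s t : ℝ} (hs0 : 0 ≤ s) (hs1 : s < len l[i]) (ht0 : 0 ≤ t)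
    (ht1 : t < len l[j]) (h : l.lenSum len i + s = l.lenSum len j + t) : i = j ∧ s = t := by
  have key : ∀ {i j : ℕ} (hi : i < l.length) {s t : ℝ}, s < len l[i] → 0 ≤ t →
      l.lenSum len i + s = l.lenSum len j + t → ¬ i < j := by
    intro i j hi s t hs ht h hij
    have := l.lenSum_mono hlen (Nat.succ_le_of_lt hij)
    rw [Nat.succ_eq_add_one, l.lenSum_succ hi] at this
    linarith
  obtain rfl : i = j := le_antisymm (not_lt.1 (key hj ht1 hs0 h.symm)) (not_lt.1 (key hi hs1 ht0 h))
  exact ⟨rfl, by linarith⟩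

theorem lenSum_add_lt (hlen : ∀ a, 0 < len a) (l : List α) {i : ℕ} (hi : i < l.length)
    {s : ℝ} (hs1 : s < len l[i]) : l.lenSum len i + s < (l.map len).sum := by
  have := l.lenSum_mono hlen (Nat.succ_le_of_lt hi)
  rw [Nat.succ_eq_add_one, l.lenSum_succ hi, lenSum_length] at this
  linarith

/-- Positions modulo the total length determine the entry. -/
theorem lenSum_add_inj_mod (hlen : ∀ a, 0 < len a) (l : List α) {i j : ℕ} (hi : i < l.length)
    (hj : j < l.length) {s t : ℝ} (hs0 : 0 ≤ s) (hs1 : s < len l[i]) (ht0 : 0 ≤ t)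
    (ht1 : t < len l[j]) (n : ℤ)
    (h : l.lenSum len i + s = l.lenSum len j + t + n * (l.map len).sum) : i = j ∧ s = t := by
  have a1 := l.lenSum_add_lt hlen hi hs1
  have a2 := l.lenSum_add_lt hlen hj ht1
  have b1 := l.lenSum_nonneg hlen i
  have b2 := l.lenSum_nonneg hlen j
  have hn : n = 0 := by
    by_contra hn
    rcases lt_or_gt_of_ne hn with hn | hn
    · have : (n : ℝ) ≤ -1 := by exact_mod_cast Int.le_sub_one_of_lt hn
      nlinarith
    · have : (1 : ℝ) ≤ n := by exact_mod_cast hn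
      nlinarith
  subst hn
  exact l.lenSum_add_inj hlen hi hj hs0 hs1 ht0 ht1 (by simpa using h)

theorem exists_lenSum_mod (l : List α) (hl : 0 < (l.map len).sum) (x : ℝ) :
    ∃ (i : ℕ) (h : i < l.length) (s : ℝ) (n : ℤ), 0 ≤ s ∧ s < len l[i] ∧
      x = l.lenSum len i + s + n * (l.map len).sum := by
  set w := (l.map len).sum with hw
  have h0 : 0 ≤ x - ⌊x / w⌋ * w := by
    have := Int.floor_le (x / w)
    rw [le_div_iff₀ hl] at this
    linarith
  have h1 : x - ⌊x / w⌋ * w < w := by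
    have := Int.lt_floor_add_one (x / w)
    rw [div_lt_iff₀ hl] at this
    linarith
  obtain ⟨i, hi, s, hs0, hs1, hx⟩ := l.exists_lenSum_le _ h0 h1
  exact ⟨i, hi, s, ⌊x / w⌋, hs0, hs1, by linarith⟩

/-- The cyclic predecessor in a list. -/
theorem exists_cyclic_pred [DecidableEq α] {R : α → α → Prop} {l : List α} {a : α}
    (hd : l.Nodup) (hh : l.head? = some a) (hc : (l ++ [a]).IsChain R) {e : α} (he : e ∈ l) :
    ∃ x ∈ l, R x e ∧ ∃ n : ℤ,
      l.lenSum len (l.idxOf e) = l.lenSum len (l.idxOf x) + len x + n * (l.map len).sum := by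
  have hpos : 0 < l.length := List.length_pos_of_mem he
  have hi := List.idxOf_lt_length_iff.2 he
  have hce := List.isChain_iff_getElem.1 hc
  rcases hk : l.idxOf e with _ | k
  -- The first entry is preceded by the last one, whose end is a full turn further on; hence the
  -- integer -1.
  · have hlast : l.length - 1 < l.length := by omega
    refine ⟨l[l.length - 1], List.getElem_mem _, ?_, -1, ?_⟩
    · have := hce (l.length - 1) (by simp; omega)
      rw [List.getElem_append_left hlast] at this
      convert this using 1
      have h2 : l.length - 1 + 1 = l.length := by omega
      simp only [h2, List.getElem_append_right le_rfl]
      simp only [Nat.sub_self, List.getElem_singleton]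
      have h3 : l[0] = a := by
        rw [List.head?_eq_getElem?, List.getElem?_eq_getElem hpos] at hh
        exact Option.some.inj hh
      rw [← h3]
      have h4 : l[l.idxOf e] = e := List.getElem_idxOf hi
      simp only [hk] at h4
      exact h4.symm
    · rw [hd.idxOf_getElem, ← lenSum_length l]
      have h2 : l.length = l.length - 1 + 1 := by omega
      conv_rhs => enter [2, 2]; rw [h2]
      rw [lenSum_succ l hlast]
      simp
  · have hk1 : k + 1 < l.length := hk ▸ hi
    refine ⟨l[k], List.getElem_mem _, ?_, 0, ?_⟩
    · have := hce k (by simp; omega)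
      rw [List.getElem_append_left (by omega), List.getElem_append_left hk1] at this
      convert this using 1
      have h4 : l[l.idxOf e] = e := List.getElem_idxOf hi
      simp only [hk] at h4
      exact h4.symm
    · rw [hd.idxOf_getElem, lenSum_succ l (by omega)]
      simp

end List

end PartialSums

/-- Two cyclically ordered lists of edges, which are glued in pairs. The edges of the lower boundary
component are listed from left to right, the edges of the upper one from right to left. -/
structure EdgeLists (α : Type*) where
  lower : List α
  upper : List α
  lowerHead : α
  upperHead : α
  mate : α → α
  rot : Equiv.Perm α
  lower_nodup : lower.Nodup
  upper_nodup : upper.Nodup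
  disjoint : ∀ e, e ∈ lower → e ∈ upper → False
  mem : ∀ e, e ∈ lower ∨ e ∈ upper
  lower_head : lower.head? = some lowerHead
  upper_head : upper.head? = some upperHead
  mate_mate : ∀ e, mate (mate e) = e
  mate_ne : ∀ e, mate e ≠ e
  lower_chain : (lower ++ [lowerHead]).IsChain (fun x y => mate (rot y) = x)
  upper_chain : (upper ++ [upperHead]).IsChain (fun x y => mate (rot y) = x)

namespace EdgeLists

variable {α : Type*} [DecidableEq α] (L : EdgeLists α)

/-- The subdivided boundary of the cylinder of circumference `∑ len` and height `Im v`, the upper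
component starting at `v`. -/
def boundary (len : α → ℝ) (hlen : ∀ a, 0 < len a) (hmate : ∀ a, len (L.mate a) = len a)
    (hsum : (L.upper.map len).sum = (L.lower.map len).sum) (v : ℂ) (hv : 0 < v.im) :
    CylinderBoundary α where
  width := (L.lower.map len).sum
  height := v.im
  width_pos := by
    have hne : L.lower ≠ [] := by
      intro h; have := L.lower_head; simp [h] at this
    exact List.sum_pos _ (by simpa using fun a _ => hlen a) (by simpa using hne)
  height_pos := hv
  org e := if e ∈ L.lower then (L.lower.lenSum len (L.lower.idxOf e) : ℂ)
    else v + ((L.lower.map len).sum - L.upper.lenSum len (L.upper.idxOf e) : ℝ)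
  sgn e := if e ∈ L.lower then 1 else -1
  len := len
  mate := L.mate
  rot := L.rot
  sgn_cases e := by
    by_cases h : e ∈ L.lower <;> simp [h]
  len_pos := hlen
  mate_mate := L.mate_mate
  mate_ne := L.mate_ne
  len_mate := hmate
  sgn_mate_rot e := by
    rcases L.mem e with h | h
    · obtain ⟨x, hx, hR, -⟩ := List.exists_cyclic_pred (len := len) L.lower_nodup L.lower_head
        L.lower_chain h
      rw [hR, if_pos h, if_pos hx]
    · obtain ⟨x, hx, hR, -⟩ := List.exists_cyclic_pred (len := len) L.upper_nodup L.upper_head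
        L.upper_chain h
      rw [hR, if_neg fun h' => L.disjoint _ h' h, if_neg fun h' => L.disjoint _ h' hx]
  org_eq e := by
    have hl : len (L.rot e) = len (L.mate (L.rot e)) := (hmate _).symm
    rw [hl]
    rcases L.mem e with h | h
    · obtain ⟨x, hx, hR, n, hn⟩ := List.exists_cyclic_pred (len := len) L.lower_nodup L.lower_head
        L.lower_chain h
      refine ⟨n, ?_⟩
      rw [hR, if_pos h, if_pos hx, if_pos h, hn]
      push_cast; ring
    · obtain ⟨x, hx, hR, n, hn⟩ := List.exists_cyclic_pred (len := len) L.upper_nodup L.upper_head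
        L.upper_chain h
      refine ⟨-n, ?_⟩
      rw [hR, if_neg fun h' => L.disjoint _ h' h, if_neg fun h' => L.disjoint _ h' hx,
        if_neg fun h' => L.disjoint _ h' h, hn, hsum]
      push_cast; ring
  exists_pt z hz := by
    have hpos : 0 < (L.lower.map len).sum := by
      have hne : L.lower ≠ [] := by
        intro h; have := L.lower_head; simp [h] at this
      exact List.sum_pos _ (by simpa using fun a _ => hlen a) (by simpa using hne)
    rcases hz with hz | hz
    · obtain ⟨i, hi, s, n, hs0, hs1, hx⟩ := L.lower.exists_lenSum_mod hpos z.re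
      refine ⟨L.lower[i], s, n, hs0, hs1, ?_⟩
      rw [if_pos (List.getElem_mem _), if_pos (List.getElem_mem _), L.lower_nodup.idxOf_getElem]
      refine Complex.ext ?_ (by simp [hz])
      simp [hx]
    -- On the upper component distances are measured leftwards from its right end `v + width`.
    · obtain ⟨i, hi, s, n, hs0, hs1, hx⟩ := L.upper.exists_lenSum_mod (by rwa [hsum])
        ((L.lower.map len).sum - (z - v).re)
      have hmem := List.getElem_mem hi
      refine ⟨L.upper[i], s, -n, hs0, hs1, ?_⟩
      rw [if_neg fun h' => L.disjoint _ h' hmem, if_neg fun h' => L.disjoint _ h' hmem,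
        L.upper_nodup.idxOf_getElem]
      refine Complex.ext ?_ (by simp [hz])
      rw [hsum, sub_re] at hx
      simp
      linarith
  pt_inj e e' s s' n hs0 hs1 hs0' hs1' h := by
    have idx : ∀ {l : List α} (he : e ∈ l) (he' : e' ∈ l), l.idxOf e = l.idxOf e' → e = e' := by
      intro l he he' h
      exact (List.idxOf_inj he).1 h
    have hre := congrArg re h
    have him := congrArg im h
    rcases L.mem e with he | he <;> rcases L.mem e' with he' | he'
    · have hi := List.idxOf_lt_length_iff.2 he
      have hi' := List.idxOf_lt_length_iff.2 he'
      rw [if_pos he, if_pos he, if_pos he', if_pos he'] at hre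
      simp at hre
      obtain ⟨h1, h2⟩ := L.lower.lenSum_add_inj_mod hlen hi hi' hs0 (by simpa using hs1) hs0'
        (by simpa using hs1') n hre
      exact ⟨idx he he' h1, h2⟩
    · have hn' : e' ∉ L.lower := fun h' => L.disjoint _ h' he'
      rw [if_pos he, if_pos he, if_neg hn', if_neg hn'] at him
      simp at him
      linarith
    · have hn : e ∉ L.lower := fun h' => L.disjoint _ h' he
      rw [if_neg hn, if_neg hn, if_pos he', if_pos he'] at him
      simp at him
      linarith
    · have hi := List.idxOf_lt_length_iff.2 he
      have hi' := List.idxOf_lt_length_iff.2 he'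
      have hn : e ∉ L.lower := fun h' => L.disjoint _ h' he
      have hn' : e' ∉ L.lower := fun h' => L.disjoint _ h' he'
      rw [if_neg hn, if_neg hn, if_neg hn', if_neg hn', ← hsum] at hre
      simp at hre
      obtain ⟨h1, h2⟩ := L.upper.lenSum_add_inj_mod hlen hi hi' hs0 (by simpa using hs1) hs0'
        (by simpa using hs1') (-n) (by push_cast; linarith)
      exact ⟨idx he he' h1, h2⟩

end EdgeLists

end

/-! ### Classes of glued points, and the edges of a suspension -/

noncomputable section

open Complex

namespace CylinderBoundary

variable {E : Type*} (B : CylinderBoundary E)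

/-- The points of the strip that are glued to the point at distance `s` from the origin of `e`. -/
def edgeClass (e : E) (s : ℝ) : Set ℂ :=
  open Classical in
  if s = 0 then {z | ∃ (e' : E) (n : ℤ), B.rot.SameCycle e e' ∧ z = B.org e' + n * B.width}
  else {z | ∃ n : ℤ, z = B.org e + B.sgn e * s + n * B.width ∨
    z = B.org (B.mate e) + B.sgn (B.mate e) * (B.len e - s : ℝ) + n * B.width}

/-- The points of the strip that are glued to a given one. -/
def fiberClass (z : ℂ) : Set ℂ :=
  open Classical in
  if h : z.im = 0 ∨ z.im = B.height then
    B.edgeClass (B.exists_pt z h).choose (B.exists_pt z h).choose_spec.choose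
  else {z' | ∃ n : ℤ, z' = z + n * B.width}

theorem pt_im (e : E) (s : ℝ) (n : ℤ) :
    (B.org e + B.sgn e * s + n * B.width).im = 0 ∨
      (B.org e + B.sgn e * s + n * B.width).im = B.height := by
  rcases B.sgn_cases e with ⟨h, h'⟩ | ⟨h, h'⟩ <;> simp [h, h']

/-- The edge and the parameter chosen in `fiberClass` are forced by `pt_inj`. -/
theorem fiberClass_pt_add {e : E} {s : ℝ} (h0 : 0 ≤ s) (h1 : s < B.len e) (n : ℤ) :
    B.fiberClass (B.org e + B.sgn e * s + n * B.width) = B.edgeClass e s := by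
  rw [fiberClass, dif_pos (B.pt_im e s n)]
  obtain ⟨n', h2, h3, h4⟩ := (B.exists_pt _ (B.pt_im e s n)).choose_spec.choose_spec
  set e' := (B.exists_pt _ (B.pt_im e s n)).choose
  set s' := (B.exists_pt _ (B.pt_im e s n)).choose_spec.choose
  have := B.pt_inj e e' s s' (n' - n) h0 h1 h2 h3 (by push_cast; linear_combination h4)
  change B.edgeClass e' s' = _
  rw [← this.1, ← this.2]

theorem fiberClass_pt {e : E} {s : ℝ} (h0 : 0 ≤ s) (h1 : s < B.len e) :
    B.fiberClass (B.org e + B.sgn e * s) = B.edgeClass e s := by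
  simpa using B.fiberClass_pt_add h0 h1 0

theorem fiberClass_of_interior {z : ℂ} (h0 : 0 < z.im) (h1 : z.im < B.height) :
    B.fiberClass z = {z' | ∃ n : ℤ, z' = z + n * B.width} :=
  dif_neg (by rintro (h | h) <;> linarith)

theorem fiberClass_add (z : ℂ) (n : ℤ) : B.fiberClass (z + n * B.width) = B.fiberClass z := by
  by_cases h : z.im = 0 ∨ z.im = B.height
  · obtain ⟨e, s, n', h0, h1, rfl⟩ := B.exists_pt z h
    have : B.org e + B.sgn e * s + n' * B.width + n * B.width =
        B.org e + B.sgn e * s + (n' + n : ℤ) * B.width := by push_cast; ring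
    rw [this, B.fiberClass_pt_add h0 h1, B.fiberClass_pt_add h0 h1]
  · rw [fiberClass, fiberClass, dif_neg h, dif_neg (by simpa using h)]
    ext z'
    constructor
    · rintro ⟨k, rfl⟩; exact ⟨n + k, by push_cast; ring⟩
    · rintro ⟨k, rfl⟩; exact ⟨k - n, by push_cast; ring⟩

theorem self_mem_fiberClass (z : ℂ) : z ∈ B.fiberClass z := by
  by_cases h : z.im = 0 ∨ z.im = B.height
  · obtain ⟨e, s, n, h0, h1, rfl⟩ := B.exists_pt z h
    rw [B.fiberClass_pt_add h0 h1, edgeClass]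
    split_ifs with hs
    · exact ⟨e, n, Equiv.Perm.SameCycle.refl _ _, by simp [hs]⟩
    · exact ⟨n, Or.inl rfl⟩
  · rw [fiberClass, dif_neg h]
    exact ⟨0, by simp⟩

theorem fiberClass_org (e : E) : B.fiberClass (B.org e) = B.edgeClass e 0 := by
  simpa using B.fiberClass_pt (e := e) le_rfl (B.len_pos e)

/-- The end of `mate e` is, up to a period, the origin of the following edge `rot⁻¹ e`, which is in
the cycle of `e`. -/
theorem fiberClass_pt_mate_len (e : E) :
    B.fiberClass (B.org (B.mate e) + B.sgn (B.mate e) * B.len e) = B.fiberClass (B.org e) := by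
  obtain ⟨n, hn⟩ := B.org_eq (B.rot⁻¹ e)
  have hsgn := B.sgn_mate_rot (B.rot⁻¹ e)
  have hr : B.rot (B.rot⁻¹ e) = e := B.rot.apply_symm_apply e
  rw [hr] at hn hsgn
  have h1 : B.org (B.mate e) + B.sgn (B.mate e) * B.len e =
      B.org (B.rot⁻¹ e) + (-n : ℤ) * B.width := by
    rw [hn, hsgn]; push_cast; ring
  have hc : B.rot.SameCycle (B.rot⁻¹ e) e := ⟨1, hr⟩
  rw [h1, fiberClass_add, fiberClass_org, fiberClass_org, edgeClass, edgeClass, if_pos rfl,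
    if_pos rfl]
  ext z
  exact exists_congr fun e' => exists_congr fun n => and_congr_left' ⟨hc.symm.trans, hc.trans⟩

theorem fiberClass_glue {e : E} {s : ℝ} (h0 : 0 ≤ s) (h1 : s ≤ B.len e) :
    B.fiberClass (B.org e + B.sgn e * s) =
      B.fiberClass (B.org (B.mate e) + B.sgn (B.mate e) * (B.len e - s : ℝ)) := by
  rcases h0.eq_or_lt with rfl | h0'
  · simpa using (B.fiberClass_pt_mate_len e).symm
  rcases h1.eq_or_lt with rfl | h1'
  · have := B.fiberClass_pt_mate_len (B.mate e)
    rw [B.mate_mate, B.len_mate] at this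
    simpa using this
  · rw [B.fiberClass_pt h0 h1', B.fiberClass_pt (by linarith) (by rw [B.len_mate]; linarith),
      edgeClass, edgeClass, if_neg h0'.ne', if_neg (by linarith), B.mate_mate, B.len_mate,
      sub_sub_cancel]
    ext z
    exact exists_congr fun n => or_comm

end CylinderBoundary

namespace List

theorem sum_take_reverse {α : Type*} (len : α → ℝ) (l : List α) (i : ℕ) :
    ((l.reverse.take i).map len).sum = (l.map len).sum - l.lenSum len (l.length - i) := by
  have h1 : l.reverse.take i = (l.drop (l.length - i)).reverse := by
    rw [List.take_reverse]
  rw [h1, List.map_reverse, List.sum_reverse, lenSum]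
  conv_rhs => enter [1]; rw [← List.take_append_drop (l.length - i) l]
  rw [List.map_append, List.sum_append]
  ring

end List

/-- Lists of edges whose symbols form the two lines of a generalized permutation with vertical
symbol `seam`. -/
structure SuspensionLists (π : TwoLines) (α : Type*) extends EdgeLists α where
  seam : ℕ
  sym : α → ℕ
  top_eq : π.top = seam :: upper.reverse.map sym
  bot_eq : π.bot = lower.map sym ++ [seam]
  sym_ne : ∀ e, sym e ≠ seam
  sym_mate : ∀ e, sym (mate e) = sym e
  eq_or_eq_mate : ∀ e e', sym e = sym e' → e' = e ∨ e' = mate e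
  head_ne : sym lowerHead ≠ sym upperHead

namespace SuspensionLists

variable {π : TwoLines} {α : Type*} [DecidableEq α] (L : SuspensionLists π α) {v : ℕ → ℂ}

/-- The lengths of the edges. -/
def len (v : ℕ → ℂ) (e : α) : ℝ := (v (L.sym e)).re

theorem sym_mem (e : α) : L.sym e ∈ π.top ++ π.bot := by
  rw [L.top_eq, L.bot_eq]
  simp only [List.cons_append, List.mem_cons, List.mem_append, List.mem_map, List.mem_reverse]
  rcases L.mem e with h | h
  · exact Or.inr (Or.inr (Or.inl ⟨e, h, rfl⟩))
  · exact Or.inr (Or.inl ⟨e, h, rfl⟩)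

theorem lowerHead_sym : π.bot.head? = some (L.sym L.lowerHead) := by
  have := L.lower_head
  rw [L.bot_eq]
  cases h : L.lower with
  | nil => simp [h] at this
  | cons a l => simp [h] at this; simp [this]

theorem upperHead_sym : π.top.getLast? = some (L.sym L.upperHead) := by
  have := L.upper_head
  rw [L.top_eq]
  cases h : L.upper with
  | nil => simp [h] at this
  | cons a l =>
    simp [h] at this
    rw [List.getLast?_cons]
    simp [this]

/-- By `head_ne` the transverse symbol cannot be first below and last above, so it is `seam`. Its
vector cancels from the closing relation, leaving an identity between real lengths. -/
theorem suspensionData (hv : π.IsSuspensionData v) :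
    0 < (v L.seam).im ∧ (∀ e, 0 < L.len v e) ∧ (∀ e, v (L.sym e) = L.len v e) ∧
      (L.upper.map (L.len v)).sum = (L.lower.map (L.len v)).sum := by
  obtain ⟨a, ha, hpos, hsum⟩ := hv
  have ha' : a = L.seam ∧ 0 < (v a).im := by
    rcases ha with ⟨h1, -, h3⟩ | ⟨h1, h2, -⟩
    · rw [L.top_eq] at h1
      simp at h1
      exact ⟨h1.symm, h3⟩
    · rw [L.lowerHead_sym] at h1
      rw [L.upperHead_sym] at h2
      exact absurd (Option.some.inj (h1.trans h2.symm)) L.head_ne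
  obtain ⟨rfl, him⟩ := ha'
  have h1 : ∀ e, 0 < L.len v e := fun e => (hpos _ (L.sym_mem e) (L.sym_ne e)).1
  have h2 : ∀ e, v (L.sym e) = L.len v e := fun e =>
    Complex.ext rfl (by simpa using (hpos _ (L.sym_mem e) (L.sym_ne e)).2)
  refine ⟨him, h1, h2, ?_⟩
  rw [L.top_eq, L.bot_eq] at hsum
  simp only [List.map_cons, List.map_map, List.map_reverse, List.sum_cons, List.map_append,
    List.sum_append, List.sum_reverse, List.map_nil, List.sum_nil, add_zero] at hsum
  have h3 : v ∘ L.sym = fun e => (L.len v e : ℂ) := funext h2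
  rw [h3, add_comm] at hsum
  have h4 := add_right_cancel hsum
  have cast : ∀ l : List α, (l.map fun e => (L.len v e : ℂ)).sum = ((l.map (L.len v)).sum : ℝ) := by
    intro l
    induction l with
    | nil => simp
    | cons a l ih => simp [ih]
  rw [cast, cast] at h4
  exact_mod_cast h4

theorem len_mate (e : α) : L.len v (L.mate e) = L.len v e := by rw [len, L.sym_mate, len]

/-- The subdivided boundary of the cylinder of a suspension. -/
def cylinder (hv : π.IsSuspensionData v) : CylinderBoundary α :=
  L.boundary (L.len v) (L.suspensionData hv).2.1 L.len_mate (L.suspensionData hv).2.2.2 (v L.seam)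
    (L.suspensionData hv).1

variable (hv : π.IsSuspensionData v)

theorem sum_map_eq (hv : π.IsSuspensionData v) (l : List α) :
    ((l.map L.sym).map v).sum = ((l.map (L.len v)).sum : ℝ) := by
  induction l with
  | nil => simp
  | cons a l ih => simp only [List.map_cons, List.sum_cons, ih, (L.suspensionData hv).2.2.1]; simp

theorem botVertex_eq (hv : π.IsSuspensionData v) {j : ℕ} (hj : j ≤ L.lower.length) :
    π.botVertex v j = (L.lower.lenSum (L.len v) j : ℝ) := by
  rw [TwoLines.botVertex, L.bot_eq, List.take_append_of_le_length (by simpa using hj),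
    ← List.map_take, L.sum_map_eq hv, List.lenSum]

theorem botVertex_last {j : ℕ} (hj : L.lower.length < j) :
    π.botVertex v j = ((L.cylinder hv).width : ℝ) + v L.seam := by
  rw [TwoLines.botVertex, L.bot_eq, List.take_of_length_le (by simp; omega), List.map_append,
    List.sum_append, L.sum_map_eq hv]
  simp; rfl

theorem topVertex_zero : π.topVertex v 0 = 0 := by simp [TwoLines.topVertex]

theorem topVertex_succ (i : ℕ) :
    π.topVertex v (i + 1) = v L.seam +
      (((L.cylinder hv).width : ℝ) - L.upper.lenSum (L.len v) (L.upper.length - i) : ℝ) := by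
  rw [TwoLines.topVertex, L.top_eq, List.take_succ_cons, List.map_cons, List.sum_cons,
    ← List.map_take, L.sum_map_eq hv, List.sum_take_reverse, (L.suspensionData hv).2.2.2]
  rfl

/-- The top line is read from left to right, but the upper edges are directed from right to left; so
the parameter t becomes 1 - t. -/
theorem top_getElem? {i a : ℕ} (h : π.top[i]? = some a) :
    (i = 0 ∧ a = L.seam) ∨ ∃ e, e ∈ L.upper ∧ L.sym e = a ∧ i = L.upper.length - L.upper.idxOf e ∧
      ∀ t : ℝ, π.topVertex v i + t * v a =
        (L.cylinder hv).org e + (L.cylinder hv).sgn e * ((1 - t) * L.len v e : ℝ) := by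
  rw [L.top_eq] at h
  rcases i with _ | i
  · left; simpa [eq_comm] using h
  right
  rw [List.getElem?_cons_succ, List.getElem?_map, Option.map_eq_some_iff] at h
  obtain ⟨e, h1, h2⟩ := h
  have hi : i < L.upper.length := by
    have := (List.getElem?_eq_some_iff.1 h1).1
    simpa using this
  rw [List.getElem?_reverse hi] at h1
  obtain ⟨h3, h4⟩ := List.getElem?_eq_some_iff.1 h1
  have hmem : e ∈ L.upper := h4 ▸ List.getElem_mem _
  have hidx : L.upper.idxOf e = L.upper.length - 1 - i := by
    rw [← h4, L.upper_nodup.idxOf_getElem]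
  refine ⟨e, hmem, h2, by omega, fun t => ?_⟩
  have hn : e ∉ L.lower := fun h' => L.disjoint _ h' hmem
  have horg : (L.cylinder hv).org e = v L.seam +
      ((L.cylinder hv).width - L.upper.lenSum (L.len v) (L.upper.idxOf e) : ℝ) := if_neg hn
  have hsgn : (L.cylinder hv).sgn e = -1 := if_neg hn
  have hs : L.upper.length - i = L.upper.length - 1 - i + 1 := by omega
  rw [L.topVertex_succ hv, horg, hsgn, hs, List.lenSum_succ _ h3, hidx, h4, ← h2,
    (L.suspensionData hv).2.2.1]
  push_cast; ring

theorem bot_getElem? {j a : ℕ} (h : π.bot[j]? = some a) :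
    (j = L.lower.length ∧ a = L.seam) ∨ ∃ e, e ∈ L.lower ∧ L.sym e = a ∧ j = L.lower.idxOf e ∧
      ∀ t : ℝ, π.botVertex v j + t * v a =
        (L.cylinder hv).org e + (L.cylinder hv).sgn e * (t * L.len v e : ℝ) := by
  rw [L.bot_eq] at h
  rcases lt_or_ge j L.lower.length with hj | hj
  · right
    rw [List.getElem?_append_left (by simpa using hj), List.getElem?_map,
      Option.map_eq_some_iff] at h
    obtain ⟨e, h1, h2⟩ := h
    obtain ⟨h3, h4⟩ := List.getElem?_eq_some_iff.1 h1
    have hmem : e ∈ L.lower := h4 ▸ List.getElem_mem _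
    have hidx : L.lower.idxOf e = j := by
      rw [← h4, L.lower_nodup.idxOf_getElem]
    refine ⟨e, hmem, h2, hidx.symm, fun t => ?_⟩
    have horg : (L.cylinder hv).org e = (L.lower.lenSum (L.len v) (L.lower.idxOf e) : ℝ) :=
      if_pos hmem
    have hsgn : (L.cylinder hv).sgn e = 1 := if_pos hmem
    rw [L.botVertex_eq hv hj.le, horg, hsgn, hidx, ← h2, (L.suspensionData hv).2.2.1]
    push_cast; ring
  · left
    rw [List.getElem?_append_right (by simpa using hj), List.length_map] at h
    obtain ⟨h3, h4⟩ := List.getElem?_eq_some_iff.1 h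
    simp at h3
    have : j = L.lower.length := by omega
    simp [this] at h4
    exact ⟨this, h4.symm⟩

theorem exists_top_getElem? {e : α} (he : e ∈ L.upper) :
    π.top[L.upper.length - L.upper.idxOf e]? = some (L.sym e) := by
  have hi := List.idxOf_lt_length_iff.2 he
  obtain ⟨k, hk⟩ : ∃ k, L.upper.length - L.upper.idxOf e = k + 1 :=
    ⟨L.upper.length - L.upper.idxOf e - 1, by omega⟩
  rw [hk, L.top_eq, List.getElem?_cons_succ, List.getElem?_map, List.getElem?_reverse (by omega)]
  have : L.upper.length - 1 - k = L.upper.idxOf e := by omega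
  rw [this, List.getElem?_eq_getElem hi, List.getElem_idxOf]
  rfl

theorem exists_bot_getElem? {e : α} (he : e ∈ L.lower) :
    π.bot[L.lower.idxOf e]? = some (L.sym e) := by
  have hi := List.idxOf_lt_length_iff.2 he
  rw [L.bot_eq, List.getElem?_append_left (by simpa using hi), List.getElem?_map,
    List.getElem?_eq_getElem hi, List.getElem_idxOf]
  rfl

theorem topVertex_add {e : α} (he : e ∈ L.upper) (t : ℝ) :
    π.topVertex v (L.upper.length - L.upper.idxOf e) + t * v (L.sym e) =
      (L.cylinder hv).org e + (L.cylinder hv).sgn e * ((1 - t) * L.len v e : ℝ) := by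
  rcases L.top_getElem? hv (L.exists_top_getElem? he) with ⟨-, h⟩ | ⟨e', h1, -, h3, h4⟩
  · exact absurd h (L.sym_ne e)
  · have a1 := List.idxOf_lt_length_iff.2 he
    have a2 := List.idxOf_lt_length_iff.2 h1
    have : e = e' := (List.idxOf_inj he).1 (by omega)
    rw [h4, this]

theorem botVertex_add {e : α} (he : e ∈ L.lower) (t : ℝ) :
    π.botVertex v (L.lower.idxOf e) + t * v (L.sym e) =
      (L.cylinder hv).org e + (L.cylinder hv).sgn e * (t * L.len v e : ℝ) := by
  rcases L.bot_getElem? hv (L.exists_bot_getElem? he) with ⟨-, h⟩ | ⟨e', h1, -, h3, h4⟩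
  · exact absurd h (L.sym_ne e)
  · rw [h4, (List.idxOf_inj he).1 h3]

/-- Only generating identifications need to be examined: a function respecting them factors through
the quotient. So the fibres of the projection are found without following chains of identifications.
-/
theorem fiberClass_eq_of_glue {x y : ℂ} (h : TwoLines.Glue π v x y) :
    (L.cylinder hv).fiberClass x = (L.cylinder hv).fiberClass y := by
  have glue : ∀ e e' (t : ℝ), t ∈ Set.Icc (0 : ℝ) 1 → L.sym e = L.sym e' → e' ≠ e →
      (L.cylinder hv).fiberClass
          ((L.cylinder hv).org e + (L.cylinder hv).sgn e * (t * L.len v e : ℝ)) =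
        (L.cylinder hv).fiberClass
          ((L.cylinder hv).org e' + (L.cylinder hv).sgn e' * ((1 - t) * L.len v e' : ℝ)) := by
    intro e e' t ht hs hne
    have hm := (L.eq_or_eq_mate e e' hs).resolve_left hne
    have hl := (L.suspensionData hv).2.1 e
    rw [(L.cylinder hv).fiberClass_glue (mul_nonneg ht.1 hl.le)
      (show t * L.len v e ≤ L.len v e by nlinarith [ht.2]), hm, L.len_mate]
    congr 4
    change L.len v e - t * L.len v e = _
    ring
  have sub : ∀ {t : ℝ}, t ∈ Set.Icc (0 : ℝ) 1 → 1 - t ∈ Set.Icc (0 : ℝ) 1 := by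
    intro t ht; exact ⟨by linarith [ht.2], by linarith [ht.1]⟩
  cases h with
  | translation i j a hi hj t ht =>
    rcases L.top_getElem? hv hi with ⟨rfl, rfl⟩ | ⟨e, he, hse, -, hxe⟩
    · rcases L.bot_getElem? hv hj with ⟨rfl, -⟩ | ⟨e', -, hse', -⟩
      · rw [topVertex_zero, L.botVertex_eq hv le_rfl, List.lenSum_length,
          ← (L.cylinder hv).fiberClass_add _ 1]
        congr 1
        push_cast
        change _ + 1 * (((L.lower.map (L.len v)).sum : ℝ) : ℂ) = _
        ring
      · exact absurd hse' (L.sym_ne e')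
    · rcases L.bot_getElem? hv hj with ⟨-, rfl⟩ | ⟨e', he', hse', -, hxe'⟩
      · exact absurd hse (L.sym_ne e)
      · rw [hxe, hxe', glue e e' _ (sub ht) (hse.trans hse'.symm)
          (by rintro rfl; exact L.disjoint _ he' he), sub_sub_cancel]
  | symmetryTop i j a hij hi hj t ht =>
    rcases L.top_getElem? hv hi with ⟨rfl, rfl⟩ | ⟨e, he, hse, hie, hxe⟩
    · rcases L.top_getElem? hv hj with ⟨rfl, -⟩ | ⟨e', -, hse', -⟩
      · exact absurd rfl hij
      · exact absurd hse' (L.sym_ne e')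
    · rcases L.top_getElem? hv hj with ⟨-, rfl⟩ | ⟨e', he', hse', hie', hxe'⟩
      · exact absurd hse (L.sym_ne e)
      · have := hxe' (1 - t)
        push_cast at this
        rw [hxe, this, glue e e' _ (sub ht) (hse.trans hse'.symm)
          (by rintro rfl; exact hij (hie.trans hie'.symm))]
        push_cast
        rfl
  | symmetryBot i j a hij hi hj t ht =>
    rcases L.bot_getElem? hv hi with ⟨rfl, rfl⟩ | ⟨e, he, hse, hie, hxe⟩
    · rcases L.bot_getElem? hv hj with ⟨rfl, -⟩ | ⟨e', -, hse', -⟩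
      · exact absurd rfl hij
      · exact absurd hse' (L.sym_ne e')
    · rcases L.bot_getElem? hv hj with ⟨-, rfl⟩ | ⟨e', he', hse', hie', hxe'⟩
      · exact absurd hse (L.sym_ne e)
      · have := hxe' (1 - t)
        push_cast at this
        rw [hxe, this, glue e e' _ ht (hse.trans hse'.symm)
          (by rintro rfl; exact hij (hie.trans hie'.symm))]
        push_cast
        rfl

/-- `Glue` lists translations only from the top line to the bottom line, so the direction depends on
the lines that carry `e` and its mate. -/
theorem glue_or_glue {e : α} {s : ℝ} (h0 : 0 ≤ s) (h1 : s ≤ L.len v e) :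
    let x := (L.cylinder hv).org e + (L.cylinder hv).sgn e * s
    let y := (L.cylinder hv).org (L.mate e) + (L.cylinder hv).sgn (L.mate e) * (L.len v e - s : ℝ)
    TwoLines.Glue π v x y ∨ TwoLines.Glue π v y x := by
  intro x y
  have hl := (L.suspensionData hv).2.1 e
  set t : ℝ := s / L.len v e with ht
  have ht0 : 0 ≤ t := by positivity
  have ht1 : t ≤ 1 := by rw [ht, div_le_one hl]; exact h1
  have hs : t * L.len v e = s := by rw [ht]; field_simp
  have hs' : (1 - t) * L.len v e = L.len v e - s := by rw [sub_mul, hs, one_mul]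
  have htm : t ∈ Set.Icc (0 : ℝ) 1 := ⟨ht0, ht1⟩
  have htm' : 1 - t ∈ Set.Icc (0 : ℝ) 1 := ⟨by linarith, by linarith⟩
  rcases L.mem e with he | he <;> rcases L.mem (L.mate e) with hm | hm
  · left
    have := TwoLines.Glue.symmetryBot (π := π) (v := v) _ _ _
      (fun h => L.mate_ne e ((List.idxOf_inj he).1 h).symm)
      (L.exists_bot_getElem? he) (by rw [L.exists_bot_getElem? hm, L.sym_mate]) t htm
    have e2 := L.botVertex_add hv hm (1 - t)
    rw [L.sym_mate] at e2
    push_cast at e2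
    rw [L.botVertex_add hv he, e2, hs, L.len_mate] at this
    convert this using 2
    simp only [← hs']; push_cast; ring
  · right
    have := TwoLines.Glue.translation (π := π) (v := v) _ _ (L.sym e)
      (by rw [L.exists_top_getElem? hm, L.sym_mate]) (L.exists_bot_getElem? he) t htm
    have e2 := L.topVertex_add hv hm t
    rw [L.sym_mate] at e2
    rw [L.botVertex_add hv he, e2, hs, L.len_mate, hs'] at this
    exact this
  · left
    have := TwoLines.Glue.translation (π := π) (v := v) _ _ (L.sym e)
      (L.exists_top_getElem? he) (by rw [L.exists_bot_getElem? hm, L.sym_mate]) (1 - t) htm'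
    have e2 := L.botVertex_add hv hm (1 - t)
    rw [L.sym_mate] at e2
    rw [L.topVertex_add hv he, e2, sub_sub_cancel, hs, L.len_mate, hs'] at this
    exact this
  · left
    have a1 := List.idxOf_lt_length_iff.2 he
    have a2 := List.idxOf_lt_length_iff.2 hm
    have := TwoLines.Glue.symmetryTop (π := π) (v := v)
      (L.upper.length - L.upper.idxOf e) (L.upper.length - L.upper.idxOf (L.mate e)) (L.sym e)
      (fun h => L.mate_ne e ((List.idxOf_inj he).1 (by omega)).symm)
      (L.exists_top_getElem? he) (by rw [L.exists_top_getElem? hm, L.sym_mate]) (1 - t) htm'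
    have e2 := L.topVertex_add hv hm t
    rw [L.sym_mate, L.len_mate, hs'] at e2
    push_cast at this
    rw [sub_sub_cancel, e2] at this
    have e3 := L.topVertex_add hv he (1 - t)
    rw [sub_sub_cancel, hs] at e3
    push_cast at e3
    rw [e3] at this
    exact this

theorem glue_seam {t : ℝ} (ht : t ∈ Set.Icc (0 : ℝ) 1) :
    TwoLines.Glue π v (t * v L.seam) ((L.cylinder hv).width + t * v L.seam) := by
  have := TwoLines.Glue.translation (π := π) (v := v) 0 L.lower.length L.seam
    (by rw [L.top_eq]; rfl) (by rw [L.bot_eq]; simp) t ht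
  rw [topVertex_zero, L.botVertex_eq hv le_rfl, List.lenSum_length, zero_add] at this
  exact this

end SuspensionLists

end

/-! ### The suspension as a glued cylinder -/

noncomputable section

open Complex

namespace TwoLines

variable {π : TwoLines} {v : ℕ → ℂ}

theorem proj_of_mem {z : ℂ} (h : z ∈ π.parallelogram v) :
    π.proj v z = Quotient.mk (π.glueSetoid v) ⟨z, h⟩ := dif_pos h

theorem proj_eq_of_glue {x y : ℂ} (hx : x ∈ π.parallelogram v) (hy : y ∈ π.parallelogram v)
    (h : Glue π v x y) : π.proj v x = π.proj v y := by
  rw [proj_of_mem hx, proj_of_mem hy]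
  exact Quotient.sound (Relation.EqvGen.rel _ _ h)

theorem continuousOn_proj : ContinuousOn (π.proj v) (π.parallelogram v) := by
  rw [continuousOn_iff_continuous_domRestrict]
  have : (π.parallelogram v).domRestrict (π.proj v) = Quotient.mk (π.glueSetoid v) := by
    funext z
    exact proj_of_mem z.2
  rw [this]
  exact continuous_quot_mk

/-- A function on the plane that respects the gluing factors through the surface. -/
theorem eq_of_proj_eq {β : Type*} (f : ℂ → β) (hf : ∀ x y, Glue π v x y → f x = f y) {x y : ℂ}
    (hx : x ∈ π.parallelogram v) (hy : y ∈ π.parallelogram v) (h : π.proj v x = π.proj v y) :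
    f x = f y := by
  rw [proj_of_mem hx, proj_of_mem hy] at h
  have key : ∀ a b : π.parallelogram v,
      Relation.EqvGen (fun x y : π.parallelogram v => Glue π v x y) a b → f a = f b := by
    intro a b hab
    induction hab with
    | rel a b h => exact hf _ _ h
    | refl a => rfl
    | symm a b _ ih => exact ih.symm
    | trans a b c _ _ ih ih' => exact ih.trans ih'
  exact key ⟨x, hx⟩ ⟨y, hy⟩ (Quotient.exact h)

end TwoLines

theorem QuadraticDifferential.IsFlatOn.congr {S : Type*} [TopologicalSpace S] [ChartedSpace ℂ S]
    {q : QuadraticDifferential S} {F F' : ℂ → S} {U U' : Set ℂ} (h : q.IsFlatOn F U)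
    (hU : U' ⊆ U) (hF : ∀ z ∈ U', F' =ᶠ[𝓝 z] F) : q.IsFlatOn F' U' := by
  intro z hz e he hs
  have hFz := hF z hz
  rw [hFz.eq_of_nhds] at hs
  obtain ⟨h1, h2⟩ := h z (hU hz) e he hs
  have hc : e ∘ F' =ᶠ[𝓝 z] e ∘ F := hFz.fun_comp e
  refine ⟨h1.congr hc.symm, ?_⟩
  filter_upwards [h2, hc.deriv.filter_mono nhdsWithin_le_nhds,
    hFz.filter_mono nhdsWithin_le_nhds] with w hw h3 h4
  rw [h3, h4, hw]

namespace SuspensionLists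

variable {π : TwoLines} {α : Type*} [DecidableEq α] (L : SuspensionLists π α) {v : ℕ → ℂ}
  (hv : π.IsSuspensionData v)

theorem height_eq : (L.cylinder hv).height = (v L.seam).im := rfl

/-- The horizontal coordinate along the sides of the parallelogram. -/
def skew (z : ℂ) : ℝ :=
  (z.re - z.im / (L.cylinder hv).height * (v L.seam).re) / (L.cylinder hv).width

theorem skew_add (z z' : ℂ) : L.skew hv (z + z') = L.skew hv z + L.skew hv z' := by
  simp only [skew, add_re, add_im]; ring

theorem skew_mul (a : ℝ) (z : ℂ) : L.skew hv (a * z) = a * L.skew hv z := by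
  simp only [skew, re_ofReal_mul, im_ofReal_mul]; ring

theorem skew_ofReal (a : ℝ) : L.skew hv a = a / (L.cylinder hv).width := by
  simp [skew]

theorem skew_width : L.skew hv (L.cylinder hv).width = 1 := by
  rw [skew_ofReal, div_self (L.cylinder hv).width_pos.ne']

theorem skew_seam : L.skew hv (v L.seam) = 0 := by
  have := (L.cylinder hv).height_pos.ne'
  rw [skew, ← L.height_eq hv, div_self this]; simp

theorem continuous_skew : Continuous (L.skew hv) := by
  unfold skew; fun_prop

theorem eq_skew (z : ℂ) : z = L.skew hv z * (L.cylinder hv).width +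
    (z.im / (L.cylinder hv).height : ℝ) * v L.seam := by
  have h1 := (L.cylinder hv).height_pos.ne'
  have h2 := (L.cylinder hv).width_pos.ne'
  refine Complex.ext ?_ ?_
  · simp only [skew, add_re, re_ofReal_mul, ofReal_re]; field_simp; ring
  · simp only [add_im, im_ofReal_mul, ofReal_im, ← L.height_eq hv]; field_simp; ring

theorem mem_parallelogram_of {s t : ℝ} (hs : s ∈ Set.Icc (0 : ℝ) 1) (ht : t ∈ Set.Icc (0 : ℝ) 1) :
    (s * (L.cylinder hv).width + t * v L.seam : ℂ) ∈ π.parallelogram v := by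
  have hc : Convex ℝ (π.parallelogram v) := convex_convexHull _ _
  have top : ∀ k, π.topVertex v k ∈ π.parallelogram v := fun k =>
    subset_convexHull _ _ (Or.inl ⟨k, rfl⟩)
  have bot : ∀ k, π.botVertex v k ∈ π.parallelogram v := fun k =>
    subset_convexHull _ _ (Or.inr ⟨k, rfl⟩)
  have h0 : (0 : ℂ) ∈ π.parallelogram v := π.zero_mem_parallelogram v
  have h1 : ((L.cylinder hv).width : ℂ) ∈ π.parallelogram v := by
    have := bot L.lower.length
    rw [L.botVertex_eq hv le_rfl, List.lenSum_length] at this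
    exact this
  have h2 : v L.seam ∈ π.parallelogram v := by
    have := top 1
    rw [TwoLines.topVertex, L.top_eq] at this
    simpa using this
  have h3 : ((L.cylinder hv).width : ℂ) + v L.seam ∈ π.parallelogram v := by
    rw [← L.botVertex_last hv (Nat.lt_succ_self _)]
    exact bot _
  have a1 := hc h0 h1 (sub_nonneg.2 hs.2) hs.1 (sub_add_cancel 1 s)
  have a2 := hc h2 h3 (sub_nonneg.2 hs.2) hs.1 (sub_add_cancel 1 s)
  convert hc a1 a2 (sub_nonneg.2 ht.2) ht.1 (sub_add_cancel 1 t) using 1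
  simp only [real_smul]
  push_cast; ring

/-- In the coordinates along the two directions of the sides, all vertices of the broken lines
satisfy the convex inequalities on the right; conversely, the four corners are themselves vertices
of the broken lines. -/
theorem parallelogram_eq : π.parallelogram v =
    {z | L.skew hv z ∈ Set.Icc (0 : ℝ) 1 ∧ z.im ∈ Set.Icc (0 : ℝ) (L.cylinder hv).height} := by
  have hw := (L.cylinder hv).width_pos
  have hh := (L.cylinder hv).height_pos
  apply Set.Subset.antisymm
  · have hlow : ∀ {l : List α} (k : ℕ), (l.map (L.len v)).sum = (L.cylinder hv).width →
        0 ≤ l.lenSum (L.len v) k ∧ l.lenSum (L.len v) k ≤ (L.cylinder hv).width := by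
      intro l k hl
      have hpos := (L.suspensionData hv).2.1
      refine ⟨l.lenSum_nonneg hpos k, ?_⟩
      rcases le_total k l.length with hk | hk
      · rw [← hl, ← l.lenSum_length]
        exact l.lenSum_mono hpos hk
      · rw [List.lenSum, List.take_of_length_le hk, hl]
    refine convexHull_min ?_ ?_
    · rintro _ (⟨k, rfl⟩ | ⟨k, rfl⟩)
      · rcases k with _ | k
        · rw [topVertex_zero]
          have : L.skew hv 0 = 0 := by simp [skew]
          exact ⟨by simp [this], by simp [hh.le]⟩
        · rw [L.topVertex_succ hv]
          obtain ⟨h1, h2⟩ := hlow (l := L.upper) (L.upper.length - k) (L.suspensionData hv).2.2.2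
          refine ⟨?_, ?_⟩
          · rw [skew_add, skew_seam, skew_ofReal, zero_add]
            exact ⟨div_nonneg (by linarith) hw.le, (div_le_one hw).2 (by linarith)⟩
          · rw [add_im, ofReal_im, add_zero, ← L.height_eq hv]
            exact ⟨hh.le, le_rfl⟩
      · rcases le_or_gt k L.lower.length with hk | hk
        · rw [L.botVertex_eq hv hk]
          obtain ⟨h1, h2⟩ := hlow (l := L.lower) k rfl
          refine ⟨?_, ?_⟩
          · rw [skew_ofReal]
            exact ⟨div_nonneg (by linarith) hw.le, (div_le_one hw).2 (by linarith)⟩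
          · rw [ofReal_im]
            exact ⟨le_rfl, hh.le⟩
        · rw [L.botVertex_last hv hk]
          refine ⟨?_, ?_⟩
          · rw [skew_add, skew_seam, skew_width]; simp
          · rw [add_im, ofReal_im, zero_add, ← L.height_eq hv]
            exact ⟨hh.le, le_rfl⟩
    · rintro x ⟨⟨hx1, hx2⟩, hx3, hx4⟩ y ⟨⟨hy1, hy2⟩, hy3, hy4⟩ a b ha hb hab
      simp only [Set.mem_ofPred_eq, real_smul, skew_add, skew_mul, add_im, im_ofReal_mul, Set.mem_Icc]
      obtain rfl : b = 1 - a := by linarith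
      refine ⟨⟨by positivity, by nlinarith⟩, by positivity, by nlinarith⟩
  · rintro z ⟨h1, h2⟩
    rw [L.eq_skew hv z]
    exact L.mem_parallelogram_of hv h1 ⟨div_nonneg h2.1 hh.le, (div_le_one hh).2 h2.2⟩

/-- The projection of the strip to the surface. -/
def param (z : ℂ) : π.Surface v :=
  π.proj v (Int.fract (L.skew hv z) * (L.cylinder hv).width +
    (max 0 (min (z.im / (L.cylinder hv).height) 1) : ℝ) * v L.seam)

theorem proj_seam {t : ℝ} (ht : t ∈ Set.Icc (0 : ℝ) 1) :
    π.proj v (t * v L.seam) = π.proj v ((L.cylinder hv).width + t * v L.seam) := by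
  apply TwoLines.proj_eq_of_glue _ _ (L.glue_seam hv ht)
  · simpa using L.mem_parallelogram_of hv (s := 0) (by simp) ht
  · simpa using L.mem_parallelogram_of hv (s := 1) (by simp) ht

theorem clamp_mem (x : ℝ) : max 0 (min x 1) ∈ Set.Icc (0 : ℝ) 1 :=
  ⟨le_max_left _ _, max_le zero_le_one (min_le_right _ _)⟩

theorem clamp_eq {x : ℝ} (hx : x ∈ Set.Icc (0 : ℝ) 1) : max 0 (min x 1) = x := by
  rw [min_eq_left hx.2, max_eq_right hx.1]

/-- The jump of the fractional part is harmless because the two slanted sides are glued to each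
other; clamping the height extends the map continuously beyond the strip. -/
theorem continuous_param : Continuous (L.param hv) := by
  refine ContinuousOn.comp_fract (s := L.skew hv) (f := fun z t => π.proj v
    (t * (L.cylinder hv).width +
      (max 0 (min (z.im / (L.cylinder hv).height) 1) : ℝ) * v L.seam)) ?_ (L.continuous_skew hv) ?_
  · refine TwoLines.continuousOn_proj.comp (by fun_prop) ?_
    rintro ⟨z, t⟩ ⟨-, ht⟩
    exact L.mem_parallelogram_of hv ht (clamp_mem _)
  · intro z
    simpa using L.proj_seam hv (clamp_mem _)

theorem mem_Icc_div_height {z : ℂ} (h0 : 0 ≤ z.im) (h1 : z.im ≤ (L.cylinder hv).height) :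
    z.im / (L.cylinder hv).height ∈ Set.Icc (0 : ℝ) 1 :=
  ⟨div_nonneg h0 (L.cylinder hv).height_pos.le, (div_le_one (L.cylinder hv).height_pos).2 h1⟩

theorem param_eq_proj {z : ℂ} (hz : z ∈ π.parallelogram v) : L.param hv z = π.proj v z := by
  rw [L.parallelogram_eq hv] at hz
  obtain ⟨h1, h2⟩ := hz
  rw [param, clamp_eq (L.mem_Icc_div_height hv h2.1 h2.2)]
  rcases h1.2.lt_or_eq with h | h
  · rw [Int.fract_eq_self.2 ⟨h1.1, h⟩, ← L.eq_skew hv]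
  · conv_rhs => rw [L.eq_skew hv z]
    rw [h, Int.fract_one, ofReal_zero, zero_mul, zero_add, ofReal_one, one_mul]
    exact L.proj_seam hv (L.mem_Icc_div_height hv h2.1 h2.2)

theorem skew_add_mul_width (z : ℂ) (n : ℤ) :
    L.skew hv (z + n * (L.cylinder hv).width) = L.skew hv z + n := by
  have := L.skew_mul hv (n : ℝ) (L.cylinder hv).width
  rw [skew_width, mul_one] at this
  rw [skew_add]
  simpa using this

theorem param_add (z : ℂ) (n : ℤ) :
    L.param hv (z + n * (L.cylinder hv).width) = L.param hv z := by
  rw [param, param, skew_add_mul_width, Int.fract_add_intCast]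
  simp

theorem exists_add_mem {z : ℂ} (h0 : 0 ≤ z.im) (h1 : z.im ≤ (L.cylinder hv).height) :
    ∃ n : ℤ, z + n * (L.cylinder hv).width ∈ π.parallelogram v := by
  refine ⟨-⌊L.skew hv z⌋, ?_⟩
  rw [L.parallelogram_eq hv]
  refine ⟨?_, by simpa using ⟨h0, h1⟩⟩
  rw [skew_add_mul_width, Int.cast_neg, ← sub_eq_add_neg]
  exact ⟨Int.fract_nonneg _, (Int.fract_lt_one _).le⟩

/-- Both points can be moved by periods into the parallelogram, where `param` is the projection and
`fiberClass` respects the gluing. -/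
theorem fiberClass_eq_of_param_eq {z z' : ℂ} (h0 : 0 ≤ z.im) (h1 : z.im ≤ (L.cylinder hv).height)
    (h0' : 0 ≤ z'.im) (h1' : z'.im ≤ (L.cylinder hv).height) (h : L.param hv z = L.param hv z') :
    (L.cylinder hv).fiberClass z = (L.cylinder hv).fiberClass z' := by
  obtain ⟨n, hn⟩ := L.exists_add_mem hv h0 h1
  obtain ⟨n', hn'⟩ := L.exists_add_mem hv h0' h1'
  rw [← (L.cylinder hv).fiberClass_add z n, ← (L.cylinder hv).fiberClass_add z' n']
  apply TwoLines.eq_of_proj_eq _ (fun x y => L.fiberClass_eq_of_glue hv) hn hn'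
  rw [← L.param_eq_proj hv hn, ← L.param_eq_proj hv hn', param_add, param_add, h]

theorem pt_mem_parallelogram (e : α) {s : ℝ} (h0 : 0 ≤ s) (h1 : s ≤ L.len v e) :
    (L.cylinder hv).org e + (L.cylinder hv).sgn e * s ∈ π.parallelogram v := by
  have hl := (L.suspensionData hv).2.1 e
  set t : ℝ := s / L.len v e with ht
  have ht0 : 0 ≤ t := by positivity
  have ht1 : t ≤ 1 := by rw [ht, div_le_one hl]; exact h1
  have hs : t * L.len v e = s := by rw [ht]; field_simp
  have hc : Convex ℝ (π.parallelogram v) := convex_convexHull _ _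
  rcases L.mem e with he | he
  · have hi := L.exists_bot_getElem? he
    have a1 : π.botVertex v (L.lower.idxOf e) ∈ π.parallelogram v :=
      subset_convexHull _ _ (Or.inr ⟨_, rfl⟩)
    have a2 : π.botVertex v (L.lower.idxOf e) + v (L.sym e) ∈ π.parallelogram v :=
      subset_convexHull _ _ (Or.inr ⟨L.lower.idxOf e + 1, by
        simp [TwoLines.botVertex, List.take_add_one, hi]⟩)
    have := hc a1 a2 (sub_nonneg.2 ht1) ht0 (sub_add_cancel 1 t)
    rw [← hs, ← L.botVertex_add hv he]
    convert this using 1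
    simp only [real_smul]; push_cast; ring
  · have hi := L.exists_top_getElem? he
    have a1 : π.topVertex v (L.upper.length - L.upper.idxOf e) ∈ π.parallelogram v :=
      subset_convexHull _ _ (Or.inl ⟨_, rfl⟩)
    have a2 : π.topVertex v (L.upper.length - L.upper.idxOf e) + v (L.sym e) ∈ π.parallelogram v :=
      subset_convexHull _ _ (Or.inl ⟨L.upper.length - L.upper.idxOf e + 1, by
        simp [TwoLines.topVertex, List.take_add_one, hi]⟩)
    have := hc a1 a2 ht0 (sub_nonneg.2 ht1) (add_sub_cancel t 1)
    have e2 := L.topVertex_add hv he (1 - t)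
    rw [sub_sub_cancel, hs] at e2
    rw [← e2]
    convert this using 1
    simp only [real_smul]; push_cast; ring

/-- The surface as a cylinder with glued boundary. -/
def gluing [Finite α] : CylinderGluing α (π.Surface v) where
  toCylinderBoundary := L.cylinder hv
  param := L.param hv
  continuous_param := L.continuous_param hv
  isOpen_of U V hV h := by
    change IsOpen (Quotient.mk (π.glueSetoid v) ⁻¹' U)
    have : Quotient.mk (π.glueSetoid v) ⁻¹' U = Subtype.val ⁻¹' V := by
      ext ⟨z, hz⟩
      have hz' := hz
      rw [L.parallelogram_eq hv] at hz'
      have := h z hz'.2.1 hz'.2.2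
      rw [L.param_eq_proj hv hz, TwoLines.proj_of_mem hz] at this
      exact this.symm
    rw [this]
    exact hV.preimage continuous_subtype_val
  surj x := by
    obtain ⟨⟨z, hz⟩, rfl⟩ := Quotient.exists_rep x
    have hz' := hz
    rw [L.parallelogram_eq hv] at hz'
    exact ⟨z, hz'.2.1, hz'.2.2, by rw [L.param_eq_proj hv hz, TwoLines.proj_of_mem hz]⟩
  periodic z := by simpa using L.param_add hv z 1
  glue e s h0 h1 := by
    have hx := L.pt_mem_parallelogram hv e h0 h1
    have hy := L.pt_mem_parallelogram hv (L.mate e) (s := L.len v e - s) (sub_nonneg.2 h1)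
      (by rw [L.len_mate]; linarith)
    refine (L.param_eq_proj hv hx).trans (Eq.trans ?_ (L.param_eq_proj hv hy).symm)
    rcases L.glue_or_glue hv h0 h1 with h | h
    · exact TwoLines.proj_eq_of_glue hx hy h
    · exact (TwoLines.proj_eq_of_glue hy hx h).symm
  -- All three fibre conditions come from the fact that a point lies in its own class, which equals
  -- the class of any point with the same image.
  fiber_interior z z' h0 h1 h0' h1' h := by
    have := (L.cylinder hv).self_mem_fiberClass z'
    rwa [L.fiberClass_eq_of_param_eq hv h0' h1' h0.le h1.le h,
      (L.cylinder hv).fiberClass_of_interior h0 h1] at this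
  fiber_edge e s z hs0 hs1 h0 h1 h := by
    have hm := L.pt_mem_parallelogram hv e hs0.le hs1.le
    rw [L.parallelogram_eq hv] at hm
    have := (L.cylinder hv).self_mem_fiberClass z
    rwa [L.fiberClass_eq_of_param_eq hv h0 h1 hm.2.1 hm.2.2 h,
      (L.cylinder hv).fiberClass_pt hs0.le hs1, CylinderBoundary.edgeClass, if_neg hs0.ne'] at this
  fiber_vertex e z h0 h1 h := by
    have hm := L.pt_mem_parallelogram hv e le_rfl ((L.suspensionData hv).2.1 e).le
    rw [L.parallelogram_eq hv] at hm
    simp only [ofReal_zero, mul_zero, add_zero] at hm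
    have := (L.cylinder hv).self_mem_fiberClass z
    rw [L.fiberClass_eq_of_param_eq hv h0 h1 hm.2.1 hm.2.2 h,
      (L.cylinder hv).fiberClass_org, CylinderBoundary.edgeClass, if_pos rfl] at this
    obtain ⟨e', n, hc, hz⟩ := this
    obtain ⟨k, hk⟩ := hc.exists_nat_pow_eq
    exact ⟨k, n, by rw [hz, ← hk]⟩

variable [Finite α]

theorem isSuspension :
    letI := (L.gluing hv).chartedSpace
    π.IsSuspension v (L.gluing hv).quadraticDifferential := by
  let _ := (L.gluing hv).chartedSpace
  have hopen : interior (π.parallelogram v) ⊆ {z | 0 < z.im ∧ z.im < (L.cylinder hv).height} := by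
    have h1 : π.parallelogram v ⊆ {z | 0 ≤ z.im} ∩ {z | z.im ≤ (L.cylinder hv).height} := by
      rw [L.parallelogram_eq hv]
      exact fun z hz => hz.2
    have h2 := interior_mono h1
    rw [interior_inter, interior_setOfPred_le_im, interior_setOfPred_im_le] at h2
    exact h2
  refine QuadraticDifferential.IsFlatOn.congr (L.gluing hv).isFlatOn_param hopen fun z hz => ?_
  filter_upwards [isOpen_interior.mem_nhds hz] with w hw
  exact (L.param_eq_proj hv (interior_subset hw)).symm

end SuspensionLists

end

/-! ### Topology and stratum of a glued cylinder -/

noncomputable section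

open Complex

namespace CylinderGluing

variable {E S : Type*} [TopologicalSpace S] (G : CylinderGluing E S)

include G in
theorem compactSpace : CompactSpace S := by
  have hc : IsCompact (Set.Icc 0 G.width ×ℂ Set.Icc 0 G.height) := isCompact_Icc.reProdIm isCompact_Icc
  refine ⟨?_⟩
  convert hc.image G.continuous_param
  refine (Set.eq_univ_of_forall fun x => ?_).symm
  obtain ⟨z, h0, h1, rfl⟩ := G.surj x
  have hw := G.width_pos
  refine ⟨z + (-⌊z.re / G.width⌋ : ℤ) * G.width, ?_, G.param_add_int _ _⟩
  have h2 := Int.floor_le (z.re / G.width)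
  have h3 := Int.lt_floor_add_one (z.re / G.width)
  rw [le_div_iff₀ hw] at h2
  rw [div_lt_iff₀ hw] at h3
  rw [Complex.mem_reProdIm]
  refine ⟨⟨?_, ?_⟩, ?_, ?_⟩ <;> simp <;> linarith

include G in
theorem connectedSpace : ConnectedSpace S := by
  have hc : Convex ℝ {z : ℂ | 0 ≤ z.im ∧ z.im ≤ G.height} := by
    rintro x ⟨h1, h2⟩ y ⟨h3, h4⟩ a b ha hb hab
    simp only [Set.mem_ofPred_eq, real_smul, add_im, im_ofReal_mul]
    obtain rfl : b = 1 - a := by linarith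
    exact ⟨by positivity, by nlinarith⟩
  have h := hc.isPreconnected.image G.param G.continuous_param.continuousOn
  have : G.param '' {z : ℂ | 0 ≤ z.im ∧ z.im ≤ G.height} = Set.univ := by
    refine Set.eq_univ_of_forall fun x => ?_
    obtain ⟨z, h0, h1, rfl⟩ := G.surj x
    exact ⟨z, ⟨h0, h1⟩, rfl⟩
  rw [this] at h
  have := PreconnectedSpace.mk h
  exact ⟨⟨G.param 0⟩⟩

variable [Finite E]

/-- End points of edges correspond to cycles of `rot`, from each of which `rep` selects one edge.
All other points are regular, and a cycle of length m contributes the order m - 2. -/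
theorem inStratum {ι : Type*} [Fintype ι] (rep : ι → E) (κ : ι → ℤ)
    (hinj : ∀ i j, G.rot.SameCycle (rep i) (rep j) → i = j)
    (hsurj : ∀ e, ∃ i, G.rot.SameCycle (rep i) e)
    (hκ : ∀ i, (Function.minimalPeriod G.rot (rep i) : ℤ) = κ i + 2)
    {e : E} (he : G.sgn e = G.sgn (G.mate e)) :
    letI := G.chartedSpace
    G.quadraticDifferential.InStratum (Finset.univ.val.map κ) := by
  let _ := G.chartedSpace
  have hinj' : Function.Injective fun i => G.param (G.org (rep i)) := by
    intro i j hij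
    obtain ⟨k, n, hk⟩ := G.fiber_vertex (rep i) (G.org (rep j)) (G.org_mem_strip _).1
      (G.org_mem_strip _).2 hij.symm
    have := (G.pt_inj (rep j) ((G.rot ^ k) (rep i)) 0 0 n le_rfl (G.len_pos _) le_rfl (G.len_pos _)
      (by simpa using hk)).1
    exact hinj i j ⟨k, by rw [this]; rfl⟩
  refine ⟨G.compactSpace, G.connectedSpace, G.t2Space, G.not_isGlobalSquare he,
    Finset.univ.map ⟨_, hinj'⟩, ?_, ?_⟩
  · intro x hx
    refine G.order_of_notMem_vertices ?_
    rintro ⟨e', rfl⟩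
    obtain ⟨i, hi⟩ := hsurj e'
    obtain ⟨k, rfl⟩ := hi.exists_nat_pow_eq
    refine hx (Finset.mem_map.2 ⟨i, Finset.mem_univ _, ?_⟩)
    exact (G.param_org_rot_pow _ _).symm
  · rw [Finset.map_val, Multiset.map_map, Multiset.map_map]
    refine Multiset.map_congr rfl fun i _ => ?_
    have : (Function.minimalPeriod G.rot (rep i) : ℤ) - 2 = κ i := by rw [hκ]; ring
    exact (G.order_org (rep i)).trans (by rw [this]; rfl)

end CylinderGluing

/-! ### Permutations described by labels -/

section Labels

variable {ι : Type*} (m : ι → ℕ)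

/-- The label `b` follows `a` cyclically, the labels `(i, k)` being ordered by `k < m i`. -/
def IsNextLabel (a b : ι × ℕ) : Prop :=
  b.1 = a.1 ∧ (b.2 = a.2 + 1 ∨ b.2 = 0 ∧ a.2 + 1 = m a.1)

variable {m}

theorem IsNextLabel.left_unique {a b c : ι × ℕ} (ha : IsNextLabel m a c) (hb : IsNextLabel m b c) :
    a = b := by
  obtain ⟨a1, a2⟩ := a
  obtain ⟨b1, b2⟩ := b
  obtain ⟨h1, h2⟩ := ha
  obtain ⟨h3, h4⟩ := hb
  obtain rfl : a1 = b1 := h1.symm.trans h3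
  refine Prod.ext rfl ?_
  simp only at *
  omega

theorem IsNextLabel.right_unique {a b c : ι × ℕ} (hb : IsNextLabel m a b) (hc : IsNextLabel m a c)
    (hbm : b.2 < m b.1) (hcm : c.2 < m c.1) : b = c := by
  obtain ⟨b1, b2⟩ := b
  obtain ⟨c1, c2⟩ := c
  obtain ⟨h1, h2⟩ := hb
  obtain ⟨h3, h4⟩ := hc
  simp only at *
  subst h1 h3
  refine Prod.ext rfl ?_
  simp only at *
  omega

variable {α : Type*} {f : Equiv.Perm α} {lab : α → ι × ℕ} (hinj : Function.Injective lab)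
  (hlt : ∀ e, (lab e).2 < m (lab e).1) (hf : ∀ e, IsNextLabel m (lab (f e)) (lab e))

include hf in
-- Each application of `f` lowers the position by one, modulo the length of the cycle; working in
-- `ZMod` absorbs the passage from 0 to the last position.
theorem label_iterate (k : ℕ) (e : α) : (lab (f^[k] e)).1 = (lab e).1 ∧
    (((lab (f^[k] e)).2 + k : ℕ) : ZMod (m (lab e).1)) = (lab e).2 := by
  induction k with
  | zero => simp
  | succ k ih =>
    rw [Function.iterate_succ_apply']
    obtain ⟨h1, h2⟩ := hf (f^[k] e)
    refine ⟨h1.symm.trans ih.1, ?_⟩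
    rw [← ih.2]
    rcases h2 with h2 | ⟨h2, h3⟩
    · rw [h2]; congr 1; ring
    · rw [← h1, ih.1] at h3
      have : (lab (f (f^[k] e))).2 + (k + 1) = m (lab e).1 + k := by omega
      rw [this, h2]; simp

include hinj hlt hf

/-- By `label_iterate`, f^k fixes `e` exactly when the length of its cycle divides k. -/
theorem minimalPeriod_eq_of_label (e : α) : Function.minimalPeriod f e = m (lab e).1 := by
  apply Nat.dvd_antisymm
  · apply Function.IsPeriodicPt.minimalPeriod_dvd
    obtain ⟨h1, h2⟩ := label_iterate hf (m (lab e).1) e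
    refine hinj (Prod.ext h1 ?_)
    rw [ZMod.natCast_eq_natCast_iff] at h2
    have h3 : (lab (f^[m (lab e).1] e)).2 ≡ (lab e).2 [MOD m (lab e).1] := by
      simpa [Nat.ModEq] using h2
    have h4 := hlt (f^[m (lab e).1] e)
    rw [h1] at h4
    exact h3.eq_of_lt_of_lt h4 (hlt e)
  · obtain ⟨h1, h2⟩ := label_iterate hf (Function.minimalPeriod f e) e
    rw [Function.iterate_minimalPeriod] at h2
    rw [← ZMod.natCast_eq_zero_iff]
    simpa using h2

theorem sameCycle_iff_of_label [Finite α] {e e' : α} :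
    f.SameCycle e e' ↔ (lab e).1 = (lab e').1 := by
  constructor
  · intro h
    obtain ⟨k, rfl⟩ := h.exists_nat_pow_eq
    rw [← Equiv.Perm.iterate_eq_pow]
    exact (label_iterate hf k e).1.symm
  · intro h
    -- The number of steps down from the position of `e` to that of `e'`, with a full turn added so
    -- that the subtraction is not truncated.
    set k := (lab e).2 + (m (lab e).1 - (lab e').2) with hk
    have hlt' := hlt e'
    rw [← h] at hlt'
    obtain ⟨h1, h2⟩ := label_iterate hf k e
    refine ⟨k, ?_⟩
    rw [zpow_natCast, ← Equiv.Perm.iterate_eq_pow]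
    refine hinj (Prod.ext (h1.trans h) ?_)
    have h4 := hlt (f^[k] e)
    rw [h1] at h4
    have h5 : (lab (f^[k] e)).2 + k + (lab e').2 =
        (lab (f^[k] e)).2 + (lab e).2 + m (lab e).1 := by omega
    have h6 := congrArg (Nat.cast (R := ZMod (m (lab e).1))) h5
    push_cast at h6 h2
    rw [h2, ZMod.natCast_self, add_zero, add_comm] at h6
    have h7 := (ZMod.natCast_eq_natCast_iff _ _ _).1 (add_right_cancel h6)
    exact (h7.eq_of_lt_of_lt hlt' h4).symm

end Labels

/-- The permutation determined by labels such that every edge of the two lists is followed by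
the edge whose label is next to that of its mate. -/
theorem exists_perm_of_labels {α ι : Type*} [DecidableEq α] [Finite α] {m : ι → ℕ}
    {lab : α → ι × ℕ} (hinj : Function.Injective lab) {mate : α → α} (hmate : ∀ e, mate (mate e) = e)
    {lower upper : List α} {lowerHead upperHead : α} (lower_nodup : lower.Nodup)
    (upper_nodup : upper.Nodup) (mem : ∀ e, e ∈ lower ∨ e ∈ upper)
    (lower_head : lower.head? = some lowerHead) (upper_head : upper.head? = some upperHead)
    (hlt : ∀ e, (lab e).2 < m (lab e).1)
    (lower_chain : (lower ++ [lowerHead]).IsChain fun x y => IsNextLabel m (lab (mate x)) (lab y))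
    (upper_chain : (upper ++ [upperHead]).IsChain fun x y => IsNextLabel m (lab (mate x)) (lab y)) :
    ∃ rot : Equiv.Perm α, (∀ e, IsNextLabel m (lab (rot e)) (lab e)) ∧
      ∀ x y, IsNextLabel m (lab (mate x)) (lab y) → mate (rot y) = x := by
  -- The mate of the predecessor has the preceding label. Only the predecessor matters here, so all
  -- lengths are taken to be 0.
  have h : ∀ e, ∃ x, IsNextLabel m (lab x) (lab e) := by
    intro e
    rcases mem e with he | he
    · obtain ⟨x, -, hx, -⟩ := List.exists_cyclic_pred (len := fun _ => 0) lower_nodup lower_head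
        lower_chain he
      exact ⟨_, hx⟩
    · obtain ⟨x, -, hx, -⟩ := List.exists_cyclic_pred (len := fun _ => 0) upper_nodup upper_head
        upper_chain he
      exact ⟨_, hx⟩
  choose r hr using h
  have hri : Function.Injective r := by
    intro e e' he
    have h2 := hr e'
    rw [← he] at h2
    exact hinj ((hr e).right_unique h2 (hlt e) (hlt e'))
  refine ⟨Equiv.ofBijective r (Finite.injective_iff_bijective.1 hri), hr, fun x y hxy => ?_⟩
  have : r y = mate x := hinj ((hr y).left_unique hxy)
  rw [Equiv.ofBijective_apply, this, hmate]

/-! ### Cylindricity and existence of suspension vectors -/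

namespace SuspensionLists

variable {π : TwoLines} {α : Type*} [DecidableEq α] (L : SuspensionLists π α)

theorem count_sym {l : List α} (hl : l.Nodup) {e : α} (he : e ∈ l) (he' : L.mate e ∈ l) :
    (l.map L.sym).count (L.sym e) = 2 := by
  have hsub : (l.filter fun x => L.sym x = L.sym e).Perm [e, L.mate e] := by
    rw [List.perm_ext_iff_of_nodup (hl.filter _) (by simpa using (L.mate_ne e).symm)]
    intro x
    simp only [List.mem_filter, decide_eq_true_eq, List.mem_cons, List.not_mem_nil, or_false]
    constructor
    · rintro ⟨-, h⟩
      exact L.eq_or_eq_mate _ _ h.symm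
    · rintro (rfl | rfl)
      · exact ⟨he, rfl⟩
      · exact ⟨he', L.sym_mate e⟩
  have h2 := hsub.length_eq
  rw [List.count, List.countP_map, List.countP_eq_length_filter]
  simp only [Function.comp_def, beq_eq_decide]
  exact h2

theorem notMem_map_sym {l : List α} {e : α} (he : e ∉ l) (he' : L.mate e ∉ l) :
    L.sym e ∉ l.map L.sym := by
  rw [List.mem_map]
  rintro ⟨x, hx, hxe⟩
  rcases L.eq_or_eq_mate _ _ hxe.symm with rfl | rfl
  · exact he hx
  · exact he' hx

include L in
theorem isGeneralizedPermutation : π.IsGeneralizedPermutation := by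
  refine ⟨by simp [L.top_eq], by simp [L.bot_eq], fun a ha => ?_⟩
  have hp : (π.top ++ π.bot).Perm (L.seam :: L.seam :: (L.upper ++ L.lower).map L.sym) := by
    rw [L.top_eq, L.bot_eq, List.map_append, List.cons_append, ← List.append_assoc]
    refine List.Perm.cons _ ((List.perm_append_singleton _ _).trans (List.Perm.cons _ ?_))
    exact ((List.reverse_perm _).map _).append_right _
  rw [hp.count_eq]
  rw [hp.mem_iff] at ha
  have hne : L.seam ∉ (L.upper ++ L.lower).map L.sym := by
    rw [List.mem_map]
    rintro ⟨x, -, h⟩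
    exact L.sym_ne x h
  have hmem : ∀ e, e ∈ L.upper ++ L.lower := fun e => List.mem_append.2 (L.mem e).symm
  by_cases h : a = L.seam
  · subst h
    rw [List.count_cons_self, List.count_cons_self, List.count_eq_zero.2 hne]
  · simp only [List.mem_cons, h, false_or] at ha
    obtain ⟨e, -, rfl⟩ := List.mem_map.1 ha
    rw [List.count_cons_of_ne (Ne.symm h), List.count_cons_of_ne (Ne.symm h),
      L.count_sym (List.nodup_append.2 ⟨L.upper_nodup, L.lower_nodup,
        fun x hx y hy hxy => L.disjoint x (hxy ▸ hy) hx⟩) (hmem e) (hmem _)]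

variable {e₀ e₁ : α} (h₀ : e₀ ∈ L.lower) (h₀' : L.mate e₀ ∈ L.lower) (h₁ : e₁ ∈ L.upper)
  (h₁' : L.mate e₁ ∈ L.upper)
include h₀ h₀' h₁ h₁'

/-- A symbol that one line carries twice is missing from the other line; having one on each line
excludes both inclusions. -/
theorem isCylindrical : π.IsCylindrical := by
  have n₀ := L.notMem_map_sym (l := L.upper.reverse)
    (fun h => L.disjoint _ h₀ (List.mem_reverse.1 h)) (fun h => L.disjoint _ h₀' (List.mem_reverse.1 h))
  have n₁ := L.notMem_map_sym (l := L.lower)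
    (fun h => L.disjoint _ h h₁) (fun h => L.disjoint _ h h₁')
  refine ⟨L.isGeneralizedPermutation, Or.inl ?_, fun h => ?_, fun h => ?_⟩
  · simp [L.top_eq, L.bot_eq]
  · have : L.sym e₁ ∈ π.bot.toFinset := h.1 (by
      rw [L.top_eq]; simp only [List.mem_toFinset, List.mem_cons, List.mem_map, List.mem_reverse]
      exact Or.inr ⟨_, h₁, rfl⟩)
    rw [L.bot_eq, List.mem_toFinset, List.mem_append, List.mem_singleton] at this
    exact this.elim n₁ (L.sym_ne _)
  · have : L.sym e₀ ∈ π.top.toFinset := h.1 (by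
      rw [L.bot_eq]; simp only [List.mem_toFinset, List.mem_append, List.mem_map]
      exact Or.inl ⟨_, h₀, rfl⟩)
    rw [L.top_eq, List.mem_toFinset, List.mem_cons] at this
    exact this.elim (L.sym_ne _) n₀

/-- All lengths are 1 except for one symbol doubled on each line, whose length is half the number of
edges of the other line. The horizontal sides of either line then add up to |lower| + |upper| - 2.
-/
theorem exists_suspensionData : ∃ v, π.IsSuspensionData v := by
  set A := L.sym e₀
  set X := L.sym e₁
  set x : ℝ := L.upper.length / 2
  set y : ℝ := L.lower.length / 2
  have n₀ := L.notMem_map_sym (l := L.upper.reverse)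
    (fun h => L.disjoint _ h₀ (List.mem_reverse.1 h)) (fun h => L.disjoint _ h₀' (List.mem_reverse.1 h))
  have n₁ := L.notMem_map_sym (l := L.lower)
    (fun h => L.disjoint _ h h₁) (fun h => L.disjoint _ h h₁')
  have hAX : A ≠ X := fun h => n₁ (by
    change X ∈ _
    rw [← h]
    exact List.mem_map_of_mem h₀)
  have hx : 0 < x := by
    have := List.length_pos_of_mem h₁
    positivity
  have hy : 0 < y := by
    have := List.length_pos_of_mem h₀
    positivity
  let r : ℕ → ℝ := fun a => if a = A then x else if a = X then y else 1
  have hr : ∀ a, 0 < r a := by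
    intro a; simp only [r]; split_ifs <;> positivity
  refine ⟨fun a => if a = L.seam then I else r a, L.seam, Or.inl ⟨by simp [L.top_eq],
    by simp [L.bot_eq], by simp⟩, fun b _ hb => by simp [hb, hr b], ?_⟩
  have key : ∀ l : List ℕ, L.seam ∉ l →
      (l.map fun a => if a = L.seam then I else (r a : ℂ)).sum =
        l.length + (x - 1) * l.count A + (y - 1) * l.count X := by
    intro l hl
    induction l with
    | nil => simp
    | cons a l ih =>
      rw [List.mem_cons, not_or] at hl
      rw [List.map_cons, List.sum_cons, ih hl.2, if_neg (Ne.symm hl.1), List.length_cons,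
        List.count_cons, List.count_cons]
      by_cases h1 : a = A
      · subst h1
        simp [r, hAX]; ring
      · by_cases h2 : a = X
        · subst h2
          simp [r, hAX.symm]; ring
        · simp [r, h1, h2]; ring
  have hs : ∀ l : List α, L.seam ∉ l.map L.sym := by
    intro l h
    obtain ⟨e, -, he⟩ := List.mem_map.1 h
    exact L.sym_ne e he
  rw [L.top_eq, L.bot_eq, List.map_cons, List.sum_cons, List.map_append, List.sum_append,
    key _ (hs _), key _ (hs _), L.count_sym L.lower_nodup h₀ h₀', List.count_eq_zero.2 n₁,
    L.count_sym (List.nodup_reverse.2 L.upper_nodup) (List.mem_reverse.2 h₁)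
      (List.mem_reverse.2 h₁'), List.count_eq_zero.2 n₀]
  simp [x, y]
  ring

end SuspensionLists

end

noncomputable section

/-! ### Blocks of consecutive integers -/

/-- The division of `0, …, N - 1` into `n` blocks of consecutive integers; the block `j` is
`start j, …, start (j + 1) - 1`. -/
structure Blocks (N n : ℕ) where
  start : ℕ → ℕ
  blk : ℕ → ℕ
  start_zero : start 0 = 0
  start_lt : ∀ j < n, start j < start (j + 1)
  start_le : ∀ j < n, start (j + 1) ≤ N
  blk_lt : ∀ i < N, blk i < n
  start_blk_le : ∀ i < N, start (blk i) ≤ i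
  lt_start_blk : ∀ i < N, i < start (blk i + 1)
  blk_eq : ∀ i j, j < n → start j ≤ i → i < start (j + 1) → blk i = j

theorem List.exists_blocks (l : List ℕ) (hd : ∀ k ∈ l, 1 ≤ k) :
    ∃ B : Blocks l.sum l.length, B.start = fun j => (l.take j).sum := by
  set S : ℕ → ℕ := fun j => (l.take j).sum with hS
  have hsucc : ∀ j (h : j < l.length), S (j + 1) = S j + l[j] := by
    intro j h
    simp only [hS]
    rw [List.take_succ_eq_append_getElem h, List.sum_append]
    simp
  have hlt : ∀ j < l.length, S j < S (j + 1) := by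
    intro j h
    have := hd _ (List.getElem_mem h)
    rw [hsucc j h]; omega
  have hmono : Monotone S := by
    refine monotone_nat_of_le_succ fun j => ?_
    by_cases h : j < l.length
    · exact (hlt j h).le
    · simp only [hS]
      rw [List.take_of_length_le (by omega), List.take_of_length_le (by omega)]
  have hlast : S l.length = l.sum := by simp [hS]
  have hex : ∀ i, ∃ j, i < l.sum → j < l.length ∧ S j ≤ i ∧ i < S (j + 1) := by
    intro i
    by_cases hi : i < l.sum
    · have hfind : ∃ j, i < S (j + 1) := ⟨l.length, hi.trans_le (hlast.ge.trans (hmono (by omega)))⟩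
      refine ⟨Nat.find hfind, fun _ => ⟨?_, ?_, Nat.find_spec hfind⟩⟩
      · by_contra h
        have hpos : 0 < l.length := by
          by_contra h0
          have : l = [] := List.length_eq_zero_iff.1 (by omega)
          simp [this] at hi
        have := Nat.find_min hfind (m := l.length - 1) (by omega)
        rw [Nat.sub_add_cancel hpos, hlast] at this
        exact this hi
      · rcases hk : Nat.find hfind with _ | k
        · simp [hS]
        · have := Nat.find_min hfind (m := k) (by omega)
          omega
    · exact ⟨0, fun h => absurd h hi⟩
  choose blk hblk using hex
  refine ⟨⟨S, blk, by simp [hS], hlt, fun j hj => hlast ▸ hmono hj, fun i hi => (hblk i hi).1,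
    fun i hi => (hblk i hi).2.1, fun i hi => (hblk i hi).2.2, ?_⟩, rfl⟩
  intro i j hj h1 h2
  have hi : i < l.sum := h2.trans_le (hlast ▸ hmono hj)
  obtain ⟨h3, h4, h5⟩ := hblk i hi
  rcases lt_trichotomy (blk i) j with h | h | h
  · have := hmono (show blk i + 1 ≤ j from h); omega
  · exact h
  · have := hmono (show j + 1 ≤ blk i from h); omega

namespace Blocks

variable {N n : ℕ} (B : Blocks N n)

/-- The first element of the block of `i`. -/
def lo (i : ℕ) : ℕ := B.start (B.blk i)

/-- The first element after the block of `i`. -/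
def hi (i : ℕ) : ℕ := B.start (B.blk i + 1)

theorem lo_le {i : ℕ} (h : i < N) : B.lo i ≤ i := B.start_blk_le i h

theorem lt_hi {i : ℕ} (h : i < N) : i < B.hi i := B.lt_start_blk i h

theorem hi_le {i : ℕ} (h : i < N) : B.hi i ≤ N := B.start_le _ (B.blk_lt i h)

theorem lo_congr {i j : ℕ} (h : B.blk i = B.blk j) : B.lo i = B.lo j := by rw [lo, lo, h]

theorem hi_congr {i j : ℕ} (h : B.blk i = B.blk j) : B.hi i = B.hi j := by rw [hi, hi, h]

theorem blk_pred {i : ℕ} (h : i < N) (h' : B.lo i ≠ i) : B.blk (i - 1) = B.blk i := by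
  have h1 := B.lo_le h
  have h2 := B.lt_hi h
  exact B.blk_eq _ _ (B.blk_lt i h) (show B.lo i ≤ i - 1 by omega) (show i - 1 < B.hi i by omega)

/-- If the block of i - 1 extended beyond i, it would contain i, which by assumption starts a block.
-/
theorem hi_pred {i : ℕ} (h0 : 0 < i) (h : i < N) (h' : B.lo i = i) : B.hi (i - 1) = i := by
  have h1 : B.lo (i - 1) ≤ i - 1 := B.lo_le (by omega)
  have h2 : i - 1 < B.hi (i - 1) := B.lt_hi (by omega)
  by_contra hne
  have := B.blk_eq i (B.blk (i - 1)) (B.blk_lt _ (by omega)) (show B.lo (i - 1) ≤ i by omega)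
    (show i < B.hi (i - 1) by omega)
  have := B.lo_congr this
  omega

theorem hi_last (h : 0 < N) : B.hi (N - 1) = N := by
  have h1 : N - 1 < B.hi (N - 1) := B.lt_hi (by omega)
  have h2 : B.hi (N - 1) ≤ N := B.hi_le (by omega)
  omega

theorem lo_zero (h : 0 < N) : B.lo 0 = 0 := Nat.le_zero.1 (B.lo_le h)

theorem blk_start {j : ℕ} (h : j < n) : B.blk (B.start j) = j :=
  B.blk_eq _ _ h le_rfl (B.start_lt j h)

theorem blk_zero (h : 0 < N) : B.blk 0 = 0 := by
  have hn : 0 < n := (Nat.zero_le _).trans_lt (B.blk_lt 0 h)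
  have := B.blk_start hn
  rwa [B.start_zero] at this

end Blocks

/-! ### Erasing entries of a chain -/

/-- If the erased entries of a chain are skipped, then consecutive entries of the remaining list are
related, `P` being the value at the first remaining entry. -/
theorem List.IsChain.filter_of_skip {α β : Type*} {p : α → Bool} {R : α → β → Prop} {P f : α → β}
    (hP : ∀ x, p x → P x = f x) {l : List α}
    (h : l.IsChain fun x y => (p x → R x (P y)) ∧ (¬ p x → P x = P y)) :
    (l.filter p).IsChain fun x y => R x (f y) := by
  -- The induction also records that `P` at the head of the list, erased or not, is the value of `f`
  -- at the first remaining entry.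
  suffices H : (l.filter p).IsChain (fun x y => R x (f y)) ∧
      ∀ a ∈ l.head?, ∀ y ∈ (l.filter p).head?, P a = f y from H.1
  induction l with
  | nil => simp
  | cons a l ih =>
    rw [List.isChain_cons] at h
    obtain ⟨ih1, ih2⟩ := ih h.2
    by_cases ha : p a
    · rw [List.filter_cons_of_pos ha]
      refine ⟨List.isChain_cons.2 ⟨fun y hy => ?_, ih1⟩, by simpa using hP a ha⟩
      cases l with
      | nil => simp at hy
      | cons b l =>
        rw [← ih2 b (by simp) y hy]
        exact (h.1 b (by simp)).1 ha
    · rw [List.filter_cons_of_neg ha]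
      refine ⟨ih1, fun a' ha' y hy => ?_⟩
      obtain rfl : a = a' := by simpa using ha'
      cases l with
      | nil => simp at hy
      | cons b l =>
        rw [← ih2 b (by simp) y hy]
        exact (h.1 b (by simp)).2 ha

/-! ### The sides of the explicit permutation -/

/-- The sides of the suspension. The symbol `i ≤ 4g - 4 + p` is carried by `t i` on the top line and
by `b i` on the bottom line; the other symbols are carried by two sides of the same line, one of which
is a `c i`. -/
inductive Side
  | t (i : ℕ)
  | b (i : ℕ)
  | c (i : ℕ)
  | z (l : ℕ)
  deriving DecidableEq

namespace Side

/-- The other side with the same symbol. -/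
def mate (g : ℕ) : Side → Side
  | t i => b i
  | b i => t i
  | c i => if i < 4 * g - 4 then (if i % 4 < 2 then c (i + 2) else c (i - 2)) else z (i - (4 * g - 4))
  | z l => c (4 * g - 4 + l)

theorem mate_mate {g : ℕ} (hg : 1 ≤ g) (e : Side) : mate g (mate g e) = e := by
  cases e with
  | t i => rfl
  | b i => rfl
  | c i =>
    simp only [mate]
    split_ifs with h1 h2
    · dsimp only
      rw [if_pos (by omega), if_neg (by omega), Nat.add_sub_cancel]
    · dsimp only
      rw [if_pos (by omega), if_pos (by omega), Nat.sub_add_cancel (by omega)]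
    · dsimp only
      rw [Nat.add_sub_cancel' (by omega)]
  | z l =>
    simp only [mate]
    rw [if_neg (by omega), Nat.add_sub_cancel_left]

theorem mate_ne (g : ℕ) (e : Side) : mate g e ≠ e := by
  cases e with
  | t i => simp [mate]
  | b i => simp [mate]
  | c i =>
    simp only [mate]
    split_ifs with h1 h2
    · simp
    · simp; omega
    · simp
  | z l => simp [mate]

/-- The symbol of a side. -/
def sym (g p : ℕ) : Side → ℕ
  | t i => i
  | b i => i
  | c i => if i < 4 * g - 4 then 4 * g - 3 + p + 2 * (i / 4) + i % 2
      else 6 * g + p - 5 + (i - (4 * g - 4))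
  | z l => 6 * g + p - 5 + l

theorem sym_mate {g : ℕ} (hg : 1 ≤ g) (p : ℕ) (e : Side) : sym g p (mate g e) = sym g p e := by
  cases e with
  | t i => rfl
  | b i => rfl
  | c i =>
    simp only [mate]
    split_ifs with h1 h2
    · simp only [sym]
      rw [if_pos (by omega), if_pos h1]; omega
    · simp only [sym]
      rw [if_pos (by omega), if_pos h1]; omega
    · simp only [sym]
      rw [if_neg h1]
  | z l =>
    simp only [mate, sym]
    rw [if_neg (by omega)]; omega

/-- The sides of the suspension over the explicit permutation. -/
def Valid (g p : ℕ) : Side → Prop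
  | t i => 1 ≤ i ∧ i ≤ 4 * g + p - 4
  | b i => 1 ≤ i ∧ i ≤ 4 * g + p - 4
  | c i => i < 4 * g + p - 4
  | z l => l < p

theorem valid_mate {g p : ℕ} (hg : 1 ≤ g) {e : Side} (he : Valid g p e) : Valid g p (mate g e) := by
  cases e with
  | t i => exact he
  | b i => exact he
  | c i =>
    simp only [Valid] at he
    simp only [mate]
    split_ifs with h1 h2 <;> simp only [Valid] <;> omega
  | z l =>
    simp only [Valid] at he
    simp only [mate, Valid]; omega

/-- The three kinds of symbols occupy disjoint ranges: up to 4g + p - 4, from 4g + p - 3 to 6g + p -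
6, and from 6g + p - 5 on. Within each range the symbol determines the pair. -/
theorem eq_or_eq_mate {g p : ℕ} (hg : 3 ≤ g) {e e' : Side} (he : Valid g p e) (he' : Valid g p e')
    (h : sym g p e = sym g p e') : e' = e ∨ e' = mate g e := by
  cases e with
  | t i =>
    cases e' with
    | t i' => left; simpa [sym, eq_comm] using h
    | b i' => right; simpa [sym, mate, eq_comm] using h
    | c i' =>
      simp only [Valid, sym] at *
      split_ifs at h <;> omega
    | z l' => simp only [Valid, sym] at *; omega
  | b i =>
    cases e' with
    | t i' => right; simpa [sym, mate, eq_comm] using h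
    | b i' => left; simpa [sym, eq_comm] using h
    | c i' =>
      simp only [Valid, sym] at *
      split_ifs at h <;> omega
    | z l' => simp only [Valid, sym] at *; omega
  | c i =>
    cases e' with
    | t i' =>
      simp only [Valid, sym] at *
      split_ifs at h <;> omega
    | b i' =>
      simp only [Valid, sym] at *
      split_ifs at h <;> omega
    | c i' =>
      simp only [Valid, sym, mate] at *
      split_ifs at h ⊢ <;> simp only [c.injEq, or_false] <;> omega
    | z l' =>
      simp only [Valid, sym, mate] at *
      split_ifs at h ⊢ <;> simp only [z.injEq, false_or] <;> omega
  | z l =>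
    cases e' with
    | t i' => simp only [Valid, sym] at *; omega
    | b i' => simp only [Valid, sym] at *; omega
    | c i' =>
      simp only [Valid, sym, mate] at *
      split_ifs at h <;> simp only [c.injEq, reduceCtorEq, false_or] <;> omega
    | z l' => left; simp only [sym] at h; rw [z.injEq]; omega

end Side

end

/-! ### The cyclic order of the sides around each singularity -/

noncomputable section

namespace Blocks

variable {N n : ℕ} (B : Blocks N n)

/-- The number of elements of the block of `i` that are at most `3`. -/
def low (i : ℕ) : ℕ := min 4 (B.hi i) - B.lo i

/-- The lengths of the cycles. -/
def size : ℕ ⊕ ℕ → ℕ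
  | .inl j => B.start (j + 1) - B.start j + 2
  | .inr _ => 1

/-- The position of a side in the cycle of the sides starting at the same singularity. -/
def lab : Side → (ℕ ⊕ ℕ) × ℕ
  | .t i => (.inl (B.blk (if i = N then 0 else i)), 0)
  | .b i => (.inl (B.blk (i - 1)), B.low (i - 1) + 1)
  | .c i => (.inl (B.blk i), if i ≤ 3 then i - B.lo i + 1 else B.hi i + 1 - i + B.low i)
  | .z l => (.inr l, 0)

/-- The sides that are not erased. -/
def Keep : Side → Prop
  | .t i => i = N ∨ B.lo i = i
  | .b i => i = N ∨ B.lo i = i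
  | .c _ => True
  | .z _ => True

instance : DecidablePred B.Keep := fun e => by
  cases e <;> unfold Keep <;> infer_instance

/-- The label of the first side after a given one that is not erased. -/
def lead : Side → (ℕ ⊕ ℕ) × ℕ
  | .t i => if i = N ∨ B.lo i = i ∨ i ≤ 4 then B.lab (.t i) else B.lab (.c (i - 1))
  | .b i => if 4 ≤ i ∨ B.lo i = i then B.lab (.b i) else B.lab (.c i)
  | .c i => B.lab (.c i)
  | .z l => B.lab (.z l)

theorem low_congr {i j : ℕ} (h : B.blk i = B.blk j) : B.low i = B.low j := by
  rw [low, low, B.lo_congr h, B.hi_congr h]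

theorem size_blk (i : ℕ) : B.size (.inl (B.blk i)) = B.hi i - B.lo i + 2 := rfl

theorem lead_eq_lab (hN : 8 ≤ N) {e : Side} (he : B.Keep e) : B.lead e = B.lab e := by
  cases e with
  | t i => exact if_pos (he.imp_right Or.inl)
  | b i => exact if_pos (he.imp_left (by omega))
  | c i => rfl
  | z l => rfl

/-- Around the singularity of a block come the side `t`, the `c i` with i ≤ 3 in increasing order,
the side `b`, and the `c i` with i ≥ 4 in decreasing order. With one `c i` for each element of the
block this makes hi - lo + 2 positions. A pole has a single one. -/
theorem lab_lt (g p : ℕ) (hN : N = 4 * g + p - 4) {e : Side} (he : e.Valid g p) :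
    (B.lab e).2 < B.size (B.lab e).1 := by
  cases e with
  | t i => simp [lab, size]
  | b i =>
    simp only [Side.Valid] at he
    have h1 := B.lo_le (i := i - 1) (by omega)
    have h2 := B.lt_hi (i := i - 1) (by omega)
    simp only [lab, size_blk, low]; omega
  | c i =>
    simp only [Side.Valid] at he
    have h1 := B.lo_le (i := i) (by omega)
    have h2 := B.lt_hi (i := i) (by omega)
    simp only [lab, size_blk, low]
    split_ifs <;> omega
  | z l => simp [lab, size]

/-- The positions of `t`, of the low `c i`, of `b` and of the high `c i` are in disjoint ranges. A
block has only one kept `t`, that of its first element (`t N` standing for `t 0`), and only one kept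
`b`, at the end of the block. -/
theorem lab_injective (g p : ℕ) (hN : N = 4 * g + p - 4) {e e' : Side}
    (he : e.Valid g p) (he' : e'.Valid g p) (hk : B.Keep e) (hk' : B.Keep e')
    (h : B.lab e = B.lab e') : e = e' := by
  wlog hw : e.ctorIdx ≤ e'.ctorIdx generalizing e e'
  · exact (this he' he hk' hk h.symm (le_of_not_ge hw)).symm
  cases e with
  | t i =>
    cases e' with
    | t i' =>
      simp only [lab, Prod.mk.injEq, Sum.inl.injEq, and_true, Side.Valid, Keep] at *
      have h1 := B.lo_congr h
      have h0 := B.lo_zero (by omega)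
      rw [Side.t.injEq]
      split_ifs at h1 <;> omega
    | b i' => simp [lab] at h
    | c i' =>
      simp only [lab, Prod.mk.injEq, Side.Valid] at *
      have h2 := B.lt_hi (i := i') (by omega)
      have := h.2
      split_ifs at this; omega
    | z l' => simp [lab] at h
  | b i =>
    cases e' with
    | t i' => simp [lab] at h
    | b i' =>
      simp only [lab, Prod.mk.injEq, Sum.inl.injEq, Side.Valid, Keep] at *
      have key : ∀ i, 1 ≤ i → i ≤ N → (i = N ∨ B.lo i = i) → B.hi (i - 1) = i := by
        rintro i h1 h2 h3
        rcases h2.eq_or_lt with rfl | h2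
        · exact B.hi_last (by omega)
        · exact B.hi_pred (by omega) h2 (by omega)
      rw [Side.b.injEq, ← key i (by omega) (by omega) hk, ← key i' (by omega) (by omega) hk',
        B.hi_congr h.1]
    | c i' =>
      simp only [lab, Prod.mk.injEq, Sum.inl.injEq, Side.Valid] at *
      have h1 := B.lo_le (i := i') (by omega)
      have h2 := B.lt_hi (i := i') (by omega)
      have h3 := h.2
      rw [B.low_congr h.1] at h3
      unfold low at h3
      split_ifs at h3 <;> omega
    | z l' => simp [lab] at h
  | c i =>
    cases e' with
    | t i' => simp [Side.ctorIdx] at hw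
    | b i' => simp [Side.ctorIdx] at hw
    | c i' =>
      simp only [lab, Prod.mk.injEq, Sum.inl.injEq, Side.Valid] at *
      have h1 := B.lo_le (i := i') (by omega)
      have h2 := B.lt_hi (i := i') (by omega)
      have h1' := B.lo_le (i := i) (by omega)
      have h2' := B.lt_hi (i := i) (by omega)
      have h3 := h.2
      rw [Side.c.injEq]
      rw [B.low_congr h.1, B.lo_congr h.1, B.hi_congr h.1] at h3
      rw [B.lo_congr h.1] at h1'
      rw [B.hi_congr h.1] at h2'
      unfold low at h3
      split_ifs at h3 <;> omega
    | z l' => simp [lab] at h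
  | z l =>
    cases e' with
    | z l' => simpa [lab] using h
    | _ => simp [lab] at h

/-- Two consecutive sides of the boundary of the cylinder. -/
def Step (g : ℕ) (x y : Side) : Prop :=
  (B.Keep x → IsNextLabel B.size (B.lab (x.mate g)) (B.lead y)) ∧ (¬ B.Keep x → B.lead x = B.lead y)

section Steps

variable {g : ℕ} {i : ℕ}

theorem hi_pred_of_keep (h0 : 0 < i) (h : i ≤ N) (hk : i = N ∨ B.lo i = i) : B.hi (i - 1) = i := by
  rcases h.eq_or_lt with rfl | h
  · exact B.hi_last h0
  · exact B.hi_pred h0 h (by omega)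

/-- In the decreasing part of the cycle `c i` is followed by `c (i - 1)`, unless i starts its block
or i = 4; then `c i` has the last position and is followed by position 0. -/
theorem next_lab_c_lead_t (h4 : 4 ≤ i) (hN : i < N) :
    IsNextLabel B.size (B.lab (.c i)) (B.lead (.t i)) := by
  have h1 := B.lo_le hN
  have h2 := B.lt_hi hN
  simp only [lead]
  split_ifs with h
  · simp only [lab, if_neg hN.ne, if_neg (show ¬ i ≤ 3 by omega)]
    refine ⟨rfl, Or.inr ⟨rfl, ?_⟩⟩
    simp only [size_blk, low]
    omega
  · have hb := B.blk_pred hN (by omega)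
    simp only [lab, if_neg (show ¬ i ≤ 3 by omega), if_neg (show ¬ i - 1 ≤ 3 by omega)]
    refine ⟨by simp only [hb], Or.inl ?_⟩
    simp only [B.hi_congr hb, B.low_congr hb]
    omega

/-- In the increasing part of the cycle `c i` is followed by `c (i + 1)`, unless the block ends with
i or i = 3; then the position of `b` follows. -/
theorem next_lab_c_lead_b (h3 : i ≤ 3) (hN : 8 ≤ N) :
    IsNextLabel B.size (B.lab (.c i)) (B.lead (.b (i + 1))) := by
  have h1 := B.lo_le (i := i) (by omega)
  have h2 := B.lt_hi (i := i) (by omega)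
  have h1' := B.lo_le (i := i + 1) (by omega)
  simp only [lead]
  split_ifs with h
  · simp only [lab, if_pos h3, Nat.add_sub_cancel]
    refine ⟨rfl, Or.inl ?_⟩
    have hhi : i = 3 ∨ B.hi i = i + 1 := by
      rcases h with h | h
      · left; omega
      · right; exact B.hi_pred (Nat.succ_pos i) (by omega) h
    simp only [low]
    omega
  · have hb := B.blk_pred (i := i + 1) (by omega) (by omega)
    rw [Nat.add_sub_cancel] at hb
    simp only [lab, if_pos h3, if_pos (show i + 1 ≤ 3 by omega)]
    refine ⟨by simp only [hb], Or.inl ?_⟩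
    simp only [← B.lo_congr hb]
    omega

theorem step_of_mate_eq_c {x : Side} {y : Side} (hx : B.Keep x) (hm : x.mate g = .c i)
    (h : IsNextLabel B.size (B.lab (.c i)) (B.lead y)) : B.Step g x y :=
  ⟨fun _ => by rwa [hm], fun h => absurd hx h⟩

/-- The mate `b i` of a kept `t i` is followed by the decreasing part of its cycle, which `c (i -
1)` opens as the last `c` of the block ending at i. -/
theorem step_t_c (h5 : 5 ≤ i) (hN : i ≤ N) : B.Step g (.t i) (.c (i - 1)) := by
  refine ⟨fun hk => ?_, fun hk => ?_⟩
  · have hh := B.hi_pred_of_keep (by omega) hN hk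
    simp only [Side.mate, lead, lab, if_neg (show ¬ i - 1 ≤ 3 by omega)]
    refine ⟨rfl, Or.inl ?_⟩
    simp only [hh]
    omega
  · simp only [Keep, not_or] at hk
    simp only [lead]
    rw [if_neg (by omega)]

/-- A block ending at i ≤ 4 has no decreasing part, so `b i` is last in the cycle and position 0
follows. After `t 1` the upper component continues with `t N`, which starts at the zero 0. -/
theorem step_t_t (h0 : 1 ≤ i) (h4 : i ≤ 4) (hN : 8 ≤ N) :
    B.Step g (.t i) (.t (if i = 1 then N else i - 1)) := by
  have hlead : B.lead (.t (if i = 1 then N else i - 1)) = (.inl (B.blk (i - 1)), 0) := by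
    simp only [lead]
    rw [if_pos (by split_ifs <;> omega)]
    simp only [lab]
    congr 3
    split_ifs <;> omega
  rw [Step, hlead]
  refine ⟨fun hk => ?_, fun hk => ?_⟩
  · have hh := B.hi_pred_of_keep (by omega) (by omega) hk
    have h1 := B.lo_le (i := i - 1) (by omega)
    simp only [Side.mate, lab]
    refine ⟨rfl, Or.inr ⟨rfl, ?_⟩⟩
    simp only [size_blk, low, hh]
    omega
  · simp only [Keep, not_or] at hk
    simp only [lead]
    rw [if_pos (by omega), lab, if_neg (by omega), B.blk_pred (by omega) hk.2]

theorem step_b_c (h0 : 1 ≤ i) (h3 : i ≤ 3) (hN : 8 ≤ N) : B.Step g (.b i) (.c i) := by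
  refine ⟨fun hk => ?_, fun hk => ?_⟩
  · simp only [Keep, show i ≠ N by omega, false_or] at hk
    simp only [Side.mate, lead, lab, if_neg (show i ≠ N by omega), if_pos h3]
    exact ⟨rfl, Or.inl (by simp only [hk]; omega)⟩
  · simp only [Keep, not_or] at hk
    simp only [lead]
    rw [if_neg (by omega)]

/-- A block that starts at i ≥ 4 has no increasing part, so `t i` is followed at once by the side
`b` of the block. If `b i` is erased, then i - 1 and i are in one block and the expected label stays
the same. -/
theorem step_b_b (h4 : 4 ≤ i) (hN : i < N) : B.Step g (.b i) (.b (i + 1)) := by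
  have hlead : ∀ j, 4 ≤ j → B.lead (.b j) = (.inl (B.blk (j - 1)), B.low (j - 1) + 1) :=
    fun j hj => if_pos (Or.inl hj)
  rw [Step, hlead _ h4, hlead _ (by omega), Nat.add_sub_cancel]
  refine ⟨fun hk => ?_, fun hk => ?_⟩
  · simp only [Keep, hN.ne, false_or] at hk
    simp only [Side.mate, lab, if_neg hN.ne]
    refine ⟨rfl, Or.inl ?_⟩
    simp only [low, hk]
    omega
  · simp only [Keep, not_or] at hk
    have hb := B.blk_pred hN hk.2
    rw [hb, B.low_congr hb]

theorem step_b_last : B.Step g (.b N) (.c 0) := by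
  refine ⟨fun _ => ?_, fun hk => absurd (Or.inl rfl) hk⟩
  simp only [Side.mate, lead, lab, if_true, if_pos (Nat.zero_le 3)]
  exact ⟨rfl, Or.inl (by simp)⟩

end Steps

end Blocks

end

/-! ### The two boundary words of the explicit permutation -/

noncomputable section

/-- A list composed of blocks, each of which continues to the first entry of the next one, is a
chain. -/
theorem List.isChain_flatMap_range {α : Type*} {R : α → α → Prop} {l : List α} {V : ℕ → List α}
    {f : ℕ → α} {n : ℕ} (h0 : (l ++ [f 0]).IsChain R)
    (hV : ∀ k < n, (f k :: V k ++ [f (k + 1)]).IsChain R) :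
    (l ++ (List.range n).flatMap (fun k => f k :: V k) ++ [f n]).IsChain R := by
  induction n with
  | zero => simpa using h0
  | succ n ih =>
    have h1 := ih fun k hk => hV k (hk.trans (Nat.lt_succ_self n))
    have h2 := hV n (Nat.lt_succ_self n)
    have h3 := List.IsChain.append_overlap (l₂ := [f n]) (l₃ := V n ++ [f (n + 1)]) h1
      (by simpa using h2) (by simp)
    rw [List.range_succ, List.flatMap_append]
    simpa using h3

/-- The function `r` recovers from an entry the index of its word, so different words are disjoint.
-/
theorem List.nodup_flatMap_range {α : Type*} {V : ℕ → List α} {n : ℕ} (r : α → ℕ)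
    (hV : ∀ k, (V k).Nodup) (hr : ∀ k, ∀ x ∈ V k, r x = k) : ((List.range n).flatMap V).Nodup := by
  rw [List.nodup_flatMap]
  refine ⟨fun k _ => hV k, List.nodup_range.imp fun {i j} hij => ?_⟩
  intro x hx hx'
  exact hij ((hr i x hx).symm.trans (hr j x hx'))

namespace Side

/-- The sides of the bottom line from left to right. -/
def lowerSides (g p : ℕ) : List Side :=
  [c 0, b 3, c 3, b 2, c 2, b 1, c 1] ++
    (List.range (4 * g + p - 4 - 4)).flatMap (fun k => [b (4 + k)]) ++ [b (4 * g + p - 4)]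

/-- The sides of the word `V(k)`. -/
def sidesV (k : ℕ) : List Side :=
  [t (4 + 4 * k), c (6 + 4 * k), t (7 + 4 * k), c (5 + 4 * k), t (6 + 4 * k), c (4 + 4 * k),
    t (5 + 4 * k), c (7 + 4 * k)]

/-- The sides of the word `W(l)`. -/
def sidesW (g l : ℕ) : List Side := [t (4 * g - 4 + l), z l, c (4 * g - 4 + l)]

/-- The horizontal sides of the top line from left to right. -/
def topSides (g p : ℕ) : List Side :=
  [t 1, t 2, t 3] ++ (List.range (g - 2)).flatMap sidesV ++ (List.range p).flatMap (sidesW g) ++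
    [t (4 * g + p - 4)]

variable {g p : ℕ} (hg : 3 ≤ g)
include hg

theorem map_sym_lowerSides :
    (lowerSides g p).map (sym g p) ++ [0] = (explicitPerm g p).bot := by
  have h1 : List.Ico 4 (4 * g - 4 + p + 1) =
      (List.range (4 * g + p - 4 - 4)).map (fun k => 4 + k) ++ [4 * g + p - 4] := by
    have : 4 * g - 4 + p + 1 - 4 = 4 * g + p - 4 - 4 + 1 := by omega
    rw [List.Ico, this, List.range'_eq_map_range, List.range_succ, List.map_append, List.map_singleton,
      show 4 + (4 * g + p - 4 - 4) = 4 * g + p - 4 by omega]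
  rw [lowerSides, explicitPerm, h1]
  simp only [List.map_append, List.map_cons, List.map_nil, List.map_flatMap,
    sym]
  rw [if_pos (by omega), if_pos (by omega), if_pos (by omega), if_pos (by omega)]
  simp only [List.append_assoc, List.map_eq_flatMap]
  congr 1
  simp
  omega

theorem map_sym_topSides :
    0 :: (topSides g p).map (sym g p) = (explicitPerm g p).top := by
  rw [topSides, explicitPerm]
  simp only [List.map_append, List.map_cons, List.map_nil, List.map_flatMap, sym]
  have hV : (List.range (g - 2)).flatMap (fun k => (sidesV k).map (sym g p)) =
      (List.range (g - 2)).flatMap (wordV g p) := by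
    refine List.flatMap_congr fun k hk => ?_
    rw [List.mem_range] at hk
    simp only [sidesV, wordV, List.map_cons, List.map_nil, sym]
    rw [if_pos (by omega), if_pos (by omega), if_pos (by omega), if_pos (by omega)]
    simp only [List.cons.injEq, and_true, true_and]
    omega
  have hW : (List.range p).flatMap (fun k => (sidesW g k).map (sym g p)) =
      (List.range p).flatMap (wordW g p) := by
    refine List.flatMap_congr fun k hk => ?_
    simp only [sidesW, wordW, List.map_cons, List.map_nil, sym]
    rw [if_neg (by omega), Nat.add_sub_cancel_left]
  rw [hV, hW]
  rfl

theorem mem_lowerSides {e : Side} : e ∈ lowerSides g p ↔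
    e.Valid g p ∧ ((∃ i, e = b i) ∨ ∃ i, i ≤ 3 ∧ e = c i) := by
  simp only [lowerSides, List.mem_append, List.mem_flatMap, List.mem_range, List.mem_cons,
    List.not_mem_nil, or_false]
  constructor
  · rintro ((h | ⟨k, hk, rfl⟩) | rfl)
    · rcases h with rfl | rfl | rfl | rfl | rfl | rfl | rfl <;> simp [Valid] <;> omega
    · simp [Valid]; omega
    · simp [Valid]; omega
  · rintro ⟨h, ⟨i, rfl⟩ | ⟨i, hi, rfl⟩⟩
    · simp only [Valid] at h
      by_cases h4 : i < 4
      · interval_cases i <;> first | omega | simp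
      · by_cases hN : i = 4 * g + p - 4
        · right; rw [hN]
        · left; right; exact ⟨i - 4, by omega, by congr 1; omega⟩
    · interval_cases i <;> simp

theorem mem_topSides {e : Side} : e ∈ topSides g p ↔
    e.Valid g p ∧ ((∃ i, e = t i) ∨ (∃ i, 4 ≤ i ∧ e = c i) ∨ ∃ l, e = z l) := by
  simp only [topSides, List.mem_append, List.mem_flatMap, List.mem_range, List.mem_cons,
    List.not_mem_nil, or_false, sidesV, sidesW]
  constructor
  · rintro (((h | ⟨k, hk, h⟩) | ⟨k, hk, h⟩) | rfl)
    · rcases h with rfl | rfl | rfl <;> simp [Valid] <;> omega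
    · rcases h with rfl | rfl | rfl | rfl | rfl | rfl | rfl | rfl <;> simp [Valid] <;> omega
    · rcases h with rfl | rfl | rfl <;> simp [Valid] <;> omega
    · simp [Valid]; omega
  · rintro ⟨h, ⟨i, rfl⟩ | ⟨i, hi, rfl⟩ | ⟨l, rfl⟩⟩
    · simp only [Valid] at h
      by_cases h4 : i < 4
      · interval_cases i <;> first | omega | simp
      by_cases hN : i = 4 * g + p - 4
      · right; rw [hN]
      by_cases hV : i < 4 * g - 4
      · left; left; right
        refine ⟨i / 4 - 1, by omega, ?_⟩
        simp only [t.injEq, reduceCtorEq, false_or, or_false]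
        omega
      · left; right
        refine ⟨i - (4 * g - 4), by omega, ?_⟩
        simp only [t.injEq, reduceCtorEq, or_false]
        omega
    · simp only [Valid] at h
      by_cases hV : i < 4 * g - 4
      · left; left; right
        refine ⟨i / 4 - 1, by omega, ?_⟩
        simp only [c.injEq, reduceCtorEq, false_or]
        omega
      · left; right
        refine ⟨i - (4 * g - 4), by omega, ?_⟩
        simp only [c.injEq, reduceCtorEq, false_or]
        omega
    · left; right
      exact ⟨l, h, by simp⟩

theorem nodup_lowerSides : (lowerSides g p).Nodup := by
  have hn : ((List.range (4 * g + p - 4 - 4)).flatMap (fun k => [b (4 + k)])).Nodup :=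
    List.nodup_flatMap_range (fun | t _ => 0 | b i => i - 4 | c _ => 0 | z _ => 0) (by simp) (by simp)
  rw [lowerSides, List.nodup_append, List.nodup_append]
  refine ⟨⟨by simp, hn, ?_⟩, by simp, ?_⟩
  · intro x hx y hy
    obtain ⟨k, -, hk⟩ := List.mem_flatMap.1 hy
    simp only [List.mem_cons, List.not_mem_nil, or_false] at hx hk
    subst hk
    rcases hx with rfl | rfl | rfl | rfl | rfl | rfl | rfl <;> simp <;> omega
  · intro x hx y hy
    simp only [List.mem_append, List.mem_flatMap, List.mem_range, List.mem_cons, List.not_mem_nil,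
      or_false] at hx hy
    subst hy
    rcases hx with h | ⟨k, hk, rfl⟩
    · rcases h with rfl | rfl | rfl | rfl | rfl | rfl | rfl <;> simp <;> omega
    · simp; omega

theorem nodup_topSides : (topSides g p).Nodup := by
  have hV : ((List.range (g - 2)).flatMap sidesV).Nodup :=
    List.nodup_flatMap_range (fun | t i => i / 4 - 1 | b _ => 0 | c i => i / 4 - 1 | z _ => 0)
      (by simp [sidesV]) (by
        intro k x hx
        simp only [sidesV, List.mem_cons, List.not_mem_nil, or_false] at hx
        rcases hx with rfl | rfl | rfl | rfl | rfl | rfl | rfl | rfl <;> simp only <;> omega)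
  have hW : ((List.range p).flatMap (sidesW g)).Nodup :=
    List.nodup_flatMap_range (fun | t i => i - (4 * g - 4) | b _ => 0 | c i => i - (4 * g - 4) | z l => l)
      (by simp [sidesW]) (by
        intro k x hx
        simp only [sidesW, List.mem_cons, List.not_mem_nil, or_false] at hx
        rcases hx with rfl | rfl | rfl <;> simp only <;> omega)
  rw [topSides, List.nodup_append, List.nodup_append, List.nodup_append]
  refine ⟨⟨⟨by simp, hV, ?_⟩, hW, ?_⟩, by simp, ?_⟩
  · intro x hx y hy
    simp only [List.mem_flatMap, List.mem_range, List.mem_cons, List.not_mem_nil, or_false,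
      sidesV] at hx hy
    obtain ⟨k, hk, hy⟩ := hy
    rcases hx with rfl | rfl | rfl <;>
      rcases hy with rfl | rfl | rfl | rfl | rfl | rfl | rfl | rfl <;> simp <;> omega
  · intro x hx y hy
    simp only [List.mem_append, List.mem_flatMap, List.mem_range, List.mem_cons, List.not_mem_nil,
      or_false, sidesV, sidesW] at hx hy
    obtain ⟨k, hk, hy⟩ := hy
    rcases hx with hx | ⟨k', hk', hx⟩
    · rcases hx with rfl | rfl | rfl <;> rcases hy with rfl | rfl | rfl <;> simp <;> omega
    · rcases hx with rfl | rfl | rfl | rfl | rfl | rfl | rfl | rfl <;>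
        rcases hy with rfl | rfl | rfl <;> simp <;> omega
  · intro x hx y hy
    simp only [List.mem_append, List.mem_flatMap, List.mem_range, List.mem_cons, List.not_mem_nil,
      or_false, sidesV, sidesW] at hx hy
    subst hy
    rcases hx with (hx | ⟨k', hk', hx⟩) | ⟨k', hk', hx⟩
    · rcases hx with rfl | rfl | rfl <;> simp <;> omega
    · rcases hx with rfl | rfl | rfl | rfl | rfl | rfl | rfl | rfl <;> simp <;> omega
    · rcases hx with rfl | rfl | rfl <;> simp <;> omega

end Side

namespace Blocks

variable {g p n : ℕ} (hg : 3 ≤ g) (B : Blocks (4 * g + p - 4) n)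
include hg

open Side

theorem isChain_lowerSides : (lowerSides g p ++ [c 0]).IsChain (B.Step g) := by
  -- In the bottom word `c i` is followed by `b (j + 1)`, where `c j` is the mate of `c i`.
  have hc : ∀ i j, i ≤ 3 → j = (if i < 2 then i + 2 else i - 2) → B.Step g (c i) (b (j + 1)) := by
    rintro i j hi rfl
    refine B.step_of_mate_eq_c trivial ?_
      (B.next_lab_c_lead_b (i := if i < 2 then i + 2 else i - 2) (by split_ifs <;> omega) (by omega))
    simp only [mate]
    rw [if_pos (by omega), Nat.mod_eq_of_lt (by omega)]
    split_ifs <;> rfl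
  have h1 : ([c 0, b 3, c 3, b 2, c 2, b 1, c 1] ++ [b (4 + 0)]).IsChain (B.Step g) := by
    simp only [List.cons_append, List.nil_append, List.isChain_cons_cons, List.isChain_singleton,
      and_true]
    exact ⟨hc 0 2 (by omega) rfl, B.step_b_c (by omega) (by omega) (by omega),
      hc 3 1 (by omega) rfl, B.step_b_c (by omega) (by omega) (by omega),
      hc 2 0 (by omega) rfl, B.step_b_c (by omega) (by omega) (by omega), hc 1 3 (by omega) rfl⟩
  have h2 := List.isChain_flatMap_range (f := fun k => b (4 + k)) (V := fun _ => []) (n := 4 * g + p - 4 - 4) h1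
    (fun k hk => by
      simp only [List.cons_append, List.nil_append, List.isChain_cons_cons, List.isChain_singleton,
        and_true]
      exact B.step_b_b (by omega) (by omega))
  rw [show 4 + (4 * g + p - 4 - 4) = 4 * g + p - 4 by omega] at h2
  exact List.IsChain.append_overlap (l₃ := [c 0]) h2 (by simpa using B.step_b_last) (by simp)

/-- The upper component is run through from right to left, hence the reversed relation; the extra `t
N` in front closes the cycle. From the index 4 on, in this direction, a side with mate `c i` is
followed by `t i`, and `t (i + 1)` by `c i`. -/
theorem isChain_topSides :
    (t (4 * g + p - 4) :: topSides g p).IsChain (fun x y => B.Step g y x) := by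
  have ht : ∀ i, 1 ≤ i → i ≤ 4 → B.Step g (t i) (t (if i = 1 then 4 * g + p - 4 else i - 1)) :=
    fun i h1 h4 => B.step_t_t h1 h4 (by omega)
  have hct : ∀ (x : Side) i, B.Keep x → x.mate g = c i → 4 ≤ i → i < 4 * g + p - 4 →
      B.Step g x (t i) := fun x i hk hm h4 hN =>
    B.step_of_mate_eq_c hk hm (B.next_lab_c_lead_t h4 hN)
  have htc : ∀ i, 4 ≤ i → i < 4 * g + p - 4 → B.Step g (t (i + 1)) (c i) := fun i h4 hN =>
    B.step_t_c (by omega) (by omega)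
  have h0 : ([t (4 * g + p - 4), t 1, t 2, t 3] ++ [t (4 + 4 * 0)]).IsChain
      (fun x y => B.Step g y x) := by
    simp only [List.cons_append, List.nil_append, List.isChain_cons_cons, List.isChain_singleton,
      and_true]
    exact ⟨ht 1 (by omega) (by omega), ht 2 (by omega) (by omega), ht 3 (by omega) (by omega),
      ht 4 (by omega) (by omega)⟩
  have h1 := List.isChain_flatMap_range (f := fun k => t (4 + 4 * k)) (V := fun k => (sidesV k).tail)
    (n := g - 2) h0 (fun k hk => by
      simp only [sidesV, List.tail_cons, List.cons_append, List.nil_append, List.isChain_cons_cons,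
        List.isChain_singleton, and_true]
      have hm : ∀ i, 4 + 4 * k ≤ i → i < 8 + 4 * k → mate g (c i) =
          c (if i < 6 + 4 * k then i + 2 else i - 2) := by
        intro i h4 h8
        simp only [mate]
        rw [if_pos (by omega)]
        split_ifs <;> first | rfl | omega
      refine ⟨hct (c (6 + 4 * k)) (4 + 4 * k) trivial ?_ (by omega) (by omega),
        ?_,
        hct (c (5 + 4 * k)) (7 + 4 * k) trivial ?_ (by omega) (by omega), ?_,
        hct (c (4 + 4 * k)) (6 + 4 * k) trivial ?_ (by omega) (by omega), ?_,
        hct (c (7 + 4 * k)) (5 + 4 * k) trivial ?_ (by omega) (by omega), ?_⟩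
      · rw [hm _ (by omega) (by omega)]; congr 1; split_ifs <;> omega
      · convert htc (6 + 4 * k) (by omega) (by omega) using 2; omega
      · rw [hm _ (by omega) (by omega)]; congr 1; split_ifs <;> omega
      · convert htc (5 + 4 * k) (by omega) (by omega) using 2; omega
      · rw [hm _ (by omega) (by omega)]; congr 1; split_ifs <;> omega
      · convert htc (4 + 4 * k) (by omega) (by omega) using 2; omega
      · rw [hm _ (by omega) (by omega)]; congr 1; split_ifs <;> omega
      · convert htc (7 + 4 * k) (by omega) (by omega) using 2; omega)
  rw [show 4 + 4 * (g - 2) = 4 * g - 4 + 0 by omega] at h1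
  have h2 := List.isChain_flatMap_range (f := fun l => t (4 * g - 4 + l))
    (V := fun l => (sidesW g l).tail) (n := p) h1 (fun l hl => by
      simp only [sidesW, List.tail_cons, List.cons_append, List.nil_append, List.isChain_cons_cons,
        List.isChain_singleton, and_true]
      refine ⟨hct (z l) (4 * g - 4 + l) trivial rfl (by omega) (by omega), ?_,
        htc (4 * g - 4 + l) (by omega) (by omega)⟩
      have hm : mate g (c (4 * g - 4 + l)) = z l := by
        simp only [mate]
        rw [if_neg (by omega), Nat.add_sub_cancel_left]
      -- Here `c (4g - 4 + l)` is followed by its own mate `z l`, which therefore forms a cycle of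
      -- length one: a simple pole.
      refine ⟨fun _ => ?_, fun h => absurd trivial h⟩
      rw [hm]
      exact ⟨rfl, Or.inr ⟨rfl, rfl⟩⟩)
  rw [show 4 * g - 4 + p = 4 * g + p - 4 by omega] at h2
  exact h2

end Blocks

end

/-! ### Assembly: the erased permutation and its suspensions -/

noncomputable section

theorem List.exists_map_val_eq {α : Type*} {P : α → Prop} (l : List α) (h : ∀ x ∈ l, P x) :
    ∃ l' : List {x // P x}, l'.map Subtype.val = l :=
  ⟨l.attachWith P h, List.attachWith_map_subtype_val h⟩

theorem SuspensionLists.org_lowerHead {π : TwoLines} {α : Type*} [DecidableEq α]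
    (L : SuspensionLists π α) {v : ℕ → ℂ} (hv : π.IsSuspensionData v) :
    L.lowerHead ∈ L.lower ∧ (L.cylinder hv).org L.lowerHead = 0 := by
  have hmem : L.lowerHead ∈ L.lower := List.mem_of_mem_head? L.lower_head
  refine ⟨hmem, ?_⟩
  have horg : (L.cylinder hv).org L.lowerHead =
    (L.lower.lenSum (L.len v) (L.lower.idxOf L.lowerHead) : ℝ) := if_pos hmem
  have h := L.lower_head
  have hidx : L.lower.idxOf L.lowerHead = 0 := by
    cases hl : L.lower with
    | nil => simp [hl] at h
    | cons a l =>
      simp [hl] at h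
      rw [h, List.idxOf_cons_self]
  rw [horg, hidx, List.lenSum_zero, Complex.ofReal_zero]

open Side

theorem Side.sym_ne_zero {g p : ℕ} (hg : 3 ≤ g) {e : Side} (he : e.Valid g p) : e.sym g p ≠ 0 := by
  cases e <;> simp only [Side.sym, Side.Valid] at * <;> (try split_ifs) <;> omega

namespace Blocks

variable {g p n : ℕ} (B : Blocks (4 * g + p - 4) n)

/-- The sides that are not erased. -/
abbrev KeptSide (g p : ℕ) (B : Blocks (4 * g + p - 4) n) : Type :=
  {e : Side // e.Valid g p ∧ B.Keep e}

theorem keep_mate {e : Side} (he : B.Keep e) : B.Keep (e.mate g) := by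
  cases e with
  | t i => exact he
  | b i => exact he
  | c i =>
    simp only [mate]
    split_ifs <;> trivial
  | z l => trivial

theorem finite_keptSide (hg : 3 ≤ g) : Finite (KeptSide g p B) := by
  have h : {e : Side | e ∈ lowerSides g p ++ topSides g p}.Finite := List.finite_toSet _
  suffices hsub : {e : Side | e.Valid g p ∧ B.Keep e} ⊆ {e | e ∈ lowerSides g p ++ topSides g p} from
    (h.subset hsub).to_subtype
  rintro e ⟨he, -⟩
  rw [Set.mem_ofPred_eq, List.mem_append, mem_lowerSides hg, mem_topSides hg]
  cases e with
  | t i => exact Or.inr ⟨he, Or.inl ⟨i, rfl⟩⟩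
  | b i => exact Or.inl ⟨he, Or.inl ⟨i, rfl⟩⟩
  | c i =>
    rcases le_or_gt i 3 with h | h
    · exact Or.inl ⟨he, Or.inr ⟨i, h, rfl⟩⟩
    · exact Or.inr ⟨he, Or.inr (Or.inl ⟨i, h, rfl⟩)⟩
  | z l => exact Or.inr ⟨he, Or.inr (Or.inr ⟨l, rfl⟩)⟩

theorem isChain_filter {l : List Side} (hN : 8 ≤ 4 * g + p - 4) (h : l.IsChain (B.Step g)) :
    (l.filter fun e => B.Keep e).IsChain
      fun x y => IsNextLabel B.size (B.lab (x.mate g)) (B.lab y) := by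
  refine List.IsChain.filter_of_skip (R := fun x q => IsNextLabel B.size (B.lab (x.mate g)) q)
    (P := B.lead) (f := B.lab) (fun x hx => B.lead_eq_lab hN (of_decide_eq_true hx)) ?_
  refine h.imp fun x y hxy => ?_
  simpa only [decide_eq_true_eq, Step] using hxy

/-- Filtering the two full words keeps the relation between consecutive labels, because `lead` skips
the erased sides. The labels of the kept sides then determine `rot`, so the merging of singularities
is purely combinatorial. -/
theorem exists_suspensionLists (hg : 3 ≤ g) (s : Finset ℕ) (h0 : 0 ∉ s)
    (hs : ∀ e : Side, e.Valid g p → (B.Keep e ↔ e.sym g p ∉ s)) :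
    ∃ L : SuspensionLists ((explicitPerm g p).erase s) (KeptSide g p B),
      (∀ e, IsNextLabel B.size (B.lab (L.rot e)) (B.lab e)) ∧ (L.lowerHead : Side) = c 0 ∧
      (∀ e : KeptSide g p B, e ∈ L.lower ↔ (∃ i, e.1 = b i) ∨ ∃ i, i ≤ 3 ∧ e.1 = c i) ∧
      ∀ e, (L.mate e).1 = e.1.mate g := by
  have := B.finite_keptSide hg
  have hN : 8 ≤ 4 * g + p - 4 := by omega
  have valid_lower : ∀ x ∈ (lowerSides g p).filter (fun e => B.Keep e), x.Valid g p ∧ B.Keep x := by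
    intro x hx
    rw [List.mem_filter, mem_lowerSides hg] at hx
    exact ⟨hx.1.1, of_decide_eq_true hx.2⟩
  have valid_upper : ∀ x ∈ ((topSides g p).filter (fun e => B.Keep e)).reverse,
      x.Valid g p ∧ B.Keep x := by
    intro x hx
    rw [List.mem_reverse, List.mem_filter, mem_topSides hg] at hx
    exact ⟨hx.1.1, of_decide_eq_true hx.2⟩
  obtain ⟨lower, hlower⟩ := List.exists_map_val_eq _ valid_lower
  obtain ⟨upper, hupper⟩ := List.exists_map_val_eq _ valid_upper
  let mt : KeptSide g p B → KeptSide g p B := fun e =>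
    ⟨e.1.mate g, valid_mate (by omega) e.2.1, B.keep_mate e.2.2⟩
  let h₀ : KeptSide g p B := ⟨c 0, show 0 < 4 * g + p - 4 by omega, trivial⟩
  let h₁ : KeptSide g p B := ⟨t (4 * g + p - 4),
    show 1 ≤ 4 * g + p - 4 ∧ 4 * g + p - 4 ≤ 4 * g + p - 4 by omega, Or.inl rfl⟩
  have mem_lower : ∀ e : KeptSide g p B, e ∈ lower ↔
      (∃ i, e.1 = b i) ∨ ∃ i, i ≤ 3 ∧ e.1 = c i := by
    intro e
    rw [← List.mem_map_of_injective Subtype.val_injective, hlower, List.mem_filter,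
      mem_lowerSides hg]
    simp [e.2.1, e.2.2]
  have mem_upper : ∀ e : KeptSide g p B, e ∈ upper ↔
      (∃ i, e.1 = t i) ∨ (∃ i, 4 ≤ i ∧ e.1 = c i) ∨ ∃ l, e.1 = z l := by
    intro e
    rw [← List.mem_map_of_injective Subtype.val_injective, hupper, List.mem_reverse,
      List.mem_filter, mem_topSides hg]
    simp [e.2.1, e.2.2]
  have mem : ∀ e, e ∈ lower ∨ e ∈ upper := by
    intro e
    rw [mem_lower, mem_upper]
    obtain ⟨e, he⟩ := e
    cases e with
    | t i => simp
    | b i => simp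
    | c i => simp; omega
    | z l => simp
  have disj : ∀ e, e ∈ lower → e ∈ upper → False := by
    intro e
    rw [mem_lower, mem_upper]
    obtain ⟨e, he⟩ := e
    cases e with
    | t i => simp
    | b i => simp
    | c i => simp; omega
    | z l => simp
  have nodup_lower : lower.Nodup := by
    refine List.Nodup.of_map Subtype.val ?_
    rw [hlower]
    exact (nodup_lowerSides hg).filter _
  have nodup_upper : upper.Nodup := by
    refine List.Nodup.of_map Subtype.val ?_
    rw [hupper, List.nodup_reverse]
    exact (nodup_topSides hg).filter _
  have head_of : ∀ (l : List (KeptSide g p B)) (h : KeptSide g p B),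
      (l.map Subtype.val).head? = some h.1 → l.head? = some h := by
    intro l h hl
    rw [List.head?_map, Option.map_eq_some_iff] at hl
    obtain ⟨a, ha, hah⟩ := hl
    rw [ha, Subtype.ext hah]
  have filter_c : ∀ l : List Side, ((c 0 :: l).filter fun e => B.Keep e) =
      c 0 :: l.filter fun e => B.Keep e := fun l => List.filter_cons_of_pos (decide_eq_true trivial)
  have filter_t : ∀ l : List Side, ((t (4 * g + p - 4) :: l).filter fun e => B.Keep e) =
      t (4 * g + p - 4) :: l.filter fun e => B.Keep e := fun l =>
    List.filter_cons_of_pos (decide_eq_true (Or.inl rfl))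
  have head_lower : lower.head? = some h₀ := by
    refine head_of _ _ ?_
    rw [hlower, lowerSides, List.cons_append, List.cons_append,
      filter_c, List.head?_cons]
  have head_upper : upper.head? = some h₁ := by
    refine head_of _ _ ?_
    rw [hupper, topSides, List.filter_append, filter_t,
      List.reverse_append]
    simp [h₁]
  have lab_inj : Function.Injective fun e : KeptSide g p B => B.lab e.1 := fun e e' h =>
    Subtype.ext (B.lab_injective g p rfl e.2.1 e'.2.1 e.2.2 e'.2.2 h)
  have chain_lower : (lower ++ [h₀]).IsChain
      fun x y => IsNextLabel B.size (B.lab (mt x).1) (B.lab y.1) := by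
    have h := B.isChain_filter hN (B.isChain_lowerSides hg)
    rw [List.filter_append, filter_c, List.filter_nil,
      ← hlower] at h
    exact (List.isChain_map (R := fun x y => IsNextLabel B.size (B.lab (mate g x)) (B.lab y))
      (l := lower ++ [h₀]) Subtype.val).1 (by rw [List.map_append]; exact h)
  have chain_upper : (upper ++ [h₁]).IsChain
      fun x y => IsNextLabel B.size (B.lab (mt x).1) (B.lab y.1) := by
    have h := B.isChain_filter hN (List.isChain_reverse.2 (B.isChain_topSides hg))
    rw [List.filter_reverse, filter_t, List.reverse_cons,
      ← hupper] at h
    exact (List.isChain_map (R := fun x y => IsNextLabel B.size (B.lab (mate g x)) (B.lab y))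
      (l := upper ++ [h₁]) Subtype.val).1 (by rw [List.map_append]; exact h)
  obtain ⟨rot, hrot, hrot'⟩ := exists_perm_of_labels (m := B.size)
    (lab := fun e : KeptSide g p B => B.lab e.1) lab_inj (mate := mt)
    (fun e => Subtype.ext (Side.mate_mate (by omega) e.1)) nodup_lower nodup_upper mem head_lower
    head_upper (fun e => B.lab_lt g p rfl e.2.1) chain_lower chain_upper
  have filter_map : ∀ l : List Side, (∀ e ∈ l, e.Valid g p) →
      (l.map (Side.sym g p)).filter (fun a => a ∉ s) =
        (l.filter fun e => B.Keep e).map (Side.sym g p) := by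
    intro l hl
    rw [List.filter_map]
    congr 1
    refine List.filter_congr fun e he => ?_
    simp [hs e (hl e he)]
  refine ⟨{
    lower := lower, upper := upper, lowerHead := h₀, upperHead := h₁, mate := mt, rot := rot
    lower_nodup := nodup_lower, upper_nodup := nodup_upper, disjoint := disj, mem := mem
    lower_head := head_lower, upper_head := head_upper
    mate_mate := fun e => Subtype.ext (Side.mate_mate (by omega) e.1)
    mate_ne := fun e h => Side.mate_ne g e.1 (congrArg Subtype.val h)
    lower_chain := chain_lower.imp fun x y h => hrot' x y h
    upper_chain := chain_upper.imp fun x y h => hrot' x y h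
    seam := 0
    sym := fun e => e.1.sym g p
    top_eq := ?_
    bot_eq := ?_
    sym_ne := ?_
    sym_mate := fun e => Side.sym_mate (by omega) p e.1
    eq_or_eq_mate := fun e e' h => (Side.eq_or_eq_mate hg e.2.1 e'.2.1 h).imp Subtype.ext Subtype.ext
    head_ne := ?_ }, hrot, rfl, mem_lower, fun e => rfl⟩
  · have : upper.reverse.map (fun e => e.1.sym g p) =
        ((topSides g p).filter fun e => B.Keep e).map (Side.sym g p) := by
      rw [← List.reverse_reverse ((topSides g p).filter fun e => B.Keep e), ← hupper,
        ← List.map_reverse, List.map_map]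
      rfl
    rw [this, TwoLines.erase, ← map_sym_topSides hg, List.filter_cons_of_pos (by simpa using h0),
      filter_map _ fun e he => ((mem_topSides hg).1 he).1]
  · have : lower.map (fun e => e.1.sym g p) =
        ((lowerSides g p).filter fun e => B.Keep e).map (Side.sym g p) := by
      rw [← hlower, List.map_map]
      rfl
    rw [this, TwoLines.erase, ← map_sym_lowerSides hg, List.filter_append,
      List.filter_cons_of_pos (by simpa using h0), List.filter_nil,
      filter_map _ fun e he => ((mem_lowerSides hg).1 he).1]
  · exact fun e => sym_ne_zero hg e.2.1
  · simp only [Side.sym, h₀, h₁]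
    rw [if_pos (by omega)]
    omega

theorem lab_fst {e : Side} (he : e.Valid g p) :
    (∃ j < n, (B.lab e).1 = .inl j) ∨ ∃ l < p, (B.lab e).1 = .inr l := by
  cases e with
  | t i =>
    simp only [Valid] at he
    exact Or.inl ⟨_, B.blk_lt _ (by split_ifs <;> omega), rfl⟩
  | b i =>
    simp only [Valid] at he
    exact Or.inl ⟨_, B.blk_lt _ (by omega), rfl⟩
  | c i => exact Or.inl ⟨_, B.blk_lt _ he, rfl⟩
  | z l => exact Or.inr ⟨l, he, rfl⟩

/-- The erased symbols are the elements of blocks other than their first ones. The symbol N and the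
symbols doubled on one line are at least N, beyond all blocks, and hence survive. -/
theorem keep_iff (hg : 3 ≤ g) {s : Finset ℕ}
    (hs : ∀ i, i ∈ s ↔ ∃ j < n, B.start j < i ∧ i < B.start (j + 1)) {e : Side}
    (he : e.Valid g p) : B.Keep e ↔ e.sym g p ∉ s := by
  have large : ∀ i, 4 * g + p - 4 ≤ i → i ∉ s := by
    intro i hi h
    obtain ⟨j, hj, -, h2⟩ := (hs i).1 h
    have := B.start_le j hj
    omega
  have small : ∀ i, 1 ≤ i ∧ i ≤ 4 * g + p - 4 → ((i = 4 * g + p - 4 ∨ B.lo i = i) ↔ i ∉ s) := by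
    rintro i ⟨h1, h2⟩
    rcases h2.eq_or_lt with h | h
    · exact ⟨fun _ => large i h.ge, fun _ => Or.inl h⟩
    · rw [hs, or_iff_right h.ne]
      have hl := B.lo_le h
      constructor
      · rintro h3 ⟨j, hj, h4, h5⟩
        rw [lo, B.blk_eq i j hj h4.le h5] at h3
        omega
      · intro h3
        by_contra h4
        exact h3 ⟨B.blk i, B.blk_lt i h, lt_of_le_of_ne hl h4, B.lt_hi h⟩
  cases e with
  | t i => exact small i he
  | b i => exact small i he
  | c i =>
    refine iff_of_true trivial (large _ ?_)
    simp only [Side.sym]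
    split_ifs <;> omega
  | z l =>
    refine iff_of_true trivial (large _ ?_)
    simp only [Side.sym]
    simp only [Valid] at he
    omega

end Blocks

theorem mem_erasedSymbols {d : List ℕ} {i : ℕ} : i ∈ erasedSymbols d ↔
    ∃ j < d.length, (d.take j).sum < i ∧ i < (d.take (j + 1)).sum := by
  simp [erasedSymbols]

theorem TwoLines.orders_eq (d : List ℕ) (p : ℕ) : TwoLines.orders d p =
    (Finset.univ : Finset (Fin d.length ⊕ Fin p)).val.map
      (Sum.elim (fun j => (d.get j : ℤ)) fun _ => -1) := by
  rw [← Finset.univ_disjSum_univ, Finset.val_disjSum, Multiset.disjSum, Multiset.map_add,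
    Multiset.map_map, Multiset.map_map, TwoLines.orders]
  congr 1
  · have : (d : Multiset ℕ) = (Finset.univ : Finset (Fin d.length)).val.map d.get := by
      rw [Fin.univ_val_map, List.ofFn_get]
    conv_lhs => rw [this]
    rw [Multiset.map_map]
    rfl
  · rw [eq_comm, Multiset.eq_replicate]
    exact ⟨by simp, fun b hb => Multiset.eq_of_mem_replicate (by simpa using hb)⟩

/-- The suspensions over the permutations obtained by erasing blocks of symbols. -/
theorem suspension_of_erase {g p : ℕ} (hg : 3 ≤ g) {d : List ℕ} (hd : ∀ k ∈ d, 1 ≤ k)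
    (hsum : d.sum = 4 * g + p - 4) :
    let π := (explicitPerm g p).erase (erasedSymbols d)
    π.IsCylindrical ∧ (∃ v, π.IsSuspensionData v) ∧ ∀ v, π.IsSuspensionData v →
      ∃ (_ : ChartedSpace ℂ (π.Surface v)) (_ : IsManifold 𝓘(ℂ) ω (π.Surface v))
        (q : QuadraticDifferential (π.Surface v)),
        π.IsSuspension v q ∧ q.IsOneCylinderJenkinsStrebel ∧ q.InStratum (TwoLines.orders d p) ∧
          ∀ d₁ ∈ d.head?, q.order (π.proj v 0) = ((d₁ : ℤ) : WithTop ℤ) := by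
  intro π
  obtain ⟨B, hB⟩ : ∃ B : Blocks (4 * g + p - 4) d.length, B.start = fun j => (d.take j).sum := by
    rw [← hsum]
    exact d.exists_blocks hd
  have hmem : ∀ i, i ∈ erasedSymbols d ↔ ∃ j < d.length, B.start j < i ∧ i < B.start (j + 1) := by
    intro i
    rw [hB]
    exact mem_erasedSymbols
  obtain ⟨L, hrot, hhead, hlower, hmate⟩ := B.exists_suspensionLists hg (erasedSymbols d)
    (by simp [hmem]) (fun e => B.keep_iff hg hmem)
  have := B.finite_keptSide hg
  let side : (i : ℕ) → i < 4 * g + p - 4 → B.KeptSide g p := fun i hi => ⟨c i, hi, trivial⟩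
  have mate_side : ∀ i (hi : i < 4 * g + p - 4) (h : i + 2 < 4 * g + p - 4), i % 4 < 2 →
      i < 4 * g - 4 → L.mate (side i hi) = side (i + 2) h := by
    intro i hi h h1 h2
    refine Subtype.ext ((hmate _).trans ?_)
    simp only [side, mate, if_pos h1, if_pos h2]
  have lower_iff : ∀ i (hi : i < 4 * g + p - 4), side i hi ∈ L.lower ↔ i ≤ 3 := by
    intro i hi
    rw [hlower]
    simp [side]
  have upper_of : ∀ i (hi : i < 4 * g + p - 4), 4 ≤ i → side i hi ∈ L.upper := fun i hi h4 =>
    (L.mem _).resolve_left ((lower_iff i hi).not.2 (by omega))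
  -- The pair `c 0`, `c 2` lies on the bottom line and the pair `c 4`, `c 6` on the top line; the
  -- latter exists because g ≥ 3.
  have b0 : 0 < 4 * g + p - 4 := by omega
  have b4 : 4 < 4 * g + p - 4 := by omega
  have b2 : 0 + 2 < 4 * g + p - 4 := by omega
  have b6 : 4 + 2 < 4 * g + p - 4 := by omega
  have l0 : side 0 b0 ∈ L.lower := (lower_iff 0 b0).2 (by omega)
  have l0' : L.mate (side 0 b0) ∈ L.lower := by
    rw [mate_side 0 b0 b2 (by omega) (by omega)]
    exact (lower_iff _ b2).2 (by omega)
  have u4 : side 4 b4 ∈ L.upper := upper_of 4 b4 le_rfl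
  have u4' : L.mate (side 4 b4) ∈ L.upper := by
    rw [mate_side 4 b4 b6 (by omega) (by omega)]
    exact upper_of _ b6 (by omega)
  refine ⟨L.isCylindrical l0 l0' u4 u4', L.exists_suspensionData l0 l0' u4 u4', fun v hv => ?_⟩
  have lab_inj : Function.Injective fun e : B.KeptSide g p => B.lab e.1 := fun e e' h =>
    Subtype.ext (B.lab_injective g p rfl e.2.1 e'.2.1 e.2.2 e'.2.2 h)
  have lab_lt : ∀ e : B.KeptSide g p, (B.lab e.1).2 < B.size (B.lab e.1).1 := fun e =>
    B.lab_lt g p rfl e.2.1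
  have cycle_iff : ∀ e e', L.rot.SameCycle e e' ↔ (B.lab e.1).1 = (B.lab e'.1).1 := fun e e' =>
    sameCycle_iff_of_label lab_inj lab_lt hrot
  have period : ∀ e, Function.minimalPeriod L.rot e = B.size (B.lab e.1).1 := fun e =>
    minimalPeriod_eq_of_label lab_inj lab_lt hrot e
  have size_get : ∀ j (hj : j < d.length), B.size (.inl j) = d.get ⟨j, hj⟩ + 2 := by
    intro j hj
    have : B.start (j + 1) = B.start j + d.get ⟨j, hj⟩ := by
      rw [hB]
      simp only [List.take_succ_eq_append_getElem hj, List.sum_append]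
      simp
    simp only [Blocks.size, this]
    omega
  have org0 : (L.cylinder hv).org L.lowerHead = 0 := (L.org_lowerHead hv).2
  have start_lt : ∀ j < d.length, B.start j < 4 * g + p - 4 := fun j hj =>
    (B.start_lt j hj).trans_le (B.start_le j hj)
  refine ⟨(L.gluing hv).chartedSpace, (L.gluing hv).isManifold,
    (L.gluing hv).quadraticDifferential, L.isSuspension hv, ?_, ?_, ?_⟩
  · refine (L.gluing hv).isOneCylinderJenkinsStrebel (fun e => ?_) ⟨L.lowerHead, ?_⟩
      ⟨side 4 b4, ?_⟩
    -- The cycles have lengths d_j + 2 ≥ 3 and, at the poles, 1.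
    · change Function.minimalPeriod L.rot e ≠ 2
      rw [period]
      rcases B.lab_fst e.2.1 with ⟨j, hj, h⟩ | ⟨l, -, h⟩
      · rw [h, size_get j hj]
        have := hd _ (List.get_mem d ⟨j, hj⟩)
        omega
      · rw [h]
        simp [Blocks.size]
    · exact (congrArg Complex.im org0).trans Complex.zero_im
    · refine (((L.gluing hv).sgn_cases (side 4 b4)).resolve_left fun h => ?_).2
      have hs : (L.gluing hv).sgn (side 4 b4) = -1 := if_neg fun h => L.disjoint _ h u4
      rw [hs] at h
      norm_num at h
  · rw [TwoLines.orders_eq]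
    -- The zero of the j-th block is represented by the side `c` of the first element of the block,
    -- the pole l by `z l`. The pair `c 0`, `c 2` on the lower component rules out a global square.
    refine (L.gluing hv).inStratum
      (Sum.elim (fun j : Fin d.length => side (B.start j) (start_lt j j.2))
        fun l : Fin p => ⟨z l, l.2, trivial⟩) _ ?_ ?_ ?_ (e := side 0 b0) ?_
    · intro i j hij
      have := (cycle_iff _ _).1 hij
      rcases i with i | i <;> rcases j with j | j
      · have h : B.blk (B.start i) = B.blk (B.start j) := Sum.inl.inj this
        rw [B.blk_start i.2, B.blk_start j.2] at h
        rw [Fin.ext h]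
      · exact absurd this Sum.inl_ne_inr
      · exact absurd this Sum.inr_ne_inl
      · rw [Fin.ext (Sum.inr.inj this)]
    · intro e
      rcases B.lab_fst e.2.1 with ⟨j, hj, h⟩ | ⟨l, hl, h⟩
      · refine ⟨.inl ⟨j, hj⟩, (cycle_iff _ _).2 ?_⟩
        rw [h]
        exact congrArg Sum.inl (B.blk_start hj)
      · refine ⟨.inr ⟨l, hl⟩, (cycle_iff _ _).2 ?_⟩
        rw [h]
        rfl
    · intro i
      rcases i with i | i
      · have h : Function.minimalPeriod L.rot (side (B.start i) (start_lt i i.2)) =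
            d.get i + 2 := by
          rw [period]
          change B.size (.inl (B.blk (B.start i))) = _
          rw [B.blk_start i.2, size_get i i.2]
        change ((Function.minimalPeriod L.rot (side (B.start i) (start_lt i i.2)) : ℕ) : ℤ) = _
        rw [h]
        simp
      · have h : Function.minimalPeriod L.rot (⟨z i, i.2, trivial⟩ : B.KeptSide g p) = 1 :=
          period _
        change ((Function.minimalPeriod L.rot (⟨z i, i.2, trivial⟩ : B.KeptSide g p) : ℕ) : ℤ) = _
        rw [h]
        simp
    · exact (if_pos l0).trans (if_pos l0').symm
  · intro d₁ hd₁
    -- The left end point of the diagonal is the origin of the first bottom side `c 0`, which lies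
    -- in the first block.
    have hproj : π.proj v 0 = (L.gluing hv).param ((L.gluing hv).org L.lowerHead) := by
      rw [← L.param_eq_proj hv (π.zero_mem_parallelogram v)]
      exact congrArg (L.param hv) org0.symm
    rw [hproj, (L.gluing hv).order_org]
    have h : Function.minimalPeriod L.rot L.lowerHead = d₁ + 2 := by
      rw [period, hhead]
      change B.size (.inl (B.blk 0)) = _
      have hlen : 0 < d.length := by
        rw [List.length_pos_iff]
        rintro rfl
        simp at hd₁
      rw [B.blk_zero b0, size_get 0 hlen]
      congr 1
      rw [Option.mem_def, List.head?_eq_getElem?, List.getElem?_eq_getElem hlen] at hd₁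
      exact Option.some.inj hd₁
    have h' : Function.minimalPeriod (L.gluing hv).rot L.lowerHead = d₁ + 2 := h
    have h2 : ((d₁ + 2 : ℕ) : ℤ) - 2 = d₁ := by omega
    rw [h', h2]

/-- Blocks of length one have no elements strictly between their end points. -/
theorem erase_erasedSymbols_replicate (π : TwoLines) (n : ℕ) :
    π.erase (erasedSymbols (List.replicate n 1)) = π := by
  have h : erasedSymbols (List.replicate n 1) = ∅ := by
    rw [Finset.eq_empty_iff_forall_notMem]
    intro i hi
    obtain ⟨j, hj, h1, h2⟩ := mem_erasedSymbols.1 hi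
    rw [List.take_replicate, List.sum_replicate] at h1 h2
    simp only [smul_eq_mul, mul_one] at h1 h2
    omega
  rw [h, TwoLines.erase]
  simp

end

theorem proposition3p4 (g p : ℕ) (hg : 3 ≤ g) :
    (explicitPerm g p).EncodesOneCylinder
        (TwoLines.orders (List.replicate (4 * g + p - 4) 1) p) ∧
      ∀ d : List ℕ, (∀ k ∈ d, 1 ≤ k) → (d.sum : ℤ) - (p : ℤ) = 4 * (g : ℤ) - 4 →
        ((explicitPerm g p).erase (erasedSymbols d)).Represents d p := by
  constructor
  -- The unerased permutation is the case of 4g + p - 4 blocks of length one.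
  · have h := suspension_of_erase hg (p := p) (d := List.replicate (4 * g + p - 4) 1)
      (fun k hk => (List.eq_of_mem_replicate hk).ge) (by simp)
    rw [erase_erasedSymbols_replicate] at h
    obtain ⟨h1, h2, h3⟩ := h
    refine ⟨h1, h2, fun v hv => ?_⟩
    obtain ⟨cs, mf, q, h4, h5, h6, -⟩ := h3 v hv
    exact ⟨cs, mf, q, h4, h5, h6⟩
  · intro d hd hsum
    obtain ⟨h1, h2, h3⟩ := suspension_of_erase hg (p := p) hd (by omega)
    refine ⟨h1, h2, fun v hv => ?_⟩
    obtain ⟨cs, mf, q, h4, -, h6, h7⟩ := h3 v hv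
    exact ⟨cs, mf, q, h4, h6, h7⟩
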